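/- We work with (smooth, real) supermanifolds. Let $E\to M$ be a vector bundle of supermanifolds, $\Pi E$ its parity reversion, and give the functions on the total space of a vector bundle the weight in which functions on the base have weight $0$ and fibrewise linear functions have weight $1$. For a section $u=u^ke_k$ of $E$ of parity $\tilde u$ let $i(u)=(-1)^{\tilde u}u^k\,\partial/\partial\xi^k$ be the corresponding vector field of weight $-1$ on $\Pi E$. A homological field $Q$ (odd, $[Q,Q]=0$) of weight $1$ on $\Pi E$ *gives* a Lie algebroid structure (anchor $a$, bracket $[\cdot,\cdot]$) on $E\to M$ if $$a(u)f=[[Q,i(u)],f],\qquad i([u,v])=(-1)^{\tilde u}[[Q,i(u)],i(v)]$$ for all (local) functions $f$ on $M$ and homogeneous sections $u,v$ of $E$. For a section $u$ of $E$ let $T(u)$ denote its tangent and $\hat u$ the associated core section, both sections of $TE\to TM$; in coordinates, with $u^k\mathbf e_k+\dot u^k\bar{\mathbf e}_k$ invariant, $T(u)=u^k\mathbf e_k+\dot x^A\partial_Au^k\,\bar{\mathbf e}_k$ and $\hat u=u^k\bar{\mathbf e}_k$. A *tangent prolongation* of a Lie algebroid $E\to M$ is a Lie algebroid structure on the vector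 bundle $TE\to TM$ such that for all local sections $u,v$ of $E$ the anchor sends $T(u)$ and $\hat u$ to the complete lift and the vertical lift of the vector field $a(u)$ to $TM$ (that is, the anchor is $T(a):TE\to TTM$ followed by the canonical involution of $TTM$), and $$[T(u),T(v)]=T([u,v]),\qquad [T(u),\hat v]=\widehat{[u,v]},\qquad [\hat u,\hat v]=0 .$$ For a vector field $X=X^A\partial/\partial x^A$ on a supermanifold $N$, its tangent prolongation is the vector field $\hat X=X^A\,\partial/\partial x^A+\dot x^B\partial_BX^A\,\partial/\partial\dot x^A$ on $TN$. **Proposition 4.2.** Let $E\to M$ be a Lie algebroid given by a homological vector field $Q$ of weight $1$ on $\Pi E$. Then: 1. $TE\to TM$ is a vector bundle whose total space is the tangent bundle of the supermanifold $E$, and regrouping the coordinates, $((x,\xi),(\dot x,\dot\xi))\leftrightarrow((x,\dot x),(\xi,\dot\xi))$, is a diffeomorphism of supermanifolds $T(\Pi E)=\Pi_{TM}TE$, where $\Pi_{TM}TE$ is the parity reversion of the vector bundle $TE\to TM$. 2. The tangent prolongation $\hat Q$ of $Q$ is a homological vector field on $T(\Pi E)$; viewed as a field on $\Pi_{TM}TE$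 it is homological and of weight $1$ with respect to the bundle $\Pi_{TM}TE\to TM$. 3. The Lie algebroid $E\to M$ has exactly one tangent prolongation $TE\to TM$, and a Lie algebroid structure on $TE\to TM$ is this tangent prolongation if and only if it is given by the field $\hat Q$ on $\Pi_{TM}TE$. -/

import Mathlib

open scoped TensorProduct ContDiff
open TopologicalSpace (Opens)

universe u

set_option linter.unusedSectionVars false

noncomputable section

namespace SuperGeom

/-! ## Superdomains

A system of coordinates is a finite type `ι` of labels with a parity `p : ι → ZMod 2`.
The underlying space of the corresponding affine superspace is `Ev p → ℝ`. -/

/-- The labels of the even coordinates. -/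
abbrev Ev {ι : Type*} (p : ι → ZMod 2) : Type _ := {a : ι // p a = 0}

/-- The labels of the odd coordinates. -/
abbrev Od {ι : Type*} (p : ι → ZMod 2) : Type _ := {a : ι // p a = 1}

theorem eq_one_of_ne_zero : ∀ z : ZMod 2, z ≠ 0 → z = 1 := by decide

/-- The sign `(-1)^ε`. -/
def sgn (ε : ZMod 2) : ℝ := if ε = 0 then 1 else -1

theorem sgn_add (a b : ZMod 2) : sgn (a + b) = sgn a * sgn b := by
  have h : (1 : ZMod 2) + 1 = 0 := by decide
  rcases eq_or_ne a 0 with ha | ha <;> rcases eq_or_ne b 0 with hb | hb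
  · simp [sgn, ha, hb]
  · simp [sgn, ha, hb]
  · simp [sgn, ha, hb]
  · rw [eq_one_of_ne_zero a ha, eq_one_of_ne_zero b hb, h]; simp [sgn]

/-- Extension of a function on `U` by zero. -/
def extendZero {X : Type*} [TopologicalSpace X] {U : Opens X} (f : U → ℝ) : X → ℝ :=
  Function.extend Subtype.val f 0

theorem extendZero_apply {X : Type*} [TopologicalSpace X] {U : Opens X} (f : U → ℝ) (x : U) :
    extendZero f x = f x :=
  Subtype.val_injective.extend_apply f 0 x

section Smooth

variable {X : Type*} [NormedAddCommGroup X] [NormedSpace ℝ X]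

/-- The algebra `C^∞(U)` of smooth real functions on an open set `U`. -/
def Smooth (U : Opens X) : Subalgebra ℝ (U → ℝ) where
  carrier := {f | ContDiffOn ℝ ∞ (extendZero f) U}
  mul_mem' {f g} hf hg := (hf.mul hg).congr fun x hx =>
    (extendZero_apply _ (⟨x, hx⟩ : U)).trans (congrArg₂ (· * ·)
      (extendZero_apply f (⟨x, hx⟩ : U)).symm (extendZero_apply g (⟨x, hx⟩ : U)).symm)
  add_mem' {f g} hf hg := (hf.add hg).congr fun x hx =>
    (extendZero_apply _ (⟨x, hx⟩ : U)).trans (congrArg₂ (· + ·)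
      (extendZero_apply f (⟨x, hx⟩ : U)).symm (extendZero_apply g (⟨x, hx⟩ : U)).symm)
  algebraMap_mem' r := (contDiffOn_const (c := r)).congr fun x hx =>
    extendZero_apply _ (⟨x, hx⟩ : U)

/-- A function on `U` which is the restriction of a function smooth on `U`. -/
theorem mem_Smooth_of {U : Opens X} (f : U → ℝ) (g : X → ℝ) (hg : ContDiffOn ℝ ∞ g U)
    (h : ∀ x : U, f x = g x) : f ∈ Smooth U :=
  hg.congr fun x hx => (extendZero_apply f (⟨x, hx⟩ : U)).trans (h ⟨x, hx⟩)

theorem contDiffOn_extendZero {U : Opens X} (f : Smooth U) :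
    ContDiffOn ℝ ∞ (extendZero f.1) U := f.2

/-- The derivative of smooth functions on `U` in the direction of the vector `v`. -/
def dirDeriv (U : Opens X) (v : X) : Smooth U →ₗ[ℝ] Smooth U where
  toFun f := ⟨fun x => fderiv ℝ (extendZero f.1) x v,
    mem_Smooth_of _ (fun x => fderiv ℝ (extendZero f.1) x v)
      (((contDiffOn_extendZero f).fderiv_of_isOpen U.isOpen (m := ∞) le_rfl).clm_apply
        contDiffOn_const) fun _ => rfl⟩
  map_add' f g := by
    ext x
    have hf := ((contDiffOn_extendZero f).differentiableOn (by simp)).differentiableAt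
      (U.isOpen.mem_nhds x.2)
    have hg := ((contDiffOn_extendZero g).differentiableOn (by simp)).differentiableAt
      (U.isOpen.mem_nhds x.2)
    have : extendZero (f + g).1 = extendZero f.1 + extendZero g.1 := by
      funext y
      by_cases hy : y ∈ U
      · exact (extendZero_apply _ (⟨y, hy⟩ : U)).trans (congrArg₂ (· + ·)
          (extendZero_apply f.1 (⟨y, hy⟩ : U)).symm (extendZero_apply g.1 (⟨y, hy⟩ : U)).symm)
      · simp [extendZero, hy]
    change fderiv ℝ (extendZero (f + g).1) x v = _
    rw [this, fderiv_add hf hg]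
    rfl
  map_smul' c f := by
    ext x
    have hf := ((contDiffOn_extendZero f).differentiableOn (by simp)).differentiableAt
      (U.isOpen.mem_nhds x.2)
    have : extendZero (c • f).1 = c • extendZero f.1 := by
      funext y
      by_cases hy : y ∈ U
      · exact (extendZero_apply _ (⟨y, hy⟩ : U)).trans (congrArg (c * ·)
          (extendZero_apply f.1 (⟨y, hy⟩ : U)).symm)
      · simp [extendZero, hy]
    change fderiv ℝ (extendZero (c • f).1) x v = _
    rw [this, fderiv_const_smul hf]
    rfl

/-- Composition of smooth functions with a smooth map. -/
def smoothComp {Y : Type*} [NormedAddCommGroup Y] [NormedSpace ℝ Y] {U : Opens X} {V : Opens Y}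
    (b : X → Y) (hb : ContDiffOn ℝ ∞ b U) (hV : ∀ x : U, b x ∈ V) : Smooth V →ₐ[ℝ] Smooth U where
  toFun f := ⟨fun x => f.1 ⟨b x, hV x⟩, mem_Smooth_of _ (extendZero f.1 ∘ b)
    ((contDiffOn_extendZero f).comp hb fun x hx => hV ⟨x, hx⟩)
    fun x => (extendZero_apply f.1 (⟨b x, hV x⟩ : V)).symm⟩
  map_one' := rfl
  map_mul' _ _ := rfl
  map_zero' := rfl
  map_add' _ _ := rfl
  commutes' _ := rfl

end Smooth

section Superdomain

variable {ι ι' κ : Type*} {p : ι → ZMod 2} {p' : ι' → ZMod 2} [Fintype ι] [Fintype ι']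

/-- The superalgebra of functions on the superdomain over `U`: smooth functions of the even
coordinates with values in the exterior algebra generated by the odd coordinates. -/
def SF (U : Opens (Ev p → ℝ)) : Type _ :=
  Smooth U ⊗[ℝ] ExteriorAlgebra ℝ (Od p → ℝ)

instance (U : Opens (Ev p → ℝ)) : Ring (SF U) :=
  inferInstanceAs (Ring (Smooth U ⊗[ℝ] ExteriorAlgebra ℝ (Od p → ℝ)))

instance (U : Opens (Ev p → ℝ)) : Algebra ℝ (SF U) :=
  inferInstanceAs (Algebra ℝ (Smooth U ⊗[ℝ] ExteriorAlgebra ℝ (Od p → ℝ)))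

/-- The identification of `SF U` with the tensor product. -/
def SF.toTensor (U : Opens (Ev p → ℝ)) :
    SF U ≃ₐ[ℝ] Smooth U ⊗[ℝ] ExteriorAlgebra ℝ (Od p → ℝ) :=
  show (Smooth U ⊗[ℝ] ExteriorAlgebra ℝ (Od p → ℝ)) ≃ₐ[ℝ] _ from AlgEquiv.refl

/-- The product of a smooth function of the even coordinates and an element of the exterior
algebra generated by the odd coordinates. -/
def SF.mk (U : Opens (Ev p → ℝ)) :
    Smooth U →ₗ[ℝ] ExteriorAlgebra ℝ (Od p → ℝ) →ₗ[ℝ] SF U :=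
  (TensorProduct.mk ℝ (Smooth U) (ExteriorAlgebra ℝ (Od p → ℝ))).compr₂
    (SF.toTensor U).symm.toLinearMap

/-- The linear map on `SF U` given by a bilinear map. -/
def SF.lift {U : Opens (Ev p → ℝ)} {M : Type*} [AddCommGroup M] [Module ℝ M]
    (b : Smooth U →ₗ[ℝ] ExteriorAlgebra ℝ (Od p → ℝ) →ₗ[ℝ] M) : SF U →ₗ[ℝ] M :=
  TensorProduct.lift b ∘ₗ (SF.toTensor U).toLinearMap

theorem SF.lift_mk {U : Opens (Ev p → ℝ)} {M : Type*} [AddCommGroup M] [Module ℝ M]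
    (b : Smooth U →ₗ[ℝ] ExteriorAlgebra ℝ (Od p → ℝ) →ₗ[ℝ] M) (f : Smooth U)
    (x : ExteriorAlgebra ℝ (Od p → ℝ)) : SF.lift b (SF.mk U f x) = b f x :=
  TensorProduct.lift.tmul f x

theorem SF.mk_mul_mk (U : Opens (Ev p → ℝ)) (f g : Smooth U)
    (x y : ExteriorAlgebra ℝ (Od p → ℝ)) :
    SF.mk U f x * SF.mk U g y = SF.mk U (f * g) (x * y) :=
  Algebra.TensorProduct.tmul_mul_tmul f g x y

theorem SF.induction {U : Opens (Ev p → ℝ)} {C : SF U → Prop}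
    (mk : ∀ f x, C (SF.mk U f x)) (add : ∀ a b, C a → C b → C (a + b)) (a : SF U) : C a := by
  refine TensorProduct.induction_on (motive := C) a ?_ mk add
  have := mk 0 0
  rwa [map_zero] at this

/-- The even coordinate functions on the underlying open set. -/
def evenCoord (U : Opens (Ev p → ℝ)) (a : Ev p) : Smooth U :=
  ⟨fun x => x.1 a, mem_Smooth_of _ (fun x => x a) (contDiff_apply ℝ ℝ a).contDiffOn fun _ => rfl⟩

/-- The coordinate functions of a superdomain. -/
def coord [DecidableEq ι] (U : Opens (Ev p → ℝ)) (A : ι) : SF U :=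
  if h : p A = 0 then SF.mk U (evenCoord U ⟨A, h⟩) 1
  else SF.mk U 1 (ExteriorAlgebra.ι ℝ (Pi.single ⟨A, eq_one_of_ne_zero _ h⟩ 1))

/-- The parity automorphism: `f ↦ (-1)^(parity of f) f` on homogeneous functions. -/
def invol (U : Opens (Ev p → ℝ)) : SF U →ₐ[ℝ] SF U :=
  (SF.toTensor U).symm.toAlgHom.comp ((Algebra.TensorProduct.map (AlgHom.id ℝ (Smooth U))
    (CliffordAlgebra.involute (Q := (0 : QuadraticForm ℝ (Od p → ℝ))))).comp
      (SF.toTensor U).toAlgHom)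

/-- `f` is homogeneous of parity `ε`. -/
def HasParity {U : Opens (Ev p → ℝ)} (ε : ZMod 2) (f : SF U) : Prop :=
  invol U f = sgn ε • f

/-- The function on the underlying open set: all odd coordinates are set to zero. -/
def body (U : Opens (Ev p → ℝ)) : SF U →ₐ[ℝ] Smooth U :=
  (Algebra.TensorProduct.rid ℝ ℝ (Smooth U)).toAlgHom.comp
    ((Algebra.TensorProduct.map (AlgHom.id ℝ (Smooth U)) ExteriorAlgebra.algebraMapInv).comp
      (SF.toTensor U).toAlgHom)

/-- The (left) partial derivative `∂/∂x^A`. -/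
def pd [DecidableEq ι] (U : Opens (Ev p → ℝ)) (A : ι) : SF U →ₗ[ℝ] SF U :=
  if h : p A = 0 then SF.lift (SF.mk U ∘ₗ dirDeriv U (Pi.single ⟨A, h⟩ 1))
  else SF.lift ((SF.mk U).compl₂ (CliffordAlgebra.contractLeft
    (Q := (0 : QuadraticForm ℝ (Od p → ℝ))) (LinearMap.proj ⟨A, eq_one_of_ne_zero _ h⟩)))

/-- Restriction of functions to a smaller superdomain. -/
def res {U W : Opens (Ev p → ℝ)} (h : W ≤ U) : SF U →ₐ[ℝ] SF W :=
  (SF.toTensor W).symm.toAlgHom.comp ((Algebra.TensorProduct.map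
    (smoothComp id contDiffOn_id fun x => h x.2) (AlgHom.id ℝ (ExteriorAlgebra ℝ (Od p → ℝ)))).comp
      (SF.toTensor U).toAlgHom)

/-! ### Basic facts on parity -/

theorem involute_mul_anticomm {M : Type*} [AddCommGroup M] [Module ℝ M]
    (x y : ExteriorAlgebra ℝ M)
    (hx : CliffordAlgebra.involute (Q := (0 : QuadraticForm ℝ M)) x = -x) :
    x * y = CliffordAlgebra.involute (Q := (0 : QuadraticForm ℝ M)) y * x := by
  have key : ∀ (v : M) (z : ExteriorAlgebra ℝ M), ExteriorAlgebra.ι ℝ v * z =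
      CliffordAlgebra.involute (Q := (0 : QuadraticForm ℝ M)) z * ExteriorAlgebra.ι ℝ v := by
    intro v z
    induction z using ExteriorAlgebra.induction with
    | algebraMap r => rw [AlgHom.commutes]; exact (Algebra.commutes r _).symm
    | ι w =>
      rw [show CliffordAlgebra.involute (Q := (0 : QuadraticForm ℝ M)) (ExteriorAlgebra.ι ℝ w) =
        -ExteriorAlgebra.ι ℝ w from CliffordAlgebra.involute_ι w, neg_mul]
      exact eq_neg_of_add_eq_zero_left (ExteriorAlgebra.ι_add_mul_swap v w)
    | mul a b ha hb => rw [map_mul, ← mul_assoc, ha, mul_assoc, hb, ← mul_assoc]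
    | add a b ha hb => rw [map_add, mul_add, add_mul, ha, hb]
  induction y using ExteriorAlgebra.induction with
  | algebraMap r => rw [AlgHom.commutes]; exact (Algebra.commutes r _).symm
  | ι v =>
    rw [show CliffordAlgebra.involute (Q := (0 : QuadraticForm ℝ M)) (ExteriorAlgebra.ι ℝ v) =
      -ExteriorAlgebra.ι ℝ v from CliffordAlgebra.involute_ι v, neg_mul, key, hx, neg_mul, neg_neg]
  | mul a b ha hb => rw [map_mul, ← mul_assoc, ha, mul_assoc, hb, ← mul_assoc]
  | add a b ha hb => rw [map_add, mul_add, add_mul, ha, hb]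

section Parity

variable {U : Opens (Ev p → ℝ)}

theorem invol_mk (f : Smooth U) (x : ExteriorAlgebra ℝ (Od p → ℝ)) :
    invol U (SF.mk U f x) =
      SF.mk U f (CliffordAlgebra.involute (Q := (0 : QuadraticForm ℝ (Od p → ℝ))) x) :=
  rfl

theorem HasParity.mul {ε δ : ZMod 2} {f g : SF U} (hf : HasParity ε f) (hg : HasParity δ g) :
    HasParity (ε + δ) (f * g) := by
  unfold HasParity at *
  rw [map_mul, hf, hg, smul_mul_smul_comm, sgn_add]

theorem HasParity.add {ε : ZMod 2} {f g : SF U} (hf : HasParity ε f) (hg : HasParity ε g) :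
    HasParity ε (f + g) := by
  unfold HasParity at *
  rw [map_add, hf, hg, smul_add]

theorem HasParity.sum {ε : ZMod 2} {α : Type*} (s : Finset α) (f : α → SF U)
    (hf : ∀ i ∈ s, HasParity ε (f i)) : HasParity ε (∑ i ∈ s, f i) := by
  unfold HasParity at *
  rw [map_sum, Finset.smul_sum]
  exact Finset.sum_congr rfl hf

theorem hasParity_zero (ε : ZMod 2) : HasParity ε (0 : SF U) := by
  simp [HasParity]

theorem hasParity_coord [DecidableEq ι] (A : ι) : HasParity (p A) (coord U A) := by
  unfold HasParity coord
  split_ifs with h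
  · simp [invol_mk, sgn, h]
  · rw [invol_mk, show CliffordAlgebra.involute (Q := (0 : QuadraticForm ℝ (Od p → ℝ)))
      (ExteriorAlgebra.ι ℝ _) = -ExteriorAlgebra.ι ℝ _ from CliffordAlgebra.involute_ι _]
    simp [sgn, h]

theorem hasParity_smooth (f : Smooth U) :
    HasParity 0 (SF.mk U f 1) := by
  simp [HasParity, invol_mk, sgn]

theorem body_mk (f : Smooth U) (x : ExteriorAlgebra ℝ (Od p → ℝ)) :
    body U (SF.mk U f x) = ExteriorAlgebra.algebraMapInv x • f := by
  change Algebra.TensorProduct.rid ℝ ℝ (Smooth U)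
    (f ⊗ₜ[ℝ] (ExteriorAlgebra.algebraMapInv x : ℝ)) = _
  exact Algebra.TensorProduct.rid_tmul (R := ℝ) ℝ _ _

/-- Odd functions square to zero. -/
theorem HasParity.sq_zero {f : SF U} (hf : HasParity 1 f) : f * f = 0 := by
  have h : ∀ a b : SF U, (a - invol U a) * (b - invol U b) =
      -((b - invol U b) * (a - invol U a)) := by
    intro a b
    induction a using SF.induction with
    | add a₁ a₂ h₁ h₂ =>
      rw [map_add, add_sub_add_comm a₁ a₂, add_mul, h₁, h₂, mul_add, neg_add]
    | mk r x =>
      induction b using SF.induction with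
      | add b₁ b₂ h₁ h₂ =>
        rw [map_add, add_sub_add_comm b₁ b₂, add_mul, mul_add, h₁, h₂, neg_add]
      | mk s y =>
        rw [invol_mk, invol_mk, ← map_sub, ← map_sub, SF.mk_mul_mk, SF.mk_mul_mk, mul_comm s r,
          ← map_neg, ← neg_mul, involute_mul_anticomm]
        · congr 2
          simp
        · simp
  have h2 := h f f
  rw [show invol U f = -f by rw [hf]; simp [sgn]] at h2
  have h3 : (4 : ℝ) • (f * f) = -((4 : ℝ) • (f * f)) := by
    have e : (f - -f) * (f - -f) = (4 : ℝ) • (f * f) := by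
      rw [sub_neg_eq_add, ← two_smul ℝ f, smul_mul_smul_comm]; norm_num
    rwa [e] at h2
  have h4 : (8 : ℝ) • (f * f) = 0 := by
    rw [show (8 : ℝ) = 4 + 4 by norm_num, add_smul]
    nth_rewrite 1 [h3]
    simp
  exact (smul_eq_zero.mp h4).resolve_left (by norm_num)

end Parity

/-! ### Morphisms of superdomains -/

/-- A morphism of superdomains `U → V`, given by the pullbacks of the coordinates of `V`, which
have the right parities and whose bodies map the set `U` to the set `V`. -/
structure Mor (U : Opens (Ev p → ℝ)) (V : Opens (Ev p' → ℝ)) where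
  comp : ι' → SF U
  parity : ∀ B, HasParity (p' B) (comp B)
  maps : ∀ x : U, (fun b : Ev p' => (body U (comp b)).1 x) ∈ V

namespace Mor

variable {U : Opens (Ev p → ℝ)} {V : Opens (Ev p' → ℝ)}

/-- The underlying map of a morphism. -/
def point (φ : Mor U V) (x : U) : Ev p' → ℝ := fun b => (body U (φ.comp b)).1 x

/-- Pullback of smooth functions by the underlying map. -/
def pullBody (φ : Mor U V) : Smooth V →ₐ[ℝ] Smooth U :=
  smoothComp (fun x b => extendZero (body U (φ.comp b)).1 x)
    (contDiffOn_pi.2 fun b => (body U (φ.comp b)).2)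
    (fun x => by simpa only [extendZero_apply] using φ.maps x)

/-- The nilpotent part of the pullback of an even coordinate. -/
def nil (φ : Mor U V) (b : Ev p') : SF U := φ.comp b - SF.mk U (body U (φ.comp b)) 1

/-- `f ↦ ∑ n^(b₁) ⋯ n^(b_k) (∂_(b₁) ⋯ ∂_(b_k) f)(body)`, where `n^b` are the nilpotent parts of the
pullbacks of the even coordinates. -/
def taylorTerm [DecidableEq ι'] (φ : Mor U V) : ℕ → Smooth V →ₗ[ℝ] SF U
  | 0 => (SF.mk U).flip 1 ∘ₗ φ.pullBody.toLinearMap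
  | k + 1 => ∑ b : Ev p', LinearMap.mulLeft ℝ (φ.nil b) ∘ₗ taylorTerm φ k ∘ₗ
      dirDeriv V (Pi.single b 1)

/-- Substitution of the (even) functions `φ.comp b` into a smooth function of even coordinates, by
the Taylor expansion around the bodies, which is finite because the deviations are nilpotent. -/
def taylor [DecidableEq ι'] (φ : Mor U V) : Smooth V →ₗ[ℝ] SF U :=
  ∑ k ∈ Finset.range (Fintype.card ι + 1), ((k.factorial : ℝ)⁻¹) • φ.taylorTerm k

/-- Substitution of the odd functions `φ.comp b` for the odd coordinates. -/
def subOdd (φ : Mor U V) : ExteriorAlgebra ℝ (Od p' → ℝ) →ₐ[ℝ] SF U :=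
  ExteriorAlgebra.lift ℝ ⟨∑ b : Od p', (LinearMap.proj b).smulRight (φ.comp b), fun v => by
    refine HasParity.sq_zero ?_
    rw [LinearMap.sum_apply]
    refine HasParity.sum _ _ fun b _ => ?_
    have h := φ.parity b.1
    rw [b.2] at h
    unfold HasParity at *
    simp only [LinearMap.smulRight_apply, LinearMap.proj_apply]
    rw [map_smul, h, smul_comm]⟩

/-- The pullback of functions by a morphism of superdomains. -/
def pull [DecidableEq ι'] (φ : Mor U V) : SF V →ₗ[ℝ] SF U :=
  SF.lift ((LinearMap.mul ℝ (SF U)).compl₁₂ φ.taylor φ.subOdd.toLinearMap)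

theorem hasParity_nil (φ : Mor U V) (b : Ev p') : HasParity 0 (φ.nil b) := by
  have h := φ.parity b.1
  rw [b.2] at h
  have h' := hasParity_smooth (body U (φ.comp b))
  unfold HasParity nil at *
  rw [map_sub, h, h', smul_sub]

theorem body_nil (φ : Mor U V) (b : Ev p') : body U (φ.nil b) = 0 := by
  rw [nil, map_sub, body_mk]
  simp

theorem hasParity_taylorTerm [DecidableEq ι'] (φ : Mor U V) (k : ℕ) (f : Smooth V) :
    HasParity 0 (φ.taylorTerm k f) := by
  induction k generalizing f with
  | zero => exact hasParity_smooth _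
  | succ k ih =>
    rw [taylorTerm, LinearMap.sum_apply]
    refine HasParity.sum _ _ fun b _ => ?_
    have := (φ.hasParity_nil b).mul (ih (dirDeriv V (Pi.single b 1) f))
    rwa [add_zero] at this

theorem hasParity_taylor [DecidableEq ι'] (φ : Mor U V) (f : Smooth V) :
    HasParity 0 (φ.taylor f) := by
  rw [taylor, LinearMap.sum_apply]
  refine HasParity.sum _ _ fun k _ => ?_
  have := φ.hasParity_taylorTerm k f
  unfold HasParity at *
  rw [LinearMap.smul_apply, map_smul, this, smul_comm]

theorem invol_subOdd (φ : Mor U V) (x : ExteriorAlgebra ℝ (Od p' → ℝ)) :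
    invol U (φ.subOdd x) =
      φ.subOdd (CliffordAlgebra.involute (Q := (0 : QuadraticForm ℝ (Od p' → ℝ))) x) := by
  have : (invol U).comp φ.subOdd =
      φ.subOdd.comp (CliffordAlgebra.involute (Q := (0 : QuadraticForm ℝ (Od p' → ℝ)))) := by
    apply ExteriorAlgebra.hom_ext
    ext1 v
    change invol U (φ.subOdd (ExteriorAlgebra.ι ℝ _)) = φ.subOdd (CliffordAlgebra.involute
      (Q := (0 : QuadraticForm ℝ (Od p' → ℝ))) (ExteriorAlgebra.ι ℝ _))
    rw [show CliffordAlgebra.involute (Q := (0 : QuadraticForm ℝ (Od p' → ℝ)))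
      (ExteriorAlgebra.ι ℝ _) = -ExteriorAlgebra.ι ℝ _ from CliffordAlgebra.involute_ι _, map_neg,
      subOdd, ExteriorAlgebra.lift_ι_apply, LinearMap.sum_apply, map_sum, ← Finset.sum_neg_distrib]
    refine Finset.sum_congr rfl fun b _ => ?_
    have h := φ.parity b.1
    rw [b.2] at h
    unfold HasParity at h
    simp only [LinearMap.smulRight_apply, LinearMap.proj_apply]
    rw [map_smul, h]
    simp [sgn]
  exact DFunLike.congr_fun this x

theorem invol_pull [DecidableEq ι'] (φ : Mor U V) (f : SF V) :
    invol U (φ.pull f) = φ.pull (invol V f) := by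
  induction f using SF.induction with
  | add a b ha hb => simp only [map_add, ha, hb]
  | mk f x =>
    change invol U (φ.taylor f * φ.subOdd x) = φ.taylor f * φ.subOdd _
    have := φ.hasParity_taylor f
    unfold HasParity at this
    rw [map_mul, this, invol_subOdd]
    simp [sgn]

theorem hasParity_pull [DecidableEq ι'] (φ : Mor U V) {ε : ZMod 2} {f : SF V}
    (hf : HasParity ε f) : HasParity ε (φ.pull f) := by
  unfold HasParity at *
  rw [invol_pull, hf, map_smul]

theorem body_pull [DecidableEq ι'] (φ : Mor U V) (f : SF V) :
    body U (φ.pull f) = φ.pullBody (body V f) := by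
  induction f using SF.induction with
  | add a b ha hb => simp only [map_add, ha, hb]
  | mk f x =>
    change body U (φ.taylor f * φ.subOdd x) = _
    have h0 : body U (φ.taylor f) = φ.pullBody f := by
      rw [taylor, LinearMap.sum_apply, map_sum, Finset.sum_eq_single_of_mem 0 (by simp)]
      · simp only [Nat.factorial_zero, Nat.cast_one, inv_one, one_smul]
        change body U (SF.mk U (φ.pullBody f) 1) = _
        rw [body_mk]
        simp
      · intro k _ hk
        obtain ⟨k, rfl⟩ := Nat.exists_eq_succ_of_ne_zero hk
        rw [LinearMap.smul_apply, map_smul, Nat.succ_eq_add_one, taylorTerm, LinearMap.sum_apply,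
          map_sum, Finset.sum_eq_zero, smul_zero]
        intro b _
        change body U (φ.nil b * _) = 0
        rw [map_mul, body_nil, zero_mul]
    have h1 : (body U).comp φ.subOdd =
        (Algebra.ofId ℝ (Smooth U)).comp
          (ExteriorAlgebra.algebraMapInv (M := Od p' → ℝ)) := by
      apply ExteriorAlgebra.hom_ext
      refine LinearMap.ext fun v => ?_
      change body U (φ.subOdd (ExteriorAlgebra.ι ℝ v)) =
        algebraMap ℝ (Smooth U) (ExteriorAlgebra.algebraMapInv (ExteriorAlgebra.ι ℝ v))
      have hodd : ∀ b : Od p', body U (φ.comp b) = 0 := by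
        intro b
        have h := (φ.parity b.1)
        rw [b.2] at h
        have h2 : body U (φ.comp b) * body U (φ.comp b) = 0 := by
          rw [← map_mul, h.sq_zero, map_zero]
        ext x
        have h3 := congrFun (congrArg Subtype.val h2) x
        exact mul_self_eq_zero.mp h3
      rw [subOdd, ExteriorAlgebra.lift_ι_apply, LinearMap.sum_apply, map_sum]
      rw [Finset.sum_eq_zero, ExteriorAlgebra.algebraMapInv, ExteriorAlgebra.lift_ι_apply]
      · simp
      · intro b _
        simp [hodd]
    have h1' := DFunLike.congr_fun h1 x
    change body U (φ.subOdd x) = algebraMap ℝ _ (ExteriorAlgebra.algebraMapInv x) at h1'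
    rw [map_mul, h0, h1', body_mk, map_smul, mul_comm, Algebra.smul_def]

end Mor

theorem body_coord [DecidableEq ι] (U : Opens (Ev p → ℝ)) (a : Ev p) :
    body U (coord U a) = evenCoord U a := by
  rw [coord, dif_pos a.2, body_mk]
  simp

theorem body_res {U W : Opens (Ev p → ℝ)} (h : W ≤ U) (f : SF U) :
    body W (res h f) = smoothComp id contDiffOn_id (fun x => h x.2) (body U f) := by
  induction f using SF.induction with
  | add a b ha hb => simp only [map_add, ha, hb]
  | mk f x =>
    change body W (SF.mk W (smoothComp id contDiffOn_id _ f) x) = _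
    rw [body_mk, body_mk, map_smul]

theorem HasParity.res {U W : Opens (Ev p → ℝ)} (h : W ≤ U) {ε : ZMod 2} {f : SF U}
    (hf : HasParity ε f) : HasParity ε (res h f) := by
  have key : ∀ g : SF U, invol W (SuperGeom.res h g) = SuperGeom.res h (invol U g) := by
    intro g
    induction g using SF.induction with
    | add a b ha hb => simp only [map_add, ha, hb]
    | mk f x => rfl
  unfold HasParity at *
  rw [key, hf, map_smul]

/-- Restriction of a morphism to open subsets of the source and of the target. -/
def Mor.restr {U W : Opens (Ev p → ℝ)} {V V' : Opens (Ev p' → ℝ)} (φ : Mor U V) (h : W ≤ U)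
    (hV : ∀ x : W, φ.point ⟨x, h x.2⟩ ∈ V') : Mor W V' where
  comp B := res h (φ.comp B)
  parity B := (φ.parity B).res h
  maps x := by
    simp only [body_res]
    exact hV x

/-- The morphism whose components are coordinate functions. -/
def coordMor [DecidableEq ι] {U : Opens (Ev p → ℝ)} {V : Opens (Ev p' → ℝ)} (σ : ι' → ι)
    (hσ : ∀ B, p (σ B) = p' B)
    (h : ∀ x ∈ U, (fun b : Ev p' => x ⟨σ b.1, (hσ b.1).trans b.2⟩) ∈ V) : Mor U V where
  comp B := coord U (σ B)
  parity B := hσ B ▸ hasParity_coord (σ B)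
  maps x := by
    convert h x x.2 using 2 with b
    exact congrFun (congrArg Subtype.val
      (body_coord U (⟨σ b.1, (hσ b.1).trans b.2⟩ : Ev p))) x

/-! ### Vector fields on superdomains -/

/-- A vector field `X = ∑ X^A ∂/∂x^A` on a superdomain, given by its components. -/
abbrev VF (U : Opens (Ev p → ℝ)) : Type _ := ι → SF U

/-- The action of a vector field on functions. -/
def VF.apply [DecidableEq ι] {U : Opens (Ev p → ℝ)} (X : VF U) (f : SF U) : SF U :=
  ∑ A, X A * pd U A f

/-- The vector field is homogeneous of parity `ε`. -/
def VF.HasParity {U : Opens (Ev p → ℝ)} (ε : ZMod 2) (X : VF U) : Prop :=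
  ∀ A, SuperGeom.HasParity (ε + p A) (X A)

/-- The commutator `[X, Y] = XY - (-1)^(εδ) YX` of vector fields of parities `ε` and `δ`. -/
def VF.bracket [DecidableEq ι] {U : Opens (Ev p → ℝ)} (ε δ : ZMod 2) (X Y : VF U) : VF U :=
  fun A => X.apply (Y A) - sgn (ε * δ) • Y.apply (X A)

/-- Restriction of a vector field. -/
def VF.restr {U W : Opens (Ev p → ℝ)} (h : W ≤ U) (X : VF U) : VF W := fun A => res h (X A)

/-- The vector fields `X` and `Y` are `φ`-related. -/
def VF.Related [DecidableEq ι] [DecidableEq ι'] {U : Opens (Ev p → ℝ)} {V : Opens (Ev p' → ℝ)}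
    (φ : Mor U V) (X : VF U) (Y : VF V) : Prop :=
  ∀ B, X.apply (φ.comp B) = φ.pull (Y B)

end Superdomain

/-! ### Products with affine superspaces, tangent lifts -/

section Cylinder

variable {ι ι' κ : Type*} {p : ι → ZMod 2} {p' : ι' → ZMod 2} [Fintype ι] [Fintype ι'] [Fintype κ]
  [DecidableEq ι] [DecidableEq ι'] [DecidableEq κ]

/-- The underlying open set of the product of the superdomain `U` with the affine superspace with
coordinates of parities `r`. -/
def cyl (U : Opens (Ev p → ℝ)) (r : κ → ZMod 2) : Opens (Ev (Sum.elim p r) → ℝ) :=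
  U.comap ⟨fun y a => y ⟨Sum.inl a.1, a.2⟩, by fun_prop⟩

theorem cyl_mono {U V : Opens (Ev p → ℝ)} (h : U ≤ V) (r : κ → ZMod 2) : cyl U r ≤ cyl V r :=
  fun _ hy => h hy

/-- The projection `U × affine superspace → U`. -/
def pr (U : Opens (Ev p → ℝ)) (r : κ → ZMod 2) : Mor (cyl U r) U :=
  coordMor Sum.inl (fun _ => rfl) fun _ hx => hx

/-- The tangent bundle of a superdomain `U` has coordinates `x^A` (label `inl A`) and their
differentials (label `inr A`, same parity); this is its underlying open set. -/
abbrev tan (U : Opens (Ev p → ℝ)) : Opens (Ev (Sum.elim p p) → ℝ) := cyl U p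

/-- The even differential of a function, as a function on the tangent bundle. -/
def diff {U : Opens (Ev p → ℝ)} (f : SF U) : SF (tan U) :=
  ∑ A, coord (tan U) (Sum.inr A) * (pr U p).pull (pd U A f)

/-- The tangent prolongation (complete lift) of a vector field on a superdomain:
`X^A ∂/∂x^A + d(X^A) ∂/∂(dx^A)`. -/
def VF.prolong {U : Opens (Ev p → ℝ)} (X : VF U) : VF (tan U) :=
  Sum.elim (fun A => (pr U p).pull (X A)) (fun A => diff (X A))

/-- The vertical lift `X^A ∂/∂(dx^A)` of a vector field to the tangent bundle. -/
def VF.vlift {U : Opens (Ev p → ℝ)} (X : VF U) : VF (tan U) :=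
  Sum.elim (fun _ => 0) (fun A => (pr U p).pull (X A))

theorem hasParity_pd {U : Opens (Ev p → ℝ)} (A : ι) {ε : ZMod 2} {f : SF U}
    (hf : HasParity ε f) : HasParity (p A + ε) (pd U A f) := by
  have key : invol U (pd U A f) = sgn (p A) • pd U A (invol U f) := by
    clear hf
    induction f using SF.induction with
    | add a b ha hb => rw [map_add, map_add, ha, hb, map_add, map_add, smul_add]
    | mk f x =>
      unfold pd
      split_ifs with h
      · rw [SF.lift_mk, invol_mk, SF.lift_mk]
        simp [invol_mk, h, sgn]
      · rw [SF.lift_mk, invol_mk, SF.lift_mk]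
        simp only [LinearMap.compl₂_apply, invol_mk]
        rw [← map_smul]
        congr 1
        have hc : sgn (p A) = -1 := by simp [sgn, h]
        rw [hc]
        induction x using CliffordAlgebra.left_induction with
        | algebraMap r => simp [CliffordAlgebra.contractLeft_algebraMap]
        | add a b ha hb => simp only [map_add, ha, hb, smul_add]
        | ι_mul a m ha =>
          rw [CliffordAlgebra.contractLeft_ι_mul, map_sub, map_smul, map_mul, map_mul, ha,
            CliffordAlgebra.involute_ι, neg_mul, neg_mul, map_neg,
            CliffordAlgebra.contractLeft_ι_mul, neg_one_smul, neg_one_smul, mul_neg]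
          abel
  unfold HasParity at *
  rw [key, hf, map_smul, smul_smul, sgn_add]

theorem hasParity_diff {U : Opens (Ev p → ℝ)} {ε : ZMod 2} {f : SF U} (hf : HasParity ε f) :
    HasParity ε (diff f) := by
  refine HasParity.sum _ _ fun A _ => ?_
  have h := (hasParity_coord (U := tan U) (Sum.inr A)).mul
    ((pr U p).hasParity_pull (hasParity_pd A hf))
  have e : ∀ a b : ZMod 2, a + (a + b) = b := by decide
  rwa [show Sum.elim p p (Sum.inr A) + (p A + ε) = ε from e _ _] at h

theorem body_pr_pull {U : Opens (Ev p → ℝ)} {r : κ → ZMod 2} (f : SF U) (y : cyl U r) :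
    (body (cyl U r) ((pr U r).pull f)).1 y =
      (body U f).1 ⟨fun a => y.1 ⟨Sum.inl a.1, a.2⟩, y.2⟩ := by
  rw [Mor.body_pull]
  change (body U f).1 ⟨fun b => extendZero (body (cyl U r) ((pr U r).comp b)).1 y, _⟩ = _
  refine congrArg _ (Subtype.ext ?_)
  funext b
  refine (extendZero_apply (body (cyl U r) ((pr U r).comp b)).1 y).trans ?_
  exact congrFun (congrArg Subtype.val
    (body_coord (cyl U r) (⟨Sum.inl b.1, b.2⟩ : Ev (Sum.elim p r)))) y

/-- The tangent map of a morphism of superdomains. -/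
def Mor.tangent {U : Opens (Ev p → ℝ)} {V : Opens (Ev p' → ℝ)} (φ : Mor U V) :
    Mor (tan U) (tan V) where
  comp := Sum.elim (fun B => (pr U p).pull (φ.comp B)) (fun B => diff (φ.comp B))
  parity B := by
    cases B with
    | inl B => exact (pr U p).hasParity_pull (φ.parity B)
    | inr B => exact hasParity_diff (φ.parity B)
  maps y := by
    change (fun b : Ev p' => (body (tan U) ((pr U p).pull (φ.comp b))).1 y) ∈ V
    simp only [body_pr_pull]
    exact φ.maps _

/-- The morphism `u^j = ∑ u^i T_i^j` of trivial vector bundles over the morphism `φ`, where the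
fibre coordinates have the parities `r`. -/
def Mor.linear {U : Opens (Ev p → ℝ)} {V : Opens (Ev p' → ℝ)} (φ : Mor U V) (r : κ → ZMod 2)
    (T : κ → κ → SF U) (hT : ∀ i j, HasParity (r i + r j) (T i j)) :
    Mor (cyl U r) (cyl V r) where
  comp := Sum.elim (fun B => (pr U r).pull (φ.comp B))
    (fun j => ∑ i, coord (cyl U r) (Sum.inr i) * (pr U r).pull (T i j))
  parity B := by
    cases B with
    | inl B => exact (pr U r).hasParity_pull (φ.parity B)
    | inr j =>
      refine HasParity.sum _ _ fun i _ => ?_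
      have h := (hasParity_coord (U := cyl U r) (Sum.inr i)).mul
        ((pr U r).hasParity_pull (hT i j))
      have e : ∀ a b : ZMod 2, a + (a + b) = b := by decide
      rwa [show Sum.elim p r (Sum.inr i) + (r i + r j) = r j from e _ _] at h
  maps y := by
    change (fun b : Ev p' => (body (cyl U r) ((pr U r).pull (φ.comp b))).1 y) ∈ V
    simp only [body_pr_pull]
    exact φ.maps _

end Cylinder

/-! ## Supermanifolds -/

section Manifold

variable {ι ι' : Type*} {p : ι → ZMod 2} {p' : ι' → ZMod 2} [Fintype ι] [Fintype ι']
  [DecidableEq ι] [DecidableEq ι']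

/-- Gluing data for a supermanifold with coordinates of parities `p`: superdomains `dom α`,
the parts `ov α β` of `dom α` to be identified with parts of `dom β`, and the changes of
coordinates. -/
structure Atlas {ι : Type*} [Fintype ι] (p : ι → ZMod 2) where
  Chart : Type u
  dom : Chart → Opens (Ev p → ℝ)
  ov : Chart → Chart → Opens (Ev p → ℝ)
  ov_le : ∀ α β, ov α β ≤ dom α
  tr : ∀ α β, Mor (ov α β) (ov β α)

/-- The gluing data satisfy the cocycle conditions, so that they define a supermanifold. -/
structure Atlas.IsSupermanifold (N : Atlas.{u} p) : Prop where
  ov_self : ∀ α, N.ov α α = N.dom α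
  tr_self : ∀ α A, (N.tr α α).comp A = coord (N.ov α α) A
  ov_trans : ∀ α β γ (x : N.ov α β), (N.tr α β).point x ∈ N.ov β γ → (x : Ev p → ℝ) ∈ N.ov α γ
  tr_trans : ∀ α β γ (W : Opens (Ev p → ℝ)) (h : W ≤ N.ov α β) (h' : W ≤ N.ov α γ)
    (hW : ∀ x : W, (N.tr α β).point ⟨x, h x.2⟩ ∈ N.ov β γ) (C : ι),
    ((N.tr α β).restr h hW).pull ((N.tr β γ).comp C) = res h' ((N.tr α γ).comp C)

/-- The tangent bundle of a supermanifold (as a supermanifold). -/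
def Atlas.tangent (N : Atlas.{u} p) : Atlas.{u} (Sum.elim p p) where
  Chart := N.Chart
  dom α := tan (N.dom α)
  ov α β := tan (N.ov α β)
  ov_le α β := cyl_mono (N.ov_le α β) p
  tr α β := (N.tr α β).tangent

/-- A family of vector fields on the charts of a supermanifold. -/
abbrev Atlas.VField (N : Atlas.{u} p) : Type _ := ∀ α, VF (N.dom α)

/-- The local vector fields agree under the changes of coordinates, that is, they form a
vector field on the supermanifold. -/
def Atlas.IsVField (N : Atlas.{u} p) (X : N.VField) : Prop :=
  ∀ α β, VF.Related (N.tr α β) ((X α).restr (N.ov_le α β)) ((X β).restr (N.ov_le β α))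

/-- `Q` is a homological vector field: an odd vector field with `[Q, Q] = 0`. -/
structure Atlas.IsHomological (N : Atlas.{u} p) (Q : N.VField) : Prop where
  isVField : N.IsVField Q
  odd : ∀ α, (Q α).HasParity 1
  sq : ∀ α, (Q α).bracket 1 1 (Q α) = 0

/-- The tangent prolongation of a vector field. -/
def Atlas.VField.prolong {N : Atlas.{u} p} (X : N.VField) : N.tangent.VField :=
  fun α => (X α).prolong

/-- The family `F` of morphisms of charts, with the family `G` of inverses, defines a
diffeomorphism of supermanifolds. -/
structure Atlas.IsDiffeo (N : Atlas.{u} p) (N' : Atlas.{u} p') (c : N.Chart ≃ N'.Chart)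
    (F : ∀ α, Mor (N.dom α) (N'.dom (c α))) (G : ∀ α, Mor (N'.dom (c α)) (N.dom α)) : Prop where
  left_inv : ∀ α A, (F α).pull ((G α).comp A) = coord (N.dom α) A
  right_inv : ∀ α B, (G α).pull ((F α).comp B) = coord (N'.dom (c α)) B
  ov_iff : ∀ α β (x : N.dom α), (F α).point x ∈ N'.ov (c α) (c β) ↔ (x : Ev p → ℝ) ∈ N.ov α β
  comm : ∀ α β (h : ∀ x : N.ov α β, (F α).point ⟨x, N.ov_le α β x.2⟩ ∈ N'.ov (c α) (c β))
    (h' : ∀ x : N.ov α β, (N.tr α β).point x ∈ N.dom β) (B : ι'),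
    ((N.tr α β).restr le_rfl h').pull ((F β).comp B) =
      ((F α).restr (N.ov_le α β) h).pull ((N'.tr (c α) (c β)).comp B)

end Manifold

/-! ## Vector bundles -/

section Bundle

variable {ι κ : Type*} {p : ι → ZMod 2} {q : κ → ZMod 2} [Fintype ι] [Fintype κ]
  [DecidableEq ι] [DecidableEq κ]

/-- Gluing data for a vector bundle of supermanifolds. The base has coordinates of parities `p`,
the linear fibre coordinates `u^i` have parities `q`; they transform by
`(u^j in the chart β) = ∑ (u^i in the chart α) * T_i^j`. -/
structure Bundle {ι κ : Type*} [Fintype ι] (p : ι → ZMod 2) (q : κ → ZMod 2) where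
  base : Atlas.{u} p
  trans : ∀ α β, κ → κ → SF (base.ov α β)
  trans_parity : ∀ α β i j, HasParity (q i + q j) (trans α β i j)

namespace Bundle

/-- The gluing data satisfy the cocycle conditions, so that they define a vector bundle. -/
structure IsVectorBundle (E : Bundle.{u} p q) : Prop where
  base_isSupermanifold : E.base.IsSupermanifold
  trans_self : ∀ α i j, E.trans α α i j = if i = j then 1 else 0
  trans_trans : ∀ α β γ (W : Opens (Ev p → ℝ)) (h : W ≤ E.base.ov α β) (h' : W ≤ E.base.ov α γ)
    (hW : ∀ x : W, (E.base.tr α β).point ⟨x, h x.2⟩ ∈ E.base.ov β γ) (i k : κ),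
    ∑ j, res h (E.trans α β i j) * ((E.base.tr α β).restr h hW).pull (E.trans β γ j k) =
      res h' (E.trans α γ i k)

/-- The total space of a vector bundle. -/
def total (E : Bundle.{u} p q) : Atlas.{u} (Sum.elim p q) where
  Chart := E.base.Chart
  dom α := cyl (E.base.dom α) q
  ov α β := cyl (E.base.ov α β) q
  ov_le α β := cyl_mono (E.base.ov_le α β) q
  tr α β := (E.base.tr α β).linear q (E.trans α β) (E.trans_parity α β)

/-- The parity reversion of a vector bundle. -/
def parityRev (E : Bundle.{u} p q) : Bundle.{u} p (fun k => q k + 1) where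
  base := E.base
  trans := E.trans
  trans_parity α β i j := by
    have e : ∀ a b : ZMod 2, a + 1 + (b + 1) = a + b := by decide
    rw [e]
    exact E.trans_parity α β i j

/-- The tangent prolongation `TE → TM` of a vector bundle `E → M`. The fibre coordinates are the
fibre coordinates `u^i` of `E` (label `inl i`) and their differentials (label `inr i`), transforming
by `u^j = ∑ u^i T_i^j` and `du^j = ∑ (du^i T_i^j + u^i d(T_i^j))`. -/
def tangent (E : Bundle.{u} p q) : Bundle.{u} (Sum.elim p p) (Sum.elim q q) where
  base := E.base.tangent
  trans α β := Sum.elim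
    (fun i => Sum.elim (fun j => (pr _ p).pull (E.trans α β i j)) (fun j => diff (E.trans α β i j)))
    (fun i => Sum.elim (fun _ => 0) (fun j => (pr _ p).pull (E.trans α β i j)))
  trans_parity α β i j := by
    rcases i with i | i <;> rcases j with j | j
    · exact Mor.hasParity_pull _ (E.trans_parity α β i j)
    · exact hasParity_diff (E.trans_parity α β i j)
    · exact hasParity_zero _
    · exact Mor.hasParity_pull _ (E.trans_parity α β i j)

end Bundle

/-- Sections over `V` of a trivial bundle: `s = ∑ s^i e_i`. -/
abbrev Sec (κ : Type*) (V : Opens (Ev p → ℝ)) : Type _ := κ → SF V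

/-- The section is homogeneous of parity `ε`, where the basis section `e_i` has parity `q i`. -/
def Sec.HasParity (q : κ → ZMod 2) {V : Opens (Ev p → ℝ)} (ε : ZMod 2) (s : Sec κ V) : Prop :=
  ∀ k, SuperGeom.HasParity (ε + q k) (s k)

/-- The section `T(s) = s^i e_i + d(s^i) ē_i` of `TE → TM`, the tangent of the section `s` of `E`. -/
def Sec.tangent {V : Opens (Ev p → ℝ)} (s : Sec κ V) : Sec (κ ⊕ κ) (tan V) :=
  Sum.elim (fun k => (pr V p).pull (s k)) (fun k => diff (s k))

/-- The core section `s^i ē_i` of `TE → TM` defined by the section `s` of `E`. -/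
def Sec.core {V : Opens (Ev p → ℝ)} (s : Sec κ V) : Sec (κ ⊕ κ) (tan V) :=
  Sum.elim (fun _ => 0) (fun k => (pr V p).pull (s k))

/-- The sections `s` over `V` in the chart `α` and `s'` over `V'` in the chart `β` agree: the
section `s` is the restriction to `V` of the section `s'`. -/
def Bundle.Agree (E : Bundle.{u} p q) {α β : E.base.Chart} {V V' : Opens (Ev p → ℝ)}
    (hV : V ≤ E.base.ov α β) (hm : ∀ x : V, (E.base.tr α β).point ⟨x, hV x.2⟩ ∈ V')
    (s : Sec κ V) (s' : Sec κ V') : Prop :=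
  ∀ j, ((E.base.tr α β).restr hV hm).pull (s' j) = ∑ i, s i * res hV (E.trans α β i j)

/-! ## Lie algebroids -/

/-- A Lie algebroid structure on the vector bundle `E`: an anchor and a bracket on the local
sections, over the open subsets `V` of the charts, compatible with restrictions and with changes of
charts, with the usual identities with signs. -/
structure LieAlgebroid (E : Bundle.{u} p q) where
  anchor : ∀ (α : E.base.Chart) (V : Opens (Ev p → ℝ)), V ≤ E.base.dom α →
    (Sec κ V →ₗ[SF V] VF V)
  bracket : ∀ (α : E.base.Chart) (V : Opens (Ev p → ℝ)), V ≤ E.base.dom α →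
    (Sec κ V →ₗ[ℝ] Sec κ V →ₗ[ℝ] Sec κ V)
  anchor_agree : ∀ (α β : E.base.Chart) (V V' : Opens (Ev p → ℝ)) (hV : V ≤ E.base.ov α β)
    (hV' : V' ≤ E.base.dom β) (hm : ∀ x : V, (E.base.tr α β).point ⟨x, hV x.2⟩ ∈ V')
    (s : Sec κ V) (s' : Sec κ V'), E.Agree hV hm s s' →
    VF.Related ((E.base.tr α β).restr hV hm) (anchor α V (hV.trans (E.base.ov_le α β)) s)
      (anchor β V' hV' s')
  bracket_agree : ∀ (α β : E.base.Chart) (V V' : Opens (Ev p → ℝ)) (hV : V ≤ E.base.ov α β)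
    (hV' : V' ≤ E.base.dom β) (hm : ∀ x : V, (E.base.tr α β).point ⟨x, hV x.2⟩ ∈ V')
    (s t : Sec κ V) (s' t' : Sec κ V'), E.Agree hV hm s s' → E.Agree hV hm t t' →
    E.Agree hV hm (bracket α V (hV.trans (E.base.ov_le α β)) s t) (bracket β V' hV' s' t')
  anchor_parity : ∀ α V hV (ε : ZMod 2) (s : Sec κ V), s.HasParity q ε →
    (anchor α V hV s).HasParity ε
  bracket_parity : ∀ α V hV (ε δ : ZMod 2) (s t : Sec κ V), s.HasParity q ε → t.HasParity q δ →
    (bracket α V hV s t).HasParity q (ε + δ)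
  bracket_skew : ∀ α V hV (ε δ : ZMod 2) (s t : Sec κ V), s.HasParity q ε → t.HasParity q δ →
    bracket α V hV s t = -(sgn (ε * δ) • bracket α V hV t s)
  jacobi : ∀ α V hV (ε δ : ZMod 2) (s t w : Sec κ V), s.HasParity q ε → t.HasParity q δ →
    bracket α V hV s (bracket α V hV t w) = bracket α V hV (bracket α V hV s t) w +
      sgn (ε * δ) • bracket α V hV t (bracket α V hV s w)
  leibniz : ∀ α V hV (ε φ : ZMod 2) (s t : Sec κ V) (f : SF V), s.HasParity q ε →
    HasParity φ f → bracket α V hV s (f • t) =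
      (anchor α V hV s).apply f • t + sgn (ε * φ) • f • bracket α V hV s t
  anchor_bracket : ∀ α V hV (ε δ : ZMod 2) (s t : Sec κ V), s.HasParity q ε → t.HasParity q δ →
    anchor α V hV (bracket α V hV s t) =
      (anchor α V hV s).bracket ε δ (anchor α V hV t)

/-- The Euler field `∑ ξ^i ∂/∂ξ^i` of a vector bundle. -/
def Bundle.euler (E : Bundle.{u} p q) : E.total.VField :=
  fun _ => Sum.elim (fun _ => 0) (fun k => coord _ (Sum.inr k))

/-- The vector field `X` on the total space of a vector bundle has weight `w`, where the linear
functions on the fibres have weight `1` and the functions on the base have weight `0`. -/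
def Bundle.HasWeight (E : Bundle.{u} p q) (w : ℤ) (ε : ZMod 2) (X : E.total.VField) : Prop :=
  ∀ α, (E.euler α).bracket 0 ε (X α) = (w : ℝ) • X α

/-- The vector field `i(s) = (-1)^ε s^k ∂/∂ξ^k` on (the part over `V` of) the total space of `ΠE`
corresponding to a section `s` of `E` of parity `ε`. -/
def Sec.toVF (q : κ → ZMod 2) {V : Opens (Ev p → ℝ)} (ε : ZMod 2) (s : Sec κ V) :
    VF (cyl V (fun k => q k + 1)) :=
  Sum.elim (fun _ => 0) (fun k => sgn ε • (pr V (fun k => q k + 1)).pull (s k))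

/-- The Lie algebroid structure `A` on `E` is given by the vector field `Q` on `ΠE`:
`a(s) f = [[Q, i(s)], f]` and `i([s, t]) = (-1)^ε [[Q, i(s)], i(t)]` for sections `s`, `t` of
parities `ε`, `δ`. -/
structure LieAlgebroid.IsGivenBy {E : Bundle.{u} p q} (A : LieAlgebroid E)
    (Q : E.parityRev.total.VField) : Prop where
  anchor_eq : ∀ α V (hV : V ≤ E.base.dom α) (ε : ZMod 2) (s : Sec κ V), s.HasParity q ε →
    ∀ f : SF V, (pr V (fun k => q k + 1)).pull ((A.anchor α V hV s).apply f) =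
      (((Q α).restr (cyl_mono hV _)).bracket 1 (ε + 1) (s.toVF q ε)).apply
        ((pr V (fun k => q k + 1)).pull f)
  bracket_eq : ∀ α V (hV : V ≤ E.base.dom α) (ε δ : ZMod 2) (s t : Sec κ V), s.HasParity q ε →
    t.HasParity q δ → (A.bracket α V hV s t).toVF q (ε + δ) =
      sgn ε • (((Q α).restr (cyl_mono hV _)).bracket 1 (ε + 1) (s.toVF q ε)).bracket ε (δ + 1)
        (t.toVF q δ)

/-- `L` is the tangent prolongation of the Lie algebroid `A`: the Lie algebroid structure on
`TE → TM` with anchor the composition of `T(a) : TE → TTM` with the canonical involution of `TTM`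
(which means that the sections `T(s)` and the core sections are sent to the complete and the
vertical lifts of `a(s)`), and with
`[T(s), T(t)] = T([s, t])`, `[T(s), core t] = core [s, t]`, `[core s, core t] = 0`. -/
structure LieAlgebroid.IsTangentProlongation {E : Bundle.{u} p q} (A : LieAlgebroid E)
    (L : LieAlgebroid E.tangent) : Prop where
  anchor_tangent : ∀ α V (hV : V ≤ E.base.dom α) (s : Sec κ V),
    L.anchor α (tan V) (cyl_mono hV p) s.tangent = (A.anchor α V hV s).prolong
  anchor_core : ∀ α V (hV : V ≤ E.base.dom α) (s : Sec κ V),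
    L.anchor α (tan V) (cyl_mono hV p) s.core = (A.anchor α V hV s).vlift
  tangent_tangent : ∀ α V (hV : V ≤ E.base.dom α) (s t : Sec κ V),
    L.bracket α (tan V) (cyl_mono hV p) s.tangent t.tangent = (A.bracket α V hV s t).tangent
  tangent_core : ∀ α V (hV : V ≤ E.base.dom α) (s t : Sec κ V),
    L.bracket α (tan V) (cyl_mono hV p) s.tangent t.core = (A.bracket α V hV s t).core
  core_core : ∀ α V (hV : V ≤ E.base.dom α) (s t : Sec κ V),
    L.bracket α (tan V) (cyl_mono hV p) s.core t.core = 0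

/-! ## The identification of `T(ΠE)` with `Π_{TM} TE` -/

/-- The regrouping of coordinates `((x, dx), (u, du)) ↔ ((x, u), (dx, du))`. -/
theorem sumComm_parity (p : ι → ZMod 2) (r : κ → ZMod 2) (s : κ ⊕ κ → ZMod 2)
    (hs : ∀ k, s k = Sum.elim r r k) (B : (ι ⊕ ι) ⊕ (κ ⊕ κ)) :
    Sum.elim (Sum.elim p r) (Sum.elim p r) (Equiv.sumSumSumComm ι ι κ κ B) =
      Sum.elim (Sum.elim p p) s B := by
  rcases B with (a | a) | (k | k)
  · rfl
  · rfl
  · exact (hs (Sum.inl k)).symm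
  · exact (hs (Sum.inr k)).symm

theorem sumComm_parity' (p : ι → ZMod 2) (r : κ → ZMod 2) (s : κ ⊕ κ → ZMod 2)
    (hs : ∀ k, s k = Sum.elim r r k) (B : (ι ⊕ κ) ⊕ (ι ⊕ κ)) :
    Sum.elim (Sum.elim p p) s (Equiv.sumSumSumComm ι κ ι κ B) =
      Sum.elim (Sum.elim p r) (Sum.elim p r) B := by
  rcases B with (a | k) | (a | k)
  · rfl
  · exact hs (Sum.inl k)
  · rfl
  · exact hs (Sum.inr k)

/-- Regrouping of coordinates, from the tangent bundle of `U × fibre` (with coordinates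
`((x, u), (dx, du))`) to the product of `TU` with the tangent bundle of the fibre (with coordinates
`((x, dx), (u, du))`). -/
def regroup (U : Opens (Ev p → ℝ)) (r : κ → ZMod 2) (s : κ ⊕ κ → ZMod 2)
    (hs : ∀ k, s k = Sum.elim r r k) : Mor (tan (cyl U r)) (cyl (tan U) s) :=
  coordMor (Equiv.sumSumSumComm ι ι κ κ) (sumComm_parity p r s hs) fun _ hx => hx

/-- The inverse of `regroup`. -/
def regroupInv (U : Opens (Ev p → ℝ)) (r : κ → ZMod 2) (s : κ ⊕ κ → ZMod 2)
    (hs : ∀ k, s k = Sum.elim r r k) : Mor (cyl (tan U) s) (tan (cyl U r)) :=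
  coordMor (Equiv.sumSumSumComm ι κ ι κ) (sumComm_parity' p r s hs) fun _ hx => hx

theorem parityRev_elim (q : κ → ZMod 2) (k : κ ⊕ κ) :
    Sum.elim q q k + 1 = Sum.elim (fun k => q k + 1) (fun k => q k + 1) k := by
  cases k <;> rfl

/-- A vector field on `T(ΠE)`, viewed as a vector field on `Π_{TM} TE` by regrouping the
coordinates. -/
def Bundle.regroupVF (E : Bundle.{u} p q) (X : E.parityRev.total.tangent.VField) :
    E.tangent.parityRev.total.VField :=
  fun α B => (regroupInv (E.base.dom α) (fun k => q k + 1) (fun k => Sum.elim q q k + 1)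
    (parityRev_elim q)).pull (X α (Equiv.sumSumSumComm ι ι κ κ B))

end Bundle

end SuperGeom

end

noncomputable section

namespace SuperGeom

/-! ## Calculus of functions on superdomains -/

/-! On a tangent bundle `TN` the coordinates are pullbacks `pr f` and even differentials `df` of
functions on `N`. A prolonged field acts by `X̂(pr f) = pr(Xf)`, `X̂(df) = d(Xf)`, and a vertical
lift by `Xᵛ(pr f) = 0`, `Xᵛ(df) = pr(Xf)`. Hence `[X̂, Ŷ]` is the prolongation of `[X, Y]`, `[X̂,
Yᵛ]` is the vertical lift of `[X, Y]`, and vertical lifts commute (`VF.prolong_bracket`,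
`VF.prolong_bracket_vlift`, `VF.vlift_bracket_vlift`). In particular `[Q̂, Q̂] = 0`. The prolonged
Euler field of `ΠE` is the Euler field of `Π_{TM}TE`, so weights are preserved. That the regrouping
of coordinates is compatible with gluing is the Leibniz rule `d(u^i T_i^j) = du^i T_i^j + u^i
dT_i^j`.

After regrouping, `i(T(s))` is the prolongation of `i(s)` and `i` of the core section is the
vertical lift of `i(s)` (`Sec.toVF_tangent`, `Sec.toVF_core`). The derived brackets formed with `Q̂`
are therefore the lifts of those formed with `Q`, and these are exactly the formulas that define a
tangent prolongation (`LieAlgebroid.IsGivenBy.isTangentProlongation`).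

Existence: the derived bracket of an odd square-zero field is a Lie algebroid once the anchor and
bracket it produces are functions of base points only, that is, once suitable fibre derivatives of
the field are basic (`VF.IsDerived`, `LieAlgebroid.ofVF`). For `Q` this is read off from the
identities saying that `Q` gives the algebroid, evaluated on a frame; it passes to `Q̂`. Uniqueness:
the sections `T(e_k)` and the core sections of `e_k` form a frame of `TE`, and linearity of the
anchor, the Leibniz rule and skew-symmetry determine everything from a frame. The final equivalence
follows, since any tangent prolongation equals the one constructed from `Q̂`.

Underneath lies the calculus of pullbacks, which are defined by finite Taylor expansions. The
uniform method is `eq_zero_of_family`: a family of functions with zero bodies whose odd derivatives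
are combinations of its own members is zero. It yields multiplicativity, the chain rule
`Mor.pd_pull` and functoriality `Mor.pull_pull`, after which naturality needs checking only on
coordinates. -/

theorem zmod_two_cases (a : ZMod 2) : a = 0 ∨ a = 1 := by
  revert a; decide

@[simp] theorem sgn_zero : sgn 0 = 1 := by simp [sgn]

@[simp] theorem sgn_one : sgn 1 = -1 := by simp [sgn]

@[simp] theorem sgn_mul_self (a : ZMod 2) : sgn a * sgn a = 1 := by
  rcases zmod_two_cases a with rfl | rfl <;> simp

/-! ### Directional derivatives of smooth functions on open sets. -/

section DirDeriv

variable {X : Type*} [NormedAddCommGroup X] [NormedSpace ℝ X] {U : Opens X}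

theorem extendZero_eventuallyEq (f : U → ℝ) (g : X → ℝ) (h : ∀ x : U, f x = g x) (x : U) :
    extendZero f =ᶠ[nhds (x : X)] g := by
  filter_upwards [U.isOpen.mem_nhds x.2] with y hy
  exact (extendZero_apply f ⟨y, hy⟩).trans (h ⟨y, hy⟩)

theorem differentiableAt_extendZero (f : Smooth U) (x : U) :
    DifferentiableAt ℝ (extendZero f.1) x :=
  ((contDiffOn_extendZero f).differentiableOn (by simp)).differentiableAt (U.isOpen.mem_nhds x.2)

theorem dirDeriv_apply (v : X) (f : Smooth U) (x : U) :
    (dirDeriv U v f).1 x = fderiv ℝ (extendZero f.1) x v := rfl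

/-- The derivative depends only on the germ, so any convenient representative on the whole space may
replace the extension by zero. -/
theorem dirDeriv_apply_of_eq (v : X) (f : Smooth U) (g : X → ℝ) (h : ∀ x : U, f.1 x = g x)
    (x : U) : (dirDeriv U v f).1 x = fderiv ℝ g x v := by
  rw [dirDeriv_apply, (extendZero_eventuallyEq f.1 g h x).fderiv_eq]

theorem dirDeriv_mul (v : X) (f g : Smooth U) :
    dirDeriv U v (f * g) = dirDeriv U v f * g + f * dirDeriv U v g := by
  ext x
  rw [dirDeriv_apply_of_eq v (f * g) (extendZero f.1 * extendZero g.1) (fun y => by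
      simp [extendZero_apply]), fderiv_mul (differentiableAt_extendZero f x)
      (differentiableAt_extendZero g x)]
  simp only [extendZero_apply, _root_.add_apply, _root_.smul_apply,
    smul_eq_mul]
  change _ = (dirDeriv U v f).1 x * g.1 x + f.1 x * (dirDeriv U v g).1 x
  rw [dirDeriv_apply, dirDeriv_apply]
  ring

theorem dirDeriv_algebraMap (v : X) (r : ℝ) : dirDeriv U v (algebraMap ℝ (Smooth U) r) = 0 := by
  ext x
  rw [dirDeriv_apply_of_eq v _ (fun _ => r) (fun y => rfl)]
  simp

theorem dirDeriv_one (v : X) : dirDeriv U v (1 : Smooth U) = 0 := by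
  simpa using dirDeriv_algebraMap (U := U) v 1

/-- Both sides are values of the second Fréchet derivative, which is symmetric for smooth functions.
-/
theorem dirDeriv_comm (v w : X) (f : Smooth U) :
    dirDeriv U v (dirDeriv U w f) = dirDeriv U w (dirDeriv U v f) := by
  ext x
  have hc : ContDiffAt ℝ ∞ (extendZero f.1) x :=
    (contDiffOn_extendZero f).contDiffAt (U.isOpen.mem_nhds x.2)
  have hd : DifferentiableAt ℝ (fderiv ℝ (extendZero f.1)) x :=
    (hc.fderiv_right (m := 1) (WithTop.coe_le_coe.2 le_top)).differentiableAt (by simp)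
  have key : ∀ v w : X, (dirDeriv U v (dirDeriv U w f)).1 x =
      fderiv ℝ (fderiv ℝ (extendZero f.1)) x v w := by
    intro v w
    rw [dirDeriv_apply_of_eq v _ (fun y => fderiv ℝ (extendZero f.1) y w) (fun y => rfl),
      fderiv_clm_apply hd (by fun_prop)]
    simp
  rw [key, key]
  exact (hc.isSymmSndFDerivAt (by
    rw [minSmoothness_of_isRCLikeNormedField]; exact WithTop.coe_le_coe.2 le_top)) v w

end DirDeriv

/-! ### Parity, supercommutativity and partial derivatives. -/

section Calculus

variable {ι : Type*} {p : ι → ZMod 2} [Fintype ι] {U W : Opens (Ev p → ℝ)}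

theorem SF.one_eq (U : Opens (Ev p → ℝ)) : (1 : SF U) = SF.mk U 1 1 := rfl

theorem SF.algebraMap_eq (r : ℝ) : algebraMap ℝ (SF U) r = SF.mk U (algebraMap ℝ _ r) 1 := rfl

theorem invol_invol (f : SF U) : invol U (invol U f) = f := by
  induction f using SF.induction with
  | mk f x => rw [invol_mk, invol_mk, CliffordAlgebra.involute_involute]
  | add a b ha hb => rw [map_add, map_add, ha, hb]

/-- The component of parity `ε` of a function. -/
def part (ε : ZMod 2) : SF U →ₗ[ℝ] SF U :=
  (2⁻¹ : ℝ) • (LinearMap.id + sgn ε • (invol U).toLinearMap)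

theorem part_apply (ε : ZMod 2) (f : SF U) :
    part ε f = (2⁻¹ : ℝ) • (f + sgn ε • invol U f) := rfl

theorem hasParity_part (ε : ZMod 2) (f : SF U) : HasParity ε (part ε f) := by
  unfold HasParity
  rw [part_apply, map_smul, map_add, map_smul, invol_invol, smul_comm, smul_add (sgn ε),
    smul_smul (sgn ε), sgn_mul_self, one_smul, add_comm]

theorem part_add_part (f : SF U) : part 0 f + part 1 f = f := by
  rw [part_apply, part_apply, sgn_zero, sgn_one, ← smul_add]
  have : f + (1 : ℝ) • invol U f + (f + (-1 : ℝ) • invol U f) = (2 : ℝ) • f := by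
    rw [two_smul, one_smul, neg_one_smul]; abel
  rw [this, smul_smul]; norm_num

theorem HasParity.part_eq {ε : ZMod 2} {f : SF U} (hf : HasParity ε f) (δ : ZMod 2) :
    part δ f = if ε = δ then f else 0 := by
  unfold HasParity at hf
  rw [part_apply, hf, smul_smul]
  split_ifs with h
  · rw [h, sgn_mul_self, one_smul, ← two_smul ℝ f, smul_smul]; norm_num
  · have : sgn δ * sgn ε = -1 := by
      rcases zmod_two_cases ε with rfl | rfl <;> rcases zmod_two_cases δ with rfl | rfl <;>
        simp_all
    rw [this]; simp

theorem HasParity.smul {ε : ZMod 2} {f : SF U} (hf : HasParity ε f) (r : ℝ) :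
    HasParity ε (r • f) := by
  unfold HasParity at *
  rw [map_smul, hf, smul_comm]

theorem HasParity.sub {ε : ZMod 2} {f g : SF U} (hf : HasParity ε f) (hg : HasParity ε g) :
    HasParity ε (f - g) := by
  unfold HasParity at *
  rw [map_sub, hf, hg, smul_sub]

theorem HasParity.congr {ε δ : ZMod 2} {f : SF U} (hf : HasParity ε f) (h : ε = δ) :
    HasParity δ f := h ▸ hf

theorem hasParity_one : HasParity 0 (1 : SF U) := by
  simp [HasParity]

/-- A property of functions which is additive holds if it holds for homogeneous functions. -/
theorem SF.homogeneous_induction {C : SF U → Prop} (add : ∀ a b, C a → C b → C (a + b))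
    (hom : ∀ ε a, HasParity ε a → C a) (a : SF U) : C a := by
  rw [← part_add_part a]
  exact add _ _ (hom _ _ (hasParity_part 0 a)) (hom _ _ (hasParity_part 1 a))

/-- Against a generator this is `involute_mul_anticomm` read from the side of the generator;
products and sums of generators follow. -/
theorem involute_mul_comm {M : Type*} [AddCommGroup M] [Module ℝ M]
    (x y : ExteriorAlgebra ℝ M)
    (hx : CliffordAlgebra.involute (Q := (0 : QuadraticForm ℝ M)) x = x) : x * y = y * x := by
  induction y using ExteriorAlgebra.induction with
  | algebraMap r => exact (Algebra.commutes r _).symm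
  | ι v =>
    have := involute_mul_anticomm (ExteriorAlgebra.ι ℝ v) x
      (CliffordAlgebra.involute_ι (Q := (0 : QuadraticForm ℝ M)) v)
    rw [this, hx]
  | mul a b ha hb => rw [← mul_assoc, ha, mul_assoc, hb, ← mul_assoc]
  | add a b ha hb => rw [mul_add, add_mul, ha, hb]

theorem HasParity.even_mul_comm {f : SF U} (hf : HasParity 0 f) (g : SF U) : f * g = g * f := by
  -- Homogeneity is lost when a function is split into pure tensors. The claim is therefore proved
  -- for `a + invol a`, twice the even part of an arbitrary `a`, and divided by two at the end.
  have h : ∀ a b : SF U, (a + invol U a) * b = b * (a + invol U a) := by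
    intro a b
    induction a using SF.induction with
    | add a₁ a₂ h₁ h₂ =>
      rw [map_add, add_add_add_comm a₁ a₂, add_mul, h₁, h₂, ← mul_add]
    | mk r x =>
      induction b using SF.induction with
      | add b₁ b₂ h₁ h₂ => rw [mul_add, add_mul b₁, h₁, h₂]
      | mk s y =>
        rw [invol_mk, ← map_add, SF.mk_mul_mk, SF.mk_mul_mk, mul_comm s r, involute_mul_comm]
        simp [add_comm]
  have h2 := h f g
  rw [show invol U f = f by rw [hf]; simp, ← two_smul ℝ f, smul_mul_assoc, mul_smul_comm] at h2
  exact smul_right_injective _ (two_ne_zero (α := ℝ)) h2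

theorem HasParity.odd_mul_comm {f : SF U} (hf : HasParity 1 f) (g : SF U) :
    f * g = invol U g * f := by
  have h : ∀ a b : SF U, (a - invol U a) * b = invol U b * (a - invol U a) := by
    intro a b
    induction a using SF.induction with
    | add a₁ a₂ h₁ h₂ =>
      rw [map_add, add_sub_add_comm a₁ a₂, add_mul, h₁, h₂, mul_add]
    | mk r x =>
      induction b using SF.induction with
      | add b₁ b₂ h₁ h₂ => rw [map_add, add_mul, mul_add, h₁, h₂]
      | mk s y =>
        rw [invol_mk, invol_mk, ← map_sub, SF.mk_mul_mk, SF.mk_mul_mk, mul_comm s r,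
          involute_mul_anticomm]
        simp
  have h2 := h f g
  rw [show invol U f = -f by rw [hf]; simp, sub_neg_eq_add, ← two_smul ℝ f, smul_mul_assoc,
    mul_smul_comm] at h2
  exact smul_right_injective _ (two_ne_zero (α := ℝ)) h2

/-- Supercommutativity. -/
theorem HasParity.mul_comm {ε δ : ZMod 2} {f g : SF U} (hf : HasParity ε f)
    (hg : HasParity δ g) : f * g = sgn (ε * δ) • (g * f) := by
  rcases zmod_two_cases ε with rfl | rfl
  · rw [hf.even_mul_comm, zero_mul, sgn_zero, one_smul]
  · rw [hf.odd_mul_comm, hg, one_mul, smul_mul_assoc]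

/-- The identity for `ε` even and the parity automorphism for `ε` odd. -/
def twist (U : Opens (Ev p → ℝ)) (ε : ZMod 2) : SF U →ₐ[ℝ] SF U :=
  if ε = 0 then AlgHom.id ℝ _ else invol U

@[simp] theorem twist_zero (f : SF U) : twist U 0 f = f := by simp [twist]

@[simp] theorem twist_one (f : SF U) : twist U 1 f = invol U f := by simp [twist]

theorem HasParity.twist_eq {δ : ZMod 2} {f : SF U} (hf : HasParity δ f) (ε : ZMod 2) :
    twist U ε f = sgn (ε * δ) • f := by
  rcases zmod_two_cases ε with rfl | rfl
  · simp
  · rw [twist_one, hf, one_mul]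

variable [DecidableEq ι]

theorem pd_even_mk {A : ι} (h : p A = 0) (f : Smooth U) (x : ExteriorAlgebra ℝ (Od p → ℝ)) :
    pd U A (SF.mk U f x) = SF.mk U (dirDeriv U (Pi.single ⟨A, h⟩ 1) f) x := by
  rw [pd, dif_pos h, SF.lift_mk]; rfl

theorem pd_odd_mk {A : ι} (h : p A = 1) (f : Smooth U) (x : ExteriorAlgebra ℝ (Od p → ℝ)) :
    pd U A (SF.mk U f x) = SF.mk U f (CliffordAlgebra.contractLeft
      (Q := (0 : QuadraticForm ℝ (Od p → ℝ))) (LinearMap.proj ⟨A, h⟩) x) := by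
  rw [pd, dif_neg (by rw [h]; decide), SF.lift_mk]; rfl

theorem invol_pd (A : ι) (f : SF U) : invol U (pd U A f) = sgn (p A) • pd U A (invol U f) := by
  induction f using SF.homogeneous_induction with
  | add a b ha hb => simp only [map_add, ha, hb, smul_add]
  | hom ε a ha =>
    have h := hasParity_pd A ha
    unfold HasParity at *
    rw [h, ha, map_smul, smul_smul, sgn_add]

/-- The Leibniz rule for partial derivatives. -/
theorem pd_mul (A : ι) (f g : SF U) :
    pd U A (f * g) = pd U A f * g + twist U (p A) f * pd U A g := by
  induction f using SF.induction with
  | add a b ha hb => rw [add_mul, map_add, ha, hb, map_add, map_add, add_mul, add_mul]; abel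
  | mk f x =>
    induction g using SF.induction with
    | add a b ha hb => rw [mul_add, map_add, ha, hb, map_add, mul_add, mul_add]; abel
    | mk g y =>
      rcases zmod_two_cases (p A) with h | h
      · rw [h, twist_zero, SF.mk_mul_mk, pd_even_mk h, pd_even_mk h, pd_even_mk h, SF.mk_mul_mk,
          SF.mk_mul_mk, dirDeriv_mul, map_add, LinearMap.add_apply]
      · rw [h, twist_one, SF.mk_mul_mk, pd_odd_mk h, pd_odd_mk h, pd_odd_mk h, invol_mk,
          SF.mk_mul_mk, SF.mk_mul_mk, ← map_add]
        congr 1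
        induction x using CliffordAlgebra.left_induction generalizing f with
        | algebraMap r =>
          simp [CliffordAlgebra.contractLeft_algebraMap, CliffordAlgebra.contractLeft_algebraMap_mul]
        | add a b ha hb => simp only [add_mul, map_add, ha f, hb f]; abel_nf
        | ι_mul a v ha =>
          rw [mul_assoc, CliffordAlgebra.contractLeft_ι_mul, CliffordAlgebra.contractLeft_ι_mul,
            ha f, map_mul, CliffordAlgebra.involute_ι]
          simp only [sub_mul, mul_add, smul_mul_assoc, neg_mul, mul_assoc]
          abel_nf

theorem pd_mul_of_hasParity (A : ι) {ε : ZMod 2} {f : SF U} (hf : HasParity ε f) (g : SF U) :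
    pd U A (f * g) = pd U A f * g + sgn (p A * ε) • (f * pd U A g) := by
  rw [pd_mul, hf.twist_eq, smul_mul_assoc]

theorem pd_algebraMap (A : ι) (r : ℝ) : pd U A (algebraMap ℝ (SF U) r) = 0 := by
  rw [SF.algebraMap_eq]
  rcases zmod_two_cases (p A) with h | h
  · rw [pd_even_mk h, dirDeriv_algebraMap, map_zero, LinearMap.zero_apply]
  · rw [pd_odd_mk h, CliffordAlgebra.contractLeft_one, map_zero]

theorem pd_one (A : ι) : pd U A (1 : SF U) = 0 := by
  simpa using pd_algebraMap (U := U) A 1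

/-- Partial derivatives supercommute. -/
theorem pd_pd (A B : ι) (f : SF U) :
    pd U A (pd U B f) = sgn (p A * p B) • pd U B (pd U A f) := by
  induction f using SF.induction with
  | add a b ha hb => simp only [map_add, ha, hb, smul_add]
  | mk f x =>
    rcases zmod_two_cases (p A) with h | h <;> rcases zmod_two_cases (p B) with h' | h'
    · simp only [h, h', pd_even_mk h, pd_even_mk h', mul_zero, sgn_zero, one_smul]
      rw [dirDeriv_comm]
    · simp only [h, h', pd_even_mk h, pd_odd_mk h', zero_mul, sgn_zero, one_smul]
    · simp only [h, h', pd_odd_mk h, pd_even_mk h', mul_zero, sgn_zero, one_smul]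
    · simp only [h, h', pd_odd_mk h, pd_odd_mk h', mul_one, sgn_one, neg_one_smul]
      rw [CliffordAlgebra.contractLeft_comm, map_neg]

theorem pd_pd_self {A : ι} (h : p A = 1) (f : SF U) : pd U A (pd U A f) = 0 := by
  induction f using SF.induction with
  | add a b ha hb => simp only [map_add, ha, hb, add_zero]
  | mk f x => rw [pd_odd_mk h, pd_odd_mk h, CliffordAlgebra.contractLeft_contractLeft, map_zero]

theorem dirDeriv_evenCoord (v : Ev p → ℝ) (a : Ev p) :
    dirDeriv U v (evenCoord U a) = algebraMap ℝ _ (v a) := by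
  ext x
  rw [dirDeriv_apply_of_eq v _ (fun y => y a) (fun y => rfl)]
  rw [show (fun y : Ev p → ℝ => y a) = ContinuousLinearMap.proj (R := ℝ) a from rfl,
    ContinuousLinearMap.fderiv]
  rfl

theorem coord_even {A : ι} (h : p A = 0) : coord U A = SF.mk U (evenCoord U ⟨A, h⟩) 1 := by
  rw [coord, dif_pos h]

theorem coord_odd {A : ι} (h : p A = 1) :
    coord U A = SF.mk U 1 (ExteriorAlgebra.ι ℝ (Pi.single ⟨A, h⟩ 1)) := by
  rw [coord, dif_neg (by rw [h]; decide)]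

theorem pd_coord (A B : ι) : pd U A (coord U B) = if A = B then 1 else 0 := by
  rcases zmod_two_cases (p A) with h | h <;> rcases zmod_two_cases (p B) with h' | h'
  · rw [coord_even h', pd_even_mk h, dirDeriv_evenCoord]
    by_cases hAB : A = B
    · subst hAB
      rw [if_pos rfl, Pi.single_eq_same, (algebraMap ℝ (Smooth U)).map_one]
      rfl
    · rw [if_neg hAB, Pi.single_eq_of_ne (fun e => hAB (congrArg Subtype.val e).symm), map_zero,
        map_zero, LinearMap.zero_apply]
  · rw [coord_odd h', pd_even_mk h, dirDeriv_one, if_neg (by rintro rfl; simp [h] at h')]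
    simp
  · rw [coord_even h', pd_odd_mk h, CliffordAlgebra.contractLeft_one,
      if_neg (by rintro rfl; simp [h] at h')]
    simp
  · rw [coord_odd h', pd_odd_mk h, ExteriorAlgebra.ι, CliffordAlgebra.contractLeft_ι]
    by_cases hAB : A = B
    · subst hAB
      rw [if_pos rfl, LinearMap.proj_apply, Pi.single_eq_same, (algebraMap ℝ (CliffordAlgebra (0 : QuadraticForm ℝ (Od p → ℝ)))).map_one]
      rfl
    · rw [if_neg hAB, LinearMap.proj_apply,
        Pi.single_eq_of_ne (fun e => hAB (congrArg Subtype.val e)), map_zero, map_zero]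

theorem body_pd_even {A : ι} (h : p A = 0) (f : SF U) :
    body U (pd U A f) = dirDeriv U (Pi.single ⟨A, h⟩ 1) (body U f) := by
  induction f using SF.induction with
  | add a b ha hb => simp only [map_add, ha, hb]
  | mk f x => rw [pd_even_mk h, body_mk, body_mk, map_smul]

theorem HasParity.body_eq_zero {f : SF U} (hf : HasParity 1 f) : body U f = 0 := by
  have h2 : body U f * body U f = 0 := by rw [← map_mul, hf.sq_zero, map_zero]
  ext x
  exact mul_self_eq_zero.mp (congrFun (congrArg Subtype.val h2) x)

theorem body_invol (f : SF U) : body U (invol U f) = body U f := by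
  induction f using SF.homogeneous_induction with
  | add a b ha hb => simp only [map_add, ha, hb]
  | hom ε a ha =>
    rcases zmod_two_cases ε with rfl | rfl
    · rw [ha]; simp
    · rw [ha, map_smul, ha.body_eq_zero, smul_zero]

/-! ### Functions vanishing to a given order in the odd coordinates -/

/-- The functions whose odd derivatives of order less than `k` have zero body. -/
def vanishing (U : Opens (Ev p → ℝ)) : ℕ → Submodule ℝ (SF U)
  | 0 => ⊤
  | k + 1 => LinearMap.ker (body U).toLinearMap ⊓
      ⨅ a : Od p, (vanishing U k).comap (pd U a.1)

theorem mem_vanishing_succ {k : ℕ} {f : SF U} : f ∈ vanishing U (k + 1) ↔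
    body U f = 0 ∧ ∀ a, p a = 1 → pd U a f ∈ vanishing U k := by
  rw [vanishing, Submodule.mem_inf, Submodule.mem_iInf]
  exact and_congr Iff.rfl ⟨fun h a ha => h ⟨a, ha⟩, fun h a => h a.1 a.2⟩

theorem vanishing_succ_le (k : ℕ) : vanishing U (k + 1) ≤ vanishing U k := by
  induction k with
  | zero => exact le_top
  | succ k ih =>
    intro f hf
    rw [mem_vanishing_succ] at hf ⊢
    exact ⟨hf.1, fun a ha => ih (hf.2 a ha)⟩

theorem vanishing_antitone {k l : ℕ} (h : k ≤ l) : vanishing U l ≤ vanishing U k :=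
  antitone_nat_of_succ_le vanishing_succ_le h

theorem invol_mem_vanishing {k : ℕ} {f : SF U} (hf : f ∈ vanishing U k) :
    invol U f ∈ vanishing U k := by
  induction k generalizing f with
  | zero => trivial
  | succ k ih =>
    rw [mem_vanishing_succ] at hf ⊢
    refine ⟨by rw [body_invol, hf.1], fun a ha => ?_⟩
    have := invol_pd a f
    rw [ha, sgn_one, neg_one_smul] at this
    rw [eq_neg_of_add_eq_zero_right (a := pd U a (invol U f)) (b := invol U (pd U a f))
      (by rw [this, add_neg_cancel])] at this
    have h2 : pd U a (invol U f) = -invol U (pd U a f) := by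
      rw [invol_pd, ha, sgn_one, neg_one_smul, neg_neg]
    rw [h2]
    exact neg_mem (ih (hf.2 a ha))

/-- By the Leibniz rule an odd derivative lowers the order of one factor only. -/
theorem mul_mem_vanishing {k l : ℕ} {f g : SF U} (hf : f ∈ vanishing U k)
    (hg : g ∈ vanishing U l) : f * g ∈ vanishing U (k + l) := by
  -- The induction runs over the total order, because either factor may be the one differentiated. A
  -- differentiated factor of order zero imposes no condition, and the other factor then supplies
  -- the whole order.
  suffices H : ∀ m k l : ℕ, k + l = m → ∀ f ∈ vanishing U k, ∀ g ∈ vanishing U l,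
      f * g ∈ vanishing U m from H _ k l rfl f hf g hg
  intro m
  induction m with
  | zero => intros; trivial
  | succ m ih =>
    intro k l hkl f hf g hg
    rw [mem_vanishing_succ]
    constructor
    · rw [map_mul]
      rcases k with _ | k
      · rw [zero_add] at hkl
        subst hkl
        rw [(mem_vanishing_succ.1 hg).1, mul_zero]
      · rw [(mem_vanishing_succ.1 hf).1, zero_mul]
    · intro a ha
      rw [pd_mul, ha, twist_one]
      refine add_mem ?_ ?_
      · rcases k with _ | k
        · exact ih 0 m (by omega) _ trivial _ (vanishing_antitone (by omega) hg)
        · exact ih k l (by omega) _ ((mem_vanishing_succ.1 hf).2 a ha) _ hg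
      · rcases l with _ | l
        · exact ih m 0 (by omega) _ (vanishing_antitone (by omega) (invol_mem_vanishing hf)) _
            trivial
        · exact ih k l (by omega) _ (invol_mem_vanishing hf) _
            ((mem_vanishing_succ.1 hg).2 a ha)

theorem mem_vanishing_of_body {f : SF U} (hf : body U f = 0) : f ∈ vanishing U 1 :=
  mem_vanishing_succ.2 ⟨hf, fun _ _ => trivial⟩

/-- The odd derivatives of an even function are odd, and odd functions have zero body. This gain of
a second order is what makes the Taylor expansions terminate early enough. -/
theorem mem_vanishing_two {f : SF U} (hf : HasParity 0 f) (h : body U f = 0) :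
    f ∈ vanishing U 2 := by
  refine mem_vanishing_succ.2 ⟨h, fun a ha => mem_vanishing_of_body ?_⟩
  exact ((hasParity_pd a hf).congr (by rw [ha, add_zero])).body_eq_zero

/-- Substitution of zero for the odd coordinates in `F`. -/
def killOdd (U : Opens (Ev p → ℝ)) (F : Finset (Od p)) : SF U →ₗ[ℝ] SF U :=
  SF.lift ((SF.mk U).compl₂ (ExteriorAlgebra.map (LinearMap.pi fun a =>
    if a ∈ F then 0 else LinearMap.proj a)).toLinearMap)

theorem killOdd_mk (F : Finset (Od p)) (f : Smooth U) (x : ExteriorAlgebra ℝ (Od p → ℝ)) :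
    killOdd U F (SF.mk U f x) = SF.mk U f (ExteriorAlgebra.map (LinearMap.pi fun a =>
      if a ∈ F then 0 else LinearMap.proj a) x) :=
  SF.lift_mk _ f x

theorem killOdd_empty (g : SF U) : killOdd U ∅ g = g := by
  induction g using SF.induction with
  | add a b ha hb => rw [map_add, ha, hb]
  | mk f x =>
    rw [killOdd_mk, show (LinearMap.pi fun a : Od p => if a ∈ (∅ : Finset (Od p)) then 0 else
      LinearMap.proj a) = (LinearMap.id : (Od p → ℝ) →ₗ[ℝ] Od p → ℝ) by ext; simp,
      ExteriorAlgebra.map_id]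
    rfl

theorem killOdd_univ (g : SF U) : killOdd U Finset.univ g = SF.mk U (body U g) 1 := by
  induction g using SF.induction with
  | add a b ha hb => rw [map_add, ha, hb, map_add, map_add, LinearMap.add_apply]
  | mk f x =>
    rw [killOdd_mk, body_mk, map_smul, LinearMap.smul_apply, ← map_smul, ← Algebra.algebraMap_eq_smul_one]
    congr 1
    have : ExteriorAlgebra.map (LinearMap.pi fun a : Od p =>
        if a ∈ (Finset.univ : Finset (Od p)) then 0 else LinearMap.proj a) =
        (Algebra.ofId ℝ _).comp (ExteriorAlgebra.algebraMapInv (R := ℝ) (M := Od p → ℝ)) := by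
      apply ExteriorAlgebra.hom_ext
      refine LinearMap.ext fun v => ?_
      change ExteriorAlgebra.map _ (ExteriorAlgebra.ι ℝ v) =
        algebraMap ℝ _ (ExteriorAlgebra.algebraMapInv (ExteriorAlgebra.ι ℝ v))
      rw [ExteriorAlgebra.map_apply_ι, ExteriorAlgebra.algebraMapInv, ExteriorAlgebra.lift_ι_apply,
        LinearMap.zero_apply, map_zero, show (LinearMap.pi fun a : Od p =>
          if a ∈ (Finset.univ : Finset (Od p)) then (0 : (Od p → ℝ) →ₗ[ℝ] ℝ)
            else LinearMap.proj a) v = 0 by ext; simp, map_zero]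
    rw [this]
    rfl

/-- The algebra of the inductive step of `killOdd_insert`: `e` is the odd generator being killed, `w
+ r e` the image of a new left factor, and `y + e d` the expansion already known for the rest. -/
theorem mul_add_aux {R : Type*} [Ring R] [Algebra ℝ R] (w e d y : R) (r : ℝ) (hee : e * e = 0)
    (hanti : e * w = -(w * e)) :
    (w + r • e) * (y + e * d) = w * y + e * (r • (y + e * d) - (w + r • e) * d) := by
  have h1 : e * (e * d) = 0 := by rw [← mul_assoc, hee, zero_mul]
  have h2 : e * (w * d) = -(w * (e * d)) := by rw [← mul_assoc, hanti, neg_mul, mul_assoc]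
  simp only [add_mul, mul_add, mul_sub, smul_mul_assoc, mul_smul_comm, h1, h2, smul_zero]
  abel_nf

/-- The Taylor expansion in the single odd coordinate labelled `a`; it stops at first order because
that coordinate squares to zero. -/
theorem killOdd_insert (F : Finset (Od p)) (a : Od p) (g : SF U) :
    killOdd U F g = killOdd U (insert a F) g + coord U a.1 * pd U a.1 (killOdd U F g) := by
  induction g using SF.induction with
  | add x y hx hy =>
    simp only [map_add, mul_add]
    nth_rewrite 1 [hx, hy]
    abel_nf
  | mk f x =>
    rw [killOdd_mk, killOdd_mk, pd_odd_mk a.2, coord_odd a.2, SF.mk_mul_mk, one_mul, ← map_add]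
    congr 1
    set π : (Od p → ℝ) →ₗ[ℝ] Od p → ℝ := LinearMap.pi fun b =>
      if b ∈ F then 0 else LinearMap.proj b with hπ
    set π' : (Od p → ℝ) →ₗ[ℝ] Od p → ℝ := LinearMap.pi fun b =>
      if b ∈ insert a F then 0 else LinearMap.proj b with hπ'
    have hv : ∀ v, π v = π' v + π v a • Pi.single a 1 := by
      intro v
      ext b
      by_cases hb : b = a
      · subst hb; simp [π, π']
      · simp [π, π', hb]
    set e : ExteriorAlgebra ℝ (Od p → ℝ) := ExteriorAlgebra.ι ℝ (Pi.single a 1) with he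
    induction x using CliffordAlgebra.left_induction with
    | algebraMap r =>
      have : ∀ σ : (Od p → ℝ) →ₗ[ℝ] Od p → ℝ, ExteriorAlgebra.map σ
          (algebraMap ℝ (ExteriorAlgebra ℝ (Od p → ℝ)) r) = algebraMap ℝ _ r :=
        fun σ => AlgHom.commutes _ r
      erw [this, this, CliffordAlgebra.contractLeft_algebraMap]
      rw [mul_zero, add_zero]
    | add x y hx hy =>
      rw [map_add, map_add, map_add, mul_add, add_add_add_comm, ← hx, ← hy]
    | ι_mul x v hx =>
      have hm : ∀ σ : (Od p → ℝ) →ₗ[ℝ] Od p → ℝ, ExteriorAlgebra.map σ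
          (CliffordAlgebra.ι (0 : QuadraticForm ℝ (Od p → ℝ)) v * x) =
          CliffordAlgebra.ι (0 : QuadraticForm ℝ (Od p → ℝ)) (σ v) * ExteriorAlgebra.map σ x :=
        fun σ => (map_mul (ExteriorAlgebra.map σ) (ExteriorAlgebra.ι ℝ v) x).trans
          (by rw [ExteriorAlgebra.map_apply_ι])
      rw [hm, hm, CliffordAlgebra.contractLeft_ι_mul]
      have hs : CliffordAlgebra.ι (0 : QuadraticForm ℝ (Od p → ℝ)) (π v) =
          CliffordAlgebra.ι (0 : QuadraticForm ℝ (Od p → ℝ)) (π' v) + π v a • e := by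
        conv_lhs => rw [hv v, map_add, map_smul]
      have hee : e * e = 0 := ExteriorAlgebra.ι_sq_zero _
      have hanti : e * CliffordAlgebra.ι (0 : QuadraticForm ℝ (Od p → ℝ)) (π' v) =
          -(CliffordAlgebra.ι (0 : QuadraticForm ℝ (Od p → ℝ)) (π' v) * e) :=
        eq_neg_of_add_eq_zero_left (ExteriorAlgebra.ι_add_mul_swap _ _)
      rw [LinearMap.proj_apply, hs]
      generalize CliffordAlgebra.contractLeft _ (ExteriorAlgebra.map π x) = d at *
      rw [hx]
      exact mul_add_aux _ _ _ _ _ hee hanti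

theorem pd_killOdd {F : Finset (Od p)} {a : Od p} (ha : a ∉ F) (g : SF U) :
    pd U a.1 (killOdd U F g) = killOdd U F (pd U a.1 g) := by
  induction g using SF.induction with
  | add x y hx hy => simp only [map_add, hx, hy]
  | mk f x =>
    rw [killOdd_mk, pd_odd_mk a.2, pd_odd_mk a.2, killOdd_mk]
    congr 1
    set π : (Od p → ℝ) →ₗ[ℝ] Od p → ℝ := LinearMap.pi fun b =>
      if b ∈ F then 0 else LinearMap.proj b with hπ
    induction x using CliffordAlgebra.left_induction with
    | algebraMap r =>
      have : ∀ σ : (Od p → ℝ) →ₗ[ℝ] Od p → ℝ, ExteriorAlgebra.map σ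
          (algebraMap ℝ (ExteriorAlgebra ℝ (Od p → ℝ)) r) = algebraMap ℝ _ r :=
        fun σ => AlgHom.commutes _ r
      erw [this, CliffordAlgebra.contractLeft_algebraMap]
      simp
    | add x y hx hy => simp only [map_add, hx, hy]
    | ι_mul x v hx =>
      have hm : ∀ x, ExteriorAlgebra.map π
          (CliffordAlgebra.ι (0 : QuadraticForm ℝ (Od p → ℝ)) v * x) =
          CliffordAlgebra.ι (0 : QuadraticForm ℝ (Od p → ℝ)) (π v) * ExteriorAlgebra.map π x :=
        fun x => (map_mul (ExteriorAlgebra.map π) (ExteriorAlgebra.ι ℝ v) x).trans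
          (by rw [ExteriorAlgebra.map_apply_ι])
      rw [hm, CliffordAlgebra.contractLeft_ι_mul, CliffordAlgebra.contractLeft_ι_mul, map_sub,
        map_smul, hm, hx]
      simp [π, ha]

/-- A function is recovered from the bodies of its iterated odd derivatives, and no more derivatives
are needed than there are odd coordinates. The coordinates are put back one at a time. -/
theorem eq_zero_of_mem_vanishing {k : ℕ} (hk : Fintype.card (Od p) < k) {g : SF U}
    (hg : g ∈ vanishing U k) : g = 0 := by
  -- Here `n` counts the odd coordinates that have not been set to zero.
  have key : ∀ (n : ℕ) (F : Finset (Od p)), Fᶜ.card = n → ∀ k, n < k →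
      ∀ g ∈ vanishing U k, killOdd U F g = 0 := by
    intro n
    induction n with
    | zero =>
      intro F hF k hk g hg
      obtain ⟨k, rfl⟩ := Nat.exists_eq_succ_of_ne_zero (by omega : k ≠ 0)
      rw [Finset.card_eq_zero, Finset.compl_eq_empty_iff] at hF
      rw [hF, killOdd_univ, (mem_vanishing_succ.1 hg).1]
      simp
    | succ n ih =>
      intro F hF k hk g hg
      obtain ⟨k, rfl⟩ := Nat.exists_eq_succ_of_ne_zero (by omega : k ≠ 0)
      obtain ⟨a, ha⟩ := Finset.card_pos.1 (by omega : 0 < Fᶜ.card)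
      have ha' : a ∉ F := Finset.mem_compl.1 ha
      have hc : (insert a F)ᶜ.card = n := by
        rw [Finset.compl_insert, Finset.card_erase_of_mem ha, hF]; rfl
      -- Two successive expansions in the coordinate `a`: the terms free of it vanish by induction,
      -- and the remainder contains the second derivative in that odd coordinate, which is zero.
      rw [killOdd_insert F a, ih _ hc _ (by omega) g hg, pd_killOdd ha', killOdd_insert F a,
        ih _ hc k (by omega) _ ((mem_vanishing_succ.1 hg).2 a.1 a.2), ← pd_killOdd ha',
        pd_pd_self a.2]
      simp
  rw [← killOdd_empty g]
  exact key _ ∅ (by rw [Finset.compl_empty, Finset.card_univ]) k hk g hg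

/-- A set of functions with zero body which is closed under odd derivatives is zero. -/
theorem eq_zero_of_closed (S : Set (SF U)) (hb : ∀ g ∈ S, body U g = 0)
    (hd : ∀ a, p a = 1 → ∀ g ∈ S, pd U a g ∈ S) {g : SF U} (hg : g ∈ S) : g = 0 := by
  have : ∀ k, ∀ g ∈ S, g ∈ vanishing U k := by
    intro k
    induction k with
    | zero => intros; trivial
    | succ k ih =>
      intro g hg
      exact mem_vanishing_succ.2 ⟨hb g hg, fun a ha => ih _ (hd a ha g hg)⟩
  exact eq_zero_of_mem_vanishing (Nat.lt_succ_self _) (this _ g hg)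

/-- A family of functions with zero body whose odd derivatives are combinations of functions of the
family vanishes. -/
theorem eq_zero_of_family {I J : Type*} [Fintype J] (D : I → SF U) (hb : ∀ i, body U (D i) = 0)
    (c : Od p → J → SF U) (next : J → I → I)
    (hd : ∀ a i, pd U a.1 (D i) = ∑ j, c a j * D (next j i)) (i : I) : D i = 0 := by
  -- The closed set is the ideal generated by the family: by the Leibniz rule a derivative may also
  -- fall on a coefficient without leaving the ideal.
  refine eq_zero_of_closed (Submodule.span (SF U) (Set.range D) : Set (SF U)) ?_ ?_
    (Submodule.subset_span ⟨i, rfl⟩)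
  · intro g hg
    induction hg using Submodule.span_induction with
    | mem x hx => obtain ⟨i, rfl⟩ := hx; exact hb i
    | zero => exact map_zero _
    | add x y _ _ hx hy => rw [map_add, hx, hy, add_zero]
    | smul a x _ hx => rw [smul_eq_mul, map_mul, hx, mul_zero]
  · intro a ha g hg
    induction hg using Submodule.span_induction with
    | mem x hx =>
      obtain ⟨i, rfl⟩ := hx
      rw [hd ⟨a, ha⟩ i]
      exact Submodule.sum_mem _ fun j _ => Submodule.smul_mem _ _ (Submodule.subset_span ⟨_, rfl⟩)
    | zero => rw [map_zero]; exact Submodule.zero_mem _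
    | add x y _ _ hx hy => rw [map_add]; exact Submodule.add_mem _ hx hy
    | smul b x hx' hx =>
      rw [smul_eq_mul, pd_mul]
      exact Submodule.add_mem _ (Submodule.smul_mem _ _ hx') (Submodule.smul_mem _ _ hx)

end Calculus

/-! ## Calculus of morphisms of superdomains -/

section PullBody

variable {ι ι' : Type*} {p : ι → ZMod 2} {p' : ι' → ZMod 2} [Fintype ι] [Fintype ι']
  {U : Opens (Ev p → ℝ)} {V : Opens (Ev p' → ℝ)}

theorem Mor.ext {φ ψ : Mor U V} (h : ∀ B, φ.comp B = ψ.comp B) : φ = ψ := by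
  cases φ
  cases ψ
  congr
  exact funext h

theorem Mor.pullBody_apply (φ : Mor U V) (f : Smooth V) (x : U) :
    (φ.pullBody f).1 x = f.1 ⟨φ.point x, φ.maps x⟩ :=
  congrArg f.1 (Subtype.ext (funext fun _ => extendZero_apply _ x))

theorem sum_eq_even_add_odd {M : Type*} [AddCommMonoid M] (F : ι → M) :
    ∑ A, F A = ∑ a : Ev p, F a.1 + ∑ a : Od p, F a.1 := by
  rw [← Fintype.sum_subtype_add_sum_subtype (fun A => p A = 0) F]
  congr 1
  have h : ∀ A, (¬ p A = 0) ↔ p A = 1 := fun A =>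
    ⟨eq_one_of_ne_zero _, fun h => by rw [h]; decide⟩
  exact Fintype.sum_equiv (Equiv.subtypeEquivRight h) _ _ fun _ => rfl

variable [DecidableEq ι']

/-- The chain rule for the underlying map of a morphism. -/
theorem Mor.dirDeriv_pullBody (φ : Mor U V) (v : Ev p → ℝ) (f : Smooth V) :
    dirDeriv U v (φ.pullBody f) = ∑ b : Ev p', dirDeriv U v (body U (φ.comp b)) *
      φ.pullBody (dirDeriv V (Pi.single b 1) f) := by
  ext x
  set F : (Ev p → ℝ) → Ev p' → ℝ := fun x b => extendZero (body U (φ.comp b)).1 x with hF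
  have hFx : F x = φ.point x := funext fun b => extendZero_apply _ x
  have hFd : ∀ b, DifferentiableAt ℝ (fun x => F x b) x := fun b =>
    differentiableAt_extendZero (body U (φ.comp b)) x
  have hfd : DifferentiableAt ℝ (extendZero f.1) (F x) := by
    rw [hFx]
    exact differentiableAt_extendZero f ⟨φ.point x, φ.maps x⟩
  rw [dirDeriv_apply_of_eq v _ (extendZero f.1 ∘ F) (fun y => by
    rw [φ.pullBody_apply, Function.comp_apply,
      show F y = φ.point y from funext fun b => extendZero_apply _ y]
    exact (extendZero_apply f.1 ⟨φ.point y, φ.maps y⟩).symm),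
    fderiv_comp _ hfd (differentiableAt_pi.2 hFd), fderiv_pi hFd]
  rw [ContinuousLinearMap.comp_apply]
  rw [show ((∑ b : Ev p', dirDeriv U v (body U (φ.comp b)) *
      φ.pullBody (dirDeriv V (Pi.single b 1) f) : Smooth U) : U → ℝ) x =
      ∑ b : Ev p', (dirDeriv U v (body U (φ.comp b))).1 x *
        (φ.pullBody (dirDeriv V (Pi.single b 1) f)).1 x by
    rw [AddSubmonoidClass.coe_finsetSum, Finset.sum_apply]; rfl]
  -- The image of `v` under the derivative of the underlying map is expanded in the standard basis
  -- of the target.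
  conv_lhs => rw [← Finset.univ_sum_single (ContinuousLinearMap.pi (fun b => fderiv ℝ (fun x => F x b) x) v)]
  rw [map_sum]
  refine Finset.sum_congr rfl fun b _ => ?_
  have hb : (φ.pullBody (dirDeriv V (Pi.single b 1) f)).1 x =
      fderiv ℝ (extendZero f.1) (F x) (Pi.single b 1) := by
    rw [φ.pullBody_apply, dirDeriv_apply]
    exact congrArg (fun y => fderiv ℝ (extendZero f.1) y (Pi.single b 1)) hFx.symm
  rw [hb, dirDeriv_apply, show Pi.single b ((ContinuousLinearMap.pi fun b => fderiv ℝ (fun x => F x b) x) v b) =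
    (fderiv ℝ (fun x => F x b) x v) • (Pi.single b (1 : ℝ) : Ev p' → ℝ) by
      rw [← Pi.single_smul, smul_eq_mul, mul_one]; rfl, map_smul, smul_eq_mul]

end PullBody

namespace Mor

/-! ### Taylor substitution, the chain rule and multiplicativity of pullbacks. -/

section Taylor

variable {ι ι' : Type*} {p : ι → ZMod 2} {p' : ι' → ZMod 2} [Fintype ι] [Fintype ι']
  [DecidableEq ι] [DecidableEq ι'] {U : Opens (Ev p → ℝ)} {V : Opens (Ev p' → ℝ)} (φ : Mor U V)

theorem taylorTerm_succ (k : ℕ) (f : Smooth V) : φ.taylorTerm (k + 1) f =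
    ∑ b : Ev p', φ.nil b * φ.taylorTerm k (dirDeriv V (Pi.single b 1) f) := by
  rw [taylorTerm, LinearMap.sum_apply]; rfl

theorem pd_odd_nil {a : ι} (ha : p a = 1) (b : Ev p') :
    pd U a (φ.nil b) = pd U a (φ.comp b) := by
  rw [nil, map_sub, pd_odd_mk ha, CliffordAlgebra.contractLeft_one, map_zero, sub_zero]

/-- Each nilpotent factor is even with zero body, so it contributes two orders. -/
theorem taylorTerm_mem_vanishing (k : ℕ) (f : Smooth V) :
    φ.taylorTerm k f ∈ vanishing U (2 * k) := by
  induction k generalizing f with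
  | zero => trivial
  | succ k ih =>
    rw [taylorTerm_succ, show 2 * (k + 1) = 2 + 2 * k by ring]
    exact Submodule.sum_mem _ fun b _ => mul_mem_vanishing
      (mem_vanishing_two (φ.hasParity_nil b) (φ.body_nil b)) (ih _)

/-- The term is a symmetric expression in `k + 1` even nilpotent factors, since even functions and
even derivatives commute. Each factor contributes equally when differentiated, and the Taylor
coefficients do not involve odd coordinates. -/
theorem pd_odd_taylorTerm {a : ι} (ha : p a = 1) (k : ℕ) (f : Smooth V) :
    pd U a (φ.taylorTerm (k + 1) f) = (k + 1 : ℝ) •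
      ∑ b : Ev p', pd U a (φ.comp b) * φ.taylorTerm k (dirDeriv V (Pi.single b 1) f) := by
  induction k generalizing f with
  | zero =>
    rw [taylorTerm_succ, map_sum]
    simp only [Nat.cast_zero, zero_add, one_smul]
    refine Finset.sum_congr rfl fun b _ => ?_
    have h0 : pd U a (φ.taylorTerm 0 (dirDeriv V (Pi.single b 1) f)) = 0 := by
      change pd U a (SF.mk U _ 1) = 0
      rw [pd_odd_mk ha, CliffordAlgebra.contractLeft_one, map_zero]
    rw [pd_mul, h0, mul_zero, add_zero, φ.pd_odd_nil ha]
  | succ k ih =>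
    rw [taylorTerm_succ, map_sum]
    have h1 : ∀ b : Ev p', pd U a (φ.nil b *
        φ.taylorTerm (k + 1) (dirDeriv V (Pi.single b 1) f)) =
        pd U a (φ.comp b) * φ.taylorTerm (k + 1) (dirDeriv V (Pi.single b 1) f) +
        (k + 1 : ℝ) • ∑ c : Ev p', pd U a (φ.comp c) * (φ.nil b *
          φ.taylorTerm k (dirDeriv V (Pi.single b 1) (dirDeriv V (Pi.single c 1) f))) := by
      intro b
      rw [pd_mul_of_hasParity a (φ.hasParity_nil b), ih, φ.pd_odd_nil ha, mul_zero, sgn_zero,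
        one_smul, mul_smul_comm, Finset.mul_sum]
      congr 2
      refine Finset.sum_congr rfl fun c _ => ?_
      rw [← mul_assoc, (φ.hasParity_nil b).even_mul_comm, mul_assoc, dirDeriv_comm]
    rw [Finset.sum_congr rfl fun b _ => h1 b, Finset.sum_add_distrib, ← Finset.smul_sum,
      Finset.sum_comm, Nat.cast_succ, add_smul (k + 1 : ℝ) 1, one_smul, add_comm]
    congr 2
    refine Finset.sum_congr rfl fun b _ => ?_
    rw [← Finset.mul_sum, ← taylorTerm_succ]

/-- The factor `k + 1` from `pd_odd_taylorTerm` turns one inverse factorial into the preceding one,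
so differentiation shifts the Taylor sum by one index. -/
theorem pd_odd_taylor {a : ι} (ha : p a = 1) (f : Smooth V) :
    pd U a (φ.taylor f) =
      ∑ b : Ev p', pd U a (φ.comp b) * φ.taylor (dirDeriv V (Pi.single b 1) f) := by
  have hpos : 0 < Fintype.card ι := Fintype.card_pos_iff.2 ⟨a⟩
  have hle : Fintype.card (Od p) ≤ Fintype.card ι := Fintype.card_subtype_le _
  -- The last term of the truncated sum has order `2 * card ι`, more than the number of odd
  -- coordinates because `ι` is nonempty. Dropping it makes the shifted sums have the same length.
  have hz : ∀ f : Smooth V, φ.taylorTerm (Fintype.card ι) f = 0 := fun f =>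
    eq_zero_of_mem_vanishing (by omega) (φ.taylorTerm_mem_vanishing _ f)
  have h2 : ∀ f : Smooth V, φ.taylor f =
      ∑ k ∈ Finset.range (Fintype.card ι), ((k.factorial : ℝ)⁻¹) • φ.taylorTerm k f := by
    intro f
    rw [taylor, LinearMap.sum_apply, Finset.sum_range_succ, LinearMap.smul_apply, hz, smul_zero,
      add_zero]
    rfl
  simp only [h2 (dirDeriv V _ f)]
  rw [taylor, LinearMap.sum_apply, map_sum, Finset.sum_range_succ']
  have h0 : pd U a (((Nat.factorial 0 : ℝ)⁻¹ • φ.taylorTerm 0) f) = 0 := by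
    rw [LinearMap.smul_apply, map_smul]
    change _ • pd U a (SF.mk U _ 1) = 0
    rw [pd_odd_mk ha, CliffordAlgebra.contractLeft_one, map_zero, smul_zero]
  rw [h0, add_zero]
  simp only [Finset.mul_sum]
  rw [Finset.sum_comm]
  refine Finset.sum_congr rfl fun k _ => ?_
  rw [LinearMap.smul_apply, map_smul, pd_odd_taylorTerm φ ha, smul_smul, Finset.smul_sum]
  refine Finset.sum_congr rfl fun b _ => ?_
  rw [mul_smul_comm]
  congr 1
  rw [Nat.factorial_succ]
  push_cast
  have : (k.factorial : ℝ) ≠ 0 := by exact_mod_cast k.factorial_ne_zero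
  have : (k + 1 : ℝ) ≠ 0 := by positivity
  field_simp

theorem pull_mk (f : Smooth V) (x : ExteriorAlgebra ℝ (Od p' → ℝ)) :
    φ.pull (SF.mk V f x) = φ.taylor f * φ.subOdd x := rfl

theorem pull_mk_one (f : Smooth V) : φ.pull (SF.mk V f 1) = φ.taylor f := by
  rw [pull_mk, map_one, mul_one]

theorem body_taylor (f : Smooth V) : body U (φ.taylor f) = φ.pullBody f := by
  rw [← pull_mk_one, body_pull, body_mk, map_one, one_smul]

theorem taylor_algebraMap (r : ℝ) :
    φ.taylor (algebraMap ℝ (Smooth V) r) = algebraMap ℝ (SF U) r := by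
  rw [← sub_eq_zero]
  refine eq_zero_of_family (I := Unit) (J := Empty)
    (fun _ => φ.taylor (algebraMap ℝ (Smooth V) r) - algebraMap ℝ (SF U) r) ?_
    (fun _ j => nomatch j) (fun j => nomatch j) ?_ ()
  · intro _
    rw [map_sub, body_taylor, AlgHom.commutes, AlgHom.commutes, sub_self]
  · intro a _
    simp [pd_odd_taylor φ a.2, dirDeriv_algebraMap, pd_algebraMap]

theorem taylor_one : φ.taylor 1 = 1 := by
  have := φ.taylor_algebraMap 1
  rwa [(algebraMap ℝ (Smooth V)).map_one, (algebraMap ℝ (SF U)).map_one] at this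

/-- The family consists of the defects for all pairs of smooth functions: an odd derivative of the
defect of `(f, g)` is a combination of the defects of `(∂f, g)` and `(f, ∂g)`. Bodies agree because
`pullBody` is multiplicative. -/
theorem taylor_mul (f g : Smooth V) : φ.taylor (f * g) = φ.taylor f * φ.taylor g := by
  rw [← sub_eq_zero]
  refine eq_zero_of_family (I := Smooth V × Smooth V) (J := Ev p' ⊕ Ev p')
    (fun i => φ.taylor (i.1 * i.2) - φ.taylor i.1 * φ.taylor i.2) ?_
    (fun a => Sum.elim (fun b => pd U a.1 (φ.comp b)) (fun b => pd U a.1 (φ.comp b)))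
    (Sum.elim (fun b i => (dirDeriv V (Pi.single b 1) i.1, i.2))
      (fun b i => (i.1, dirDeriv V (Pi.single b 1) i.2))) ?_ (f, g)
  · intro i
    rw [map_sub, body_taylor, map_mul (body U), body_taylor, body_taylor, map_mul φ.pullBody,
      sub_self]
  · intro a i
    have h1 : pd U a.1 (φ.taylor i.1 * φ.taylor i.2) = ∑ b : Ev p', pd U a.1 (φ.comp b) *
        (φ.taylor (dirDeriv V (Pi.single b 1) i.1) * φ.taylor i.2 +
          φ.taylor i.1 * φ.taylor (dirDeriv V (Pi.single b 1) i.2)) := by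
      rw [pd_mul_of_hasParity _ (φ.hasParity_taylor _), pd_odd_taylor φ a.2, pd_odd_taylor φ a.2,
        mul_zero, sgn_zero, one_smul, Finset.sum_mul, Finset.mul_sum, ← Finset.sum_add_distrib]
      refine Finset.sum_congr rfl fun b _ => ?_
      rw [← mul_assoc (φ.taylor i.1), (φ.hasParity_taylor i.1).even_mul_comm (pd U a.1 (φ.comp b)),
        mul_add, mul_assoc, mul_assoc]
    refine (map_sub _ _ _).trans ((congrArg₂ (· - ·) (pd_odd_taylor φ a.2 _) h1).trans ?_)
    rw [← Finset.sum_sub_distrib, Fintype.sum_sum_type, ← Finset.sum_add_distrib]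
    refine Finset.sum_congr rfl fun b _ => ?_
    simp only [Sum.elim_inl, Sum.elim_inr]
    rw [dirDeriv_mul, map_add, ← mul_sub, ← mul_add, add_sub_add_comm]

theorem taylor_evenCoord (b : Ev p') : φ.taylor (evenCoord V b) = φ.comp b := by
  rw [← sub_eq_zero]
  refine eq_zero_of_family (I := Unit) (J := Empty)
    (fun _ => φ.taylor (evenCoord V b) - φ.comp b) ?_
    (fun _ j => nomatch j) (fun j => nomatch j) ?_ ()
  · intro _
    rw [map_sub, body_taylor, sub_eq_zero]
    ext x
    rw [pullBody_apply]
    rfl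
  · intro a _
    rw [map_sub, pd_odd_taylor φ a.2, Finset.sum_eq_single b]
    · rw [dirDeriv_evenCoord, taylor_algebraMap, Pi.single_eq_same, map_one, mul_one, sub_self]
      rfl
    · intro c _ hc
      rw [dirDeriv_evenCoord, Pi.single_eq_of_ne hc.symm, map_zero, map_zero, mul_zero]
    · simp

/-- The defects of the chain rule, for all `f`, form a family closed under odd derivatives because
these commute with the even derivative. Their bodies vanish by the classical chain rule
`dirDeriv_pullBody`. -/
theorem pd_even_taylor {a : ι} (ha : p a = 0) (f : Smooth V) :
    pd U a (φ.taylor f) =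
      ∑ b : Ev p', pd U a (φ.comp b) * φ.taylor (dirDeriv V (Pi.single b 1) f) := by
  rw [← sub_eq_zero]
  refine eq_zero_of_family (fun f : Smooth V => pd U a (φ.taylor f) -
      ∑ b : Ev p', pd U a (φ.comp b) * φ.taylor (dirDeriv V (Pi.single b 1) f)) ?_
    (fun θ b => pd U θ.1 (φ.comp b.1)) (fun (b : Ev p') f => dirDeriv V (Pi.single b 1) f) ?_ f
  · intro f
    rw [map_sub, body_pd_even ha, body_taylor, dirDeriv_pullBody, map_sum, sub_eq_zero]
    refine Finset.sum_congr rfl fun b _ => ?_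
    rw [map_mul, body_pd_even ha, body_taylor]
  · intro θ f
    have hpar : ∀ b : Ev p', HasParity 0 (pd U a (φ.comp b)) := fun b =>
      (hasParity_pd a (φ.parity b)).congr (by rw [ha, b.2, add_zero])
    have hcomm : ∀ g : SF U, pd U θ.1 (pd U a g) = pd U a (pd U θ.1 g) := fun g => by
      rw [pd_pd, ha, mul_zero, sgn_zero, one_smul]
    simp only [mul_sub, Finset.mul_sum]
    rw [Finset.sum_sub_distrib, map_sub, hcomm, pd_odd_taylor φ θ.2, map_sum, map_sum]
    have h1 : ∀ b : Ev p', pd U a (pd U θ.1 (φ.comp b) *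
        φ.taylor (dirDeriv V (Pi.single b 1) f)) = pd U a (pd U θ.1 (φ.comp b)) *
        φ.taylor (dirDeriv V (Pi.single b 1) f) + pd U θ.1 (φ.comp b) *
        pd U a (φ.taylor (dirDeriv V (Pi.single b 1) f)) := fun b => by
      rw [pd_mul, ha, twist_zero]
    have h2 : ∀ b : Ev p', pd U θ.1 (pd U a (φ.comp b) *
        φ.taylor (dirDeriv V (Pi.single b 1) f)) = pd U a (pd U θ.1 (φ.comp b)) *
        φ.taylor (dirDeriv V (Pi.single b 1) f) + ∑ c : Ev p', pd U θ.1 (φ.comp c) *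
        (pd U a (φ.comp b) *
          φ.taylor (dirDeriv V (Pi.single b 1) (dirDeriv V (Pi.single c 1) f))) := fun b => by
      rw [pd_mul_of_hasParity _ (hpar b), hcomm, mul_zero, sgn_zero, one_smul, pd_odd_taylor φ θ.2,
        Finset.mul_sum]
      congr 1
      refine Finset.sum_congr rfl fun c _ => ?_
      rw [← mul_assoc, (hpar b).even_mul_comm, mul_assoc, dirDeriv_comm]
    rw [Finset.sum_congr rfl fun b _ => h1 b, Finset.sum_congr rfl fun b _ => h2 b,
      Finset.sum_add_distrib, Finset.sum_add_distrib, add_sub_add_left_eq_sub]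
    congr 1
    exact Finset.sum_comm

theorem pd_taylor (a : ι) (f : Smooth V) : pd U a (φ.taylor f) =
    ∑ b : Ev p', pd U a (φ.comp b) * φ.taylor (dirDeriv V (Pi.single b 1) f) := by
  rcases zmod_two_cases (p a) with ha | ha
  · exact φ.pd_even_taylor ha f
  · exact φ.pd_odd_taylor ha f

theorem subOdd_ι (v : Od p' → ℝ) :
    φ.subOdd (ExteriorAlgebra.ι ℝ v) = ∑ b : Od p', v b • φ.comp b := by
  rw [subOdd, ExteriorAlgebra.lift_ι_apply, LinearMap.sum_apply]
  rfl

theorem hasParity_subOdd_ι (v : Od p' → ℝ) :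
    HasParity 1 (φ.subOdd (ExteriorAlgebra.ι ℝ v)) := by
  rw [subOdd_ι]
  exact HasParity.sum _ _ fun b _ => ((φ.parity b.1).congr b.2).smul _

/-- Both sides obey the same signed Leibniz rule, contraction being the odd partial derivative, so
induction on the number of generators applies. -/
theorem pd_subOdd (a : ι) (x : ExteriorAlgebra ℝ (Od p' → ℝ)) :
    pd U a (φ.subOdd x) = ∑ b : Od p', pd U a (φ.comp b) * φ.subOdd
      (CliffordAlgebra.contractLeft (Q := (0 : QuadraticForm ℝ (Od p' → ℝ)))
        (LinearMap.proj b) x) := by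
  induction x using CliffordAlgebra.left_induction with
  | algebraMap r =>
    have : φ.subOdd (algebraMap ℝ (ExteriorAlgebra ℝ (Od p' → ℝ)) r) = algebraMap ℝ _ r :=
      AlgHom.commutes _ r
    erw [this, pd_algebraMap]
    simp only [CliffordAlgebra.contractLeft_algebraMap]
    exact (Finset.sum_eq_zero fun b _ => (congrArg _ (map_zero φ.subOdd)).trans (mul_zero _)).symm
  | add x y hx hy =>
    simp only [map_add, mul_add, Finset.sum_add_distrib, hx, hy]
  | ι_mul y v ih =>
    have hmul : ∀ y : ExteriorAlgebra ℝ (Od p' → ℝ),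
        φ.subOdd (CliffordAlgebra.ι (0 : QuadraticForm ℝ (Od p' → ℝ)) v * y) =
        φ.subOdd (ExteriorAlgebra.ι ℝ v) * φ.subOdd y := fun y => map_mul φ.subOdd _ y
    have hsub : ∀ (r : ℝ) (y z : ExteriorAlgebra ℝ (Od p' → ℝ)),
        φ.subOdd (r • y - CliffordAlgebra.ι (0 : QuadraticForm ℝ (Od p' → ℝ)) v * z) =
        r • φ.subOdd y - φ.subOdd (ExteriorAlgebra.ι ℝ v) * φ.subOdd z := fun r y z => by
      erw [map_sub, map_smul]
      exact congrArg _ (hmul z)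
    simp only [CliffordAlgebra.contractLeft_ι_mul]
    erw [hmul, Finset.sum_congr rfl fun b _ => congrArg _ (hsub _ _ _)]
    rw [pd_mul_of_hasParity _ (φ.hasParity_subOdd_ι v)]
    simp only [mul_sub]
    rw [Finset.sum_sub_distrib]
    rw [sub_eq_add_neg]
    congr 1
    · rw [subOdd_ι, map_sum, Finset.sum_mul]
      refine Finset.sum_congr rfl fun b _ => ?_
      rw [map_smul, smul_mul_assoc, mul_smul_comm]
      rfl
    · erw [ih]
      rw [Finset.mul_sum, Finset.smul_sum, ← Finset.sum_neg_distrib]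
      refine Finset.sum_congr rfl fun b _ => ?_
      rw [← mul_assoc, ← mul_assoc, (φ.hasParity_subOdd_ι v).mul_comm
        (hasParity_pd a (φ.parity b.1)), smul_mul_assoc, smul_smul, b.2]
      -- One sign comes from moving the derivative past the odd generator, the other from moving
      -- that generator past the derivative of an odd component. Their product is the minus sign of
      -- the contraction formula for either parity of `a`.
      have : sgn (p a * 1) * sgn (1 * (p a + 1)) = -1 := by
        rcases zmod_two_cases (p a) with h | h
        · simp [h]
        · simp [h, show (1 : ZMod 2) + 1 = 0 from rfl]
      rw [this, neg_one_smul]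

/-- The chain rule. -/
theorem pd_pull (a : ι) (f : SF V) :
    pd U a (φ.pull f) = ∑ B, pd U a (φ.comp B) * φ.pull (pd V B f) := by
  induction f using SF.induction with
  | add f g hf hg => simp only [map_add, hf, hg, mul_add, Finset.sum_add_distrib]
  | mk f x =>
    rw [sum_eq_even_add_odd (p := p'), pull_mk, pd_mul_of_hasParity _ (φ.hasParity_taylor f),
      mul_zero, sgn_zero, one_smul, pd_taylor, pd_subOdd, Finset.sum_mul, Finset.mul_sum]
    congr 1
    · refine Finset.sum_congr rfl fun b _ => ?_
      rw [pd_even_mk b.2, pull_mk, mul_assoc]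
    · refine Finset.sum_congr rfl fun b _ => ?_
      rw [pd_odd_mk b.2, pull_mk, ← mul_assoc, (φ.hasParity_taylor f).even_mul_comm, mul_assoc]

theorem pull_one : φ.pull (1 : SF V) = 1 := by
  rw [SF.one_eq, pull_mk_one, taylor_one, SF.one_eq]

theorem pull_mul (f g : SF V) : φ.pull (f * g) = φ.pull f * φ.pull g := by
  induction f using SF.induction with
  | add a b ha hb => simp only [add_mul, map_add, ha, hb]
  | mk f x =>
    induction g using SF.induction with
    | add a b ha hb => simp only [mul_add, map_add, ha, hb]
    | mk g y =>
      rw [SF.mk_mul_mk, pull_mk, pull_mk, pull_mk, taylor_mul, map_mul, mul_assoc, mul_assoc,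
        ← mul_assoc (φ.taylor g), (φ.hasParity_taylor g).even_mul_comm, mul_assoc]

theorem pull_coord (B : ι') : φ.pull (coord V B) = φ.comp B := by
  rcases zmod_two_cases (p' B) with h | h
  · rw [coord_even h, pull_mk_one, taylor_evenCoord]
  · rw [coord_odd h, pull_mk, subOdd_ι]
    rw [taylor_one, one_mul, Finset.sum_eq_single ⟨B, h⟩]
    · simp
    · intro b _ hb
      rw [Pi.single_eq_of_ne hb, zero_smul]
    · simp

/-- A linear map with the body of a pullback which satisfies the chain rule for odd derivatives is
the pullback. -/
theorem pull_ext (T : SF V →ₗ[ℝ] SF U) (hb : ∀ f, body U (T f) = φ.pullBody (body V f))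
    (hd : ∀ a, p a = 1 → ∀ f, pd U a (T f) = ∑ B, pd U a (φ.comp B) * T (pd V B f)) (f : SF V) :
    T f = φ.pull f := by
  rw [← sub_eq_zero]
  refine eq_zero_of_family (fun f : SF V => T f - φ.pull f) ?_
    (fun θ B => pd U θ.1 (φ.comp B)) (fun (B : ι') f => pd V B f) ?_ f
  · intro f
    rw [map_sub, hb, body_pull, sub_self]
  · intro a f
    rw [map_sub, hd a.1 a.2, pd_pull, ← Finset.sum_sub_distrib]
    exact Finset.sum_congr rfl fun B _ => (mul_sub _ _ _).symm

end Taylor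

/-! ### Functoriality of pullbacks. -/

section Composition

variable {ι ι' ι'' ι₂ : Type*} {p : ι → ZMod 2} {p' : ι' → ZMod 2} {p'' : ι'' → ZMod 2}
  {p₂ : ι₂ → ZMod 2} [Fintype ι] [Fintype ι'] [Fintype ι''] [Fintype ι₂]
  [DecidableEq ι] [DecidableEq ι'] [DecidableEq ι''] [DecidableEq ι₂]
  {U : Opens (Ev p → ℝ)} {V : Opens (Ev p' → ℝ)} {W : Opens (Ev p'' → ℝ)} {V₂ : Opens (Ev p₂ → ℝ)}

theorem point_eq_of_comp {φ : Mor U V} {ψ : Mor V W} {χ : Mor U W}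
    (h : ∀ C, χ.comp C = φ.pull (ψ.comp C)) (x : U) :
    χ.point x = ψ.point ⟨φ.point x, φ.maps x⟩ := by
  funext c
  change (body U (χ.comp c)).1 x = _
  rw [h, body_pull, pullBody_apply]
  rfl

/-- Functoriality of pullbacks. -/
theorem pull_pull {φ : Mor U V} {ψ : Mor V W} {χ : Mor U W}
    (h : ∀ C, χ.comp C = φ.pull (ψ.comp C)) (f : SF W) :
    φ.pull (ψ.pull f) = χ.pull f := by
  refine χ.pull_ext (φ.pull ∘ₗ ψ.pull) ?_ ?_ f
  · intro f
    change body U (φ.pull (ψ.pull f)) = _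
    rw [body_pull, body_pull]
    ext x
    rw [pullBody_apply, pullBody_apply, pullBody_apply]
    exact congrArg _ (Subtype.ext (point_eq_of_comp h x).symm)
  · intro a _ f
    change pd U a (φ.pull (ψ.pull f)) = ∑ C, pd U a (χ.comp C) * φ.pull (ψ.pull (pd W C f))
    simp only [pd_pull, h, map_sum, pull_mul, Finset.mul_sum, Finset.sum_mul]
    rw [Finset.sum_comm]
    simp only [mul_assoc]

/-- Composition of morphisms. -/
def trans (φ : Mor U V) (ψ : Mor V W) : Mor U W where
  comp C := φ.pull (ψ.comp C)
  parity C := φ.hasParity_pull (ψ.parity C)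
  maps x := by
    convert ψ.maps ⟨φ.point x, φ.maps x⟩ using 2 with c
    rw [body_pull, pullBody_apply]

theorem pull_trans (φ : Mor U V) (ψ : Mor V W) (f : SF W) :
    (φ.trans ψ).pull f = φ.pull (ψ.pull f) :=
  (pull_pull (fun _ => rfl) f).symm

/-- Commutativity of a square needs to be checked on coordinates only; most later naturality
statements are reduced to generators this way. -/
theorem pull_square {φ : Mor U V} {ψ : Mor V W} {φ' : Mor U V₂} {ψ' : Mor V₂ W}
    (h : ∀ C, φ.pull (ψ.comp C) = φ'.pull (ψ'.comp C)) (f : SF W) :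
    φ.pull (ψ.pull f) = φ'.pull (ψ'.pull f) := by
  rw [pull_pull (χ := φ'.trans ψ') fun C => (h C).symm, pull_trans]

end Composition

end Mor

/-! ### Restriction of functions and morphisms. -/

section Restriction

variable {ι ι' κ : Type*} {p : ι → ZMod 2} {p' : ι' → ZMod 2} [Fintype ι] [Fintype ι']
  [DecidableEq ι] [DecidableEq ι'] {U W W₂ : Opens (Ev p → ℝ)} {V V' : Opens (Ev p' → ℝ)}

theorem res_mk (h : W ≤ U) (f : Smooth U) (x : ExteriorAlgebra ℝ (Od p → ℝ)) :
    res h (SF.mk U f x) = SF.mk W (smoothComp id contDiffOn_id (fun x => h x.2) f) x := rfl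

theorem pd_res (h : W ≤ U) (A : ι) (f : SF U) : pd W A (res h f) = res h (pd U A f) := by
  induction f using SF.induction with
  | add a b ha hb => simp only [map_add, ha, hb]
  | mk f x =>
    rcases zmod_two_cases (p A) with hA | hA
    · rw [res_mk, pd_even_mk hA, pd_even_mk hA, res_mk]
      congr 2
      ext x
      rw [dirDeriv_apply_of_eq _ _ (extendZero f.1) fun y =>
        (extendZero_apply f.1 ⟨y, h y.2⟩).symm]
      rfl
    · rw [res_mk, pd_odd_mk hA, pd_odd_mk hA, res_mk]

theorem res_coord (h : W ≤ U) (A : ι) : res h (coord U A) = coord W A := by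
  rcases zmod_two_cases (p A) with hA | hA
  · rw [coord_even hA, coord_even hA]; rfl
  · rw [coord_odd hA, coord_odd hA]; rfl

theorem res_res (h : W ≤ U) (h' : W₂ ≤ W) (f : SF U) :
    res h' (res h f) = res (h'.trans h) f := by
  induction f using SF.induction with
  | add a b ha hb => simp only [map_add, ha, hb]
  | mk f x => rfl

theorem res_rfl (f : SF U) : res le_rfl f = f := by
  induction f using SF.induction with
  | add a b ha hb => simp only [map_add, ha, hb]
  | mk f x => rfl

/-- The inclusion of a superdomain. -/
def incl (h : W ≤ U) : Mor W U := coordMor id (fun _ => rfl) fun _ hx => h hx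

/-- Restriction has the body and the odd derivatives required by `pull_ext`. Being a pullback, it is
then governed by functoriality. -/
theorem incl_pull (h : W ≤ U) (f : SF U) : (incl h).pull f = res h f := by
  refine ((incl h).pull_ext (res h).toLinearMap ?_ ?_ f).symm
  · intro f
    change body W (res h f) = _
    rw [body_res]
    ext x
    rw [Mor.pullBody_apply]
    refine congrArg (body U f).1 (Subtype.ext (funext fun a => ?_))
    exact (congrFun (congrArg Subtype.val (body_coord W a)) x).symm
  · intro a _ f
    change pd W a (res h f) = ∑ B, pd W a (coord W B) * res h (pd U B f)
    rw [Finset.sum_eq_single a]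
    · rw [pd_coord, if_pos rfl, one_mul, pd_res]
    · intro B _ hB
      rw [pd_coord, if_neg hB.symm, zero_mul]
    · simp

theorem Mor.restr_comp (φ : Mor U V) (h : W ≤ U)
    (hV : ∀ x : W, φ.point ⟨x, h x.2⟩ ∈ V') (B : ι') :
    (φ.restr h hV).comp B = res h (φ.comp B) := rfl

/-- Pullbacks of restrictions. -/
theorem Mor.restr_pull_res (φ : Mor U V) (h : W ≤ U)
    (hV : ∀ x : W, φ.point ⟨x, h x.2⟩ ∈ V') (hV' : V' ≤ V) (f : SF V) :
    (φ.restr h hV).pull (res hV' f) = res h (φ.pull f) := by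
  rw [← incl_pull, ← incl_pull]
  refine Mor.pull_square (fun C => ?_) f
  change (φ.restr h hV).pull (coord V' C) = _
  rw [pull_coord, incl_pull]
  rfl

theorem Mor.restr_restr_pull (φ : Mor U V) (h : W ≤ U) (h' : W₂ ≤ W)
    (hV : ∀ x : W, φ.point ⟨x, h x.2⟩ ∈ V')
    (hV₂ : ∀ x : W₂, φ.point ⟨x, (h'.trans h) x.2⟩ ∈ V') (f : SF V') :
    res h' ((φ.restr h hV).pull f) = (φ.restr (h'.trans h) hV₂).pull f := by
  rw [← incl_pull]
  refine Mor.pull_pull (fun C => ?_) f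
  rw [incl_pull, restr_comp, restr_comp, res_res]

/-- The pullback by a morphism given by coordinate functions of the domain of definition is a
restriction. -/
theorem Mor.pull_eq_res (φ : Mor W U) (h : W ≤ U) (hφ : ∀ A, φ.comp A = coord W A) (f : SF U) :
    φ.pull f = res h f := by
  rw [← incl_pull]
  congr 2
  exact Mor.ext hφ

theorem point_eq_self (φ : Mor W U) (hφ : ∀ A, φ.comp A = coord W A) (x : W) :
    φ.point x = x := by
  funext a
  change (body W (φ.comp a)).1 x = _
  rw [hφ, body_coord]
  rfl

end Restriction

/-! ## Calculus of vector fields -/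

section VectorFields

variable {ι ι' : Type*} {p : ι → ZMod 2} {p' : ι' → ZMod 2} [Fintype ι] [Fintype ι']
  [DecidableEq ι] [DecidableEq ι'] {U W : Opens (Ev p → ℝ)} {V : Opens (Ev p' → ℝ)}

/-- A homogeneous function of parity `ε` passes `f` at the cost of the sign. -/
theorem HasParity.mul_twist {ε : ZMod 2} {f : SF U} (hf : HasParity ε f) (g : SF U) :
    f * g = twist U ε g * f := by
  rcases zmod_two_cases ε with rfl | rfl
  · rw [twist_zero, hf.even_mul_comm]
  · rw [twist_one, hf.odd_mul_comm]

theorem twist_twist (ε δ : ZMod 2) (f : SF U) : twist U ε (twist U δ f) = twist U (ε + δ) f := by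
  rcases zmod_two_cases ε with rfl | rfl <;> rcases zmod_two_cases δ with rfl | rfl
  · simp
  · simp
  · simp
  · simp [invol_invol, show (1 : ZMod 2) + 1 = 0 from rfl]

namespace VF

@[simp] theorem apply_add (X : VF U) (f g : SF U) : X.apply (f + g) = X.apply f + X.apply g := by
  simp only [apply, map_add, mul_add, Finset.sum_add_distrib]

@[simp] theorem apply_smul (X : VF U) (r : ℝ) (f : SF U) : X.apply (r • f) = r • X.apply f := by
  simp only [apply, map_smul, mul_smul_comm, Finset.smul_sum]

@[simp] theorem apply_zero (X : VF U) : X.apply (0 : SF U) = 0 := by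
  simp [apply]

@[simp] theorem apply_sub (X : VF U) (f g : SF U) : X.apply (f - g) = X.apply f - X.apply g := by
  simp only [apply, map_sub, mul_sub, Finset.sum_sub_distrib]

@[simp] theorem zero_apply (f : SF U) : (0 : VF U).apply f = 0 := by
  simp [apply]

theorem add_apply (X Y : VF U) (f : SF U) : (X + Y).apply f = X.apply f + Y.apply f := by
  simp only [apply, Pi.add_apply, add_mul, Finset.sum_add_distrib]

theorem smul_apply (X : VF U) (r : ℝ) (f : SF U) : (r • X).apply f = r • X.apply f := by
  simp only [apply, Pi.smul_apply, smul_mul_assoc, Finset.smul_sum]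

theorem mul_apply (X : VF U) (g f : SF U) : (g • X).apply f = g * X.apply f := by
  simp only [apply, Pi.smul_apply, smul_eq_mul, mul_assoc, Finset.mul_sum]

theorem apply_sum {J : Type*} (s : Finset J) (X : VF U) (f : J → SF U) :
    X.apply (∑ j ∈ s, f j) = ∑ j ∈ s, X.apply (f j) := by
  simp only [apply, map_sum, Finset.mul_sum]
  exact Finset.sum_comm

@[simp] theorem apply_coord (X : VF U) (A : ι) : X.apply (coord U A) = X A := by
  rw [apply, Finset.sum_eq_single A]
  · rw [pd_coord, if_pos rfl, mul_one]
  · intro B _ hB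
    rw [pd_coord, if_neg hB, mul_zero]
  · simp

theorem ext_apply {X Y : VF U} (h : ∀ f, X.apply f = Y.apply f) : X = Y :=
  funext fun A => by rw [← apply_coord X, h, apply_coord]

/-- The coefficient `X A` has parity `ε + p A`, and the partial derivative twists by `p A`; the two
occurrences of `p A` cancel and a twist by `ε` remains. -/
theorem apply_mul {ε : ZMod 2} {X : VF U} (hX : X.HasParity ε) (f g : SF U) :
    X.apply (f * g) = X.apply f * g + twist U ε f * X.apply g := by
  simp only [apply, pd_mul, mul_add, Finset.sum_add_distrib, Finset.sum_mul, Finset.mul_sum,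
    mul_assoc]
  congr 1
  refine Finset.sum_congr rfl fun A _ => ?_
  rw [← mul_assoc, (hX A).mul_twist, twist_twist, add_assoc, CharTwo.add_self_eq_zero, add_zero,
    mul_assoc]

theorem apply_mul_of_hasParity {ε δ : ZMod 2} {X : VF U} (hX : X.HasParity ε) {f : SF U}
    (hf : SuperGeom.HasParity δ f) (g : SF U) :
    X.apply (f * g) = X.apply f * g + sgn (ε * δ) • (f * X.apply g) := by
  rw [apply_mul hX, hf.twist_eq, smul_mul_assoc]

theorem hasParity_apply {ε δ : ZMod 2} {X : VF U} (hX : X.HasParity ε) {f : SF U}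
    (hf : SuperGeom.HasParity δ f) : SuperGeom.HasParity (ε + δ) (X.apply f) :=
  HasParity.sum _ _ fun A _ => ((hX A).mul (hasParity_pd A hf)).congr (by
    rw [add_assoc, ← add_assoc (p A), CharTwo.add_self_eq_zero, zero_add])

theorem HasParity.bracket {ε δ : ZMod 2} {X Y : VF U} (hX : X.HasParity ε) (hY : Y.HasParity δ) :
    (X.bracket ε δ Y).HasParity (ε + δ) := fun A =>
  ((hasParity_apply hX (hY A)).congr (add_assoc _ _ _).symm).sub
    (((hasParity_apply hY (hX A)).congr (by ring)).smul _)

theorem HasParity.smul {ε : ZMod 2} {X : VF U} (hX : X.HasParity ε) (r : ℝ) :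
    (r • X).HasParity ε := fun A => (hX A).smul r

theorem HasParity.congr {ε δ : ZMod 2} {X : VF U} (hX : X.HasParity ε) (h : ε = δ) :
    X.HasParity δ := h ▸ hX

/-- The bracket of vector fields is the commutator of the corresponding operators. -/
theorem bracket_apply {ε δ : ZMod 2} {X Y : VF U} (hX : X.HasParity ε) (hY : Y.HasParity δ)
    (f : SF U) : (X.bracket ε δ Y).apply f =
      X.apply (Y.apply f) - sgn (ε * δ) • Y.apply (X.apply f) := by
  have h1 : ∀ {ε δ : ZMod 2} {X Y : VF U}, X.HasParity ε → Y.HasParity δ → X.apply (Y.apply f) =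
      ∑ A, X.apply (Y A) * pd U A f +
        ∑ A, ∑ B, sgn (ε * (δ + p A)) • (Y A * (X B * pd U B (pd U A f))) := by
    intro ε δ X Y hX hY
    rw [apply.eq_def Y f, apply_sum, ← Finset.sum_add_distrib]
    refine Finset.sum_congr rfl fun A _ => ?_
    rw [apply_mul_of_hasParity hX (hY A), apply.eq_def X (pd U A f), Finset.mul_sum,
      Finset.smul_sum]
  rw [h1 hX hY, h1 hY hX, Finset.sum_comm (γ := ι) (α := ι) (f := fun A B =>
    sgn (δ * (ε + p A)) • (X A * (Y B * pd U B (pd U A f)))), smul_add, add_sub_add_comm]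
  -- The second-order parts cancel, by supercommutativity of the coefficients and of the partial
  -- derivatives. The signs are compared through their exponents modulo two.
  have h2 : (∑ A, ∑ B, sgn (ε * (δ + p A)) • (Y A * (X B * pd U B (pd U A f)))) -
      sgn (ε * δ) • ∑ A, ∑ B, sgn (δ * (ε + p B)) • (X B * (Y A * pd U A (pd U B f))) = 0 := by
    rw [sub_eq_zero, Finset.smul_sum]
    refine Finset.sum_congr rfl fun A _ => ?_
    rw [Finset.smul_sum]
    refine Finset.sum_congr rfl fun B _ => ?_
    rw [← mul_assoc, ← mul_assoc, (hX B).mul_comm (hY A), pd_pd A B, smul_mul_assoc,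
      mul_smul_comm, smul_smul, smul_smul, smul_smul, ← sgn_add, ← sgn_add, ← sgn_add]
    congr 2
    have h4 : (2 : ZMod 2) = 0 := rfl
    linear_combination (-(ε * δ) - (δ * p B) - (p A * p B) : ZMod 2) * h4
  rw [h2, add_zero, Finset.smul_sum, ← Finset.sum_sub_distrib]
  refine Finset.sum_congr rfl fun A _ => ?_
  rw [bracket, sub_mul, smul_mul_assoc]

theorem bracket_eq_apply {ε δ : ZMod 2} (X Y : VF U) (A : ι) :
    X.bracket ε δ Y A = X.apply (Y A) - sgn (ε * δ) • Y.apply (X A) := rfl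

theorem bracket_skew (ε δ : ZMod 2) (X Y : VF U) :
    X.bracket ε δ Y = -(sgn (ε * δ) • Y.bracket δ ε X) := by
  funext A
  rw [Pi.neg_apply, Pi.smul_apply, bracket_eq_apply, bracket_eq_apply, smul_sub, smul_smul,
    mul_comm δ ε, sgn_mul_self, one_smul, neg_sub]

/-- The Jacobi identity. -/
theorem bracket_jacobi {a b c : ZMod 2} {X Y Z : VF U} (hX : X.HasParity a) (hY : Y.HasParity b)
    (hZ : Z.HasParity c) : X.bracket a (b + c) (Y.bracket b c Z) =
      (X.bracket a b Y).bracket (a + b) c Z +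
        sgn (a * b) • Y.bracket b (a + c) (X.bracket a c Z) := by
  funext A
  rw [Pi.add_apply, Pi.smul_apply]
  simp only [bracket_eq_apply (X.bracket a b Y), bracket_eq_apply X (Y.bracket b c Z),
    bracket_eq_apply Y (X.bracket a c Z), bracket_apply hX hY, bracket_apply hX hZ,
    bracket_apply hY hZ, bracket_eq_apply, apply_sub, apply_smul, smul_sub, smul_smul, mul_add,
    add_mul, sgn_add, mul_comm b a]
  -- Once the brackets are expanded, the only fact needed about the three signs is that the square
  -- of this one is `1`.
  generalize hab : sgn (a * b) = s
  have hs : s * s = 1 := by rw [← hab, sgn_mul_self]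
  generalize sgn (a * c) = t
  generalize sgn (b * c) = u
  rcases mul_self_eq_one_iff.1 hs with rfl | rfl <;> module

theorem bracket_add_left (ε δ : ZMod 2) (X X' Y : VF U) :
    (X + X').bracket ε δ Y = X.bracket ε δ Y + X'.bracket ε δ Y := by
  funext A
  simp only [bracket, Pi.add_apply, add_apply, apply_add, smul_add]
  abel

theorem bracket_add_right (ε δ : ZMod 2) (X Y Y' : VF U) :
    X.bracket ε δ (Y + Y') = X.bracket ε δ Y + X.bracket ε δ Y' := by
  funext A
  simp only [bracket, Pi.add_apply, add_apply, apply_add, smul_add]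
  abel

theorem bracket_smul_left (ε δ : ZMod 2) (r : ℝ) (X Y : VF U) :
    (r • X).bracket ε δ Y = r • X.bracket ε δ Y := by
  funext A
  simp only [bracket, Pi.smul_apply, smul_apply, apply_smul, smul_sub, smul_comm r]

theorem bracket_smul_right (ε δ : ZMod 2) (r : ℝ) (X Y : VF U) :
    X.bracket ε δ (r • Y) = r • X.bracket ε δ Y := by
  funext A
  simp only [bracket, Pi.smul_apply, smul_apply, apply_smul, smul_sub, smul_comm r]

theorem restr_apply (h : W ≤ U) (X : VF U) (f : SF U) :
    (X.restr h).apply (res h f) = res h (X.apply f) := by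
  simp only [apply, restr, pd_res, map_sum, map_mul]

theorem HasParity.restr {ε : ZMod 2} {X : VF U} (hX : X.HasParity ε) (h : W ≤ U) :
    (X.restr h).HasParity ε := fun A => (hX A).res h

theorem bracket_restr (h : W ≤ U) (ε δ : ZMod 2) (X Y : VF U) :
    (X.bracket ε δ Y).restr h = (X.restr h).bracket ε δ (Y.restr h) := by
  funext A
  simp only [bracket, restr_apply, restr.eq_def, map_sub, map_smul]

/-- Relatedness is a condition on coordinates; the chain rule extends it to all functions. -/
theorem Related.apply_pull {φ : Mor U V} {X : VF U} {Y : VF V} (h : Related φ X Y) (f : SF V) :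
    X.apply (φ.pull f) = φ.pull (Y.apply f) := by
  simp only [apply, Mor.pd_pull, map_sum, Mor.pull_mul, Finset.mul_sum]
  rw [Finset.sum_comm]
  refine Finset.sum_congr rfl fun B _ => ?_
  rw [← h B, apply, Finset.sum_mul]
  simp only [mul_assoc]

theorem Related.bracket {φ : Mor U V} {X X' : VF U} {Y Y' : VF V} {ε δ : ZMod 2}
    (hX : X.HasParity ε) (hX' : X'.HasParity δ) (h : Related φ X Y) (h' : Related φ X' Y') :
    Related φ (X.bracket ε δ X') (Y.bracket ε δ Y') := fun B => by
  rw [bracket_apply hX hX', ← φ.pull_coord, h'.apply_pull, h.apply_pull, h.apply_pull,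
    h'.apply_pull, bracket_eq_apply, map_sub, map_smul]
  simp only [apply_coord]

theorem Related.smul {φ : Mor U V} {X : VF U} {Y : VF V} (h : Related φ X Y) (r : ℝ) :
    Related φ (r • X) (r • Y) := fun B => by
  rw [smul_apply, h B, Pi.smul_apply, map_smul]

end VF

end VectorFields

/-! ### Differentials, prolongations and vertical lifts. -/

section Tangent

variable {ι ι' κ : Type*} {p : ι → ZMod 2} {p' : ι' → ZMod 2} [Fintype ι] [Fintype ι'] [Fintype κ]
  [DecidableEq ι] [DecidableEq ι'] [DecidableEq κ] {U W : Opens (Ev p → ℝ)}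
  {V : Opens (Ev p' → ℝ)} {r : κ → ZMod 2}

theorem pr_comp (B : ι) : (pr U r).comp B = coord (cyl U r) (Sum.inl B) := rfl

theorem pd_inl_pr_pull (A : ι) (f : SF U) :
    pd (cyl U r) (Sum.inl A) ((pr U r).pull f) = (pr U r).pull (pd U A f) := by
  rw [Mor.pd_pull, Finset.sum_eq_single A]
  · rw [pr_comp, pd_coord, if_pos rfl, one_mul]
  · intro B _ hB
    rw [pr_comp, pd_coord, if_neg (fun e => hB (Sum.inl.inj e).symm), zero_mul]
  · simp

theorem pd_inr_pr_pull (k : κ) (f : SF U) :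
    pd (cyl U r) (Sum.inr k) ((pr U r).pull f) = 0 := by
  rw [Mor.pd_pull]
  refine Finset.sum_eq_zero fun B _ => ?_
  rw [pr_comp, pd_coord, if_neg (by simp), zero_mul]

theorem pr_pull_res (h : W ≤ U) (f : SF U) :
    (pr W r).pull (res h f) = res (cyl_mono h r) ((pr U r).pull f) := by
  rw [← incl_pull, ← incl_pull]
  refine Mor.pull_square (fun C => ?_) f
  change (pr W r).pull (coord W C) = (incl _).pull (coord _ _)
  rw [Mor.pull_coord, Mor.pull_coord]
  rfl

theorem pr_pull_coord (A : ι) : (pr U r).pull (coord U A) = coord (cyl U r) (Sum.inl A) :=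
  Mor.pull_coord _ _

theorem diff_eq (f : SF U) :
    diff f = ∑ A, coord (tan U) (Sum.inr A) * (pr U p).pull (pd U A f) := rfl

theorem diff_add (f g : SF U) : diff (f + g) = diff f + diff g := by
  simp only [diff_eq, map_add, mul_add, Finset.sum_add_distrib]

theorem diff_smul (c : ℝ) (f : SF U) : diff (c • f) = c • diff f := by
  simp only [diff_eq, map_smul, mul_smul_comm, Finset.smul_sum]

/-- The even differential as a linear map. -/
def diffₗ (U : Opens (Ev p → ℝ)) : SF U →ₗ[ℝ] SF (tan U) where
  toFun := diff
  map_add' := diff_add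
  map_smul' := diff_smul

theorem diff_zero : diff (0 : SF U) = 0 := map_zero (diffₗ U)

theorem diff_sub (f g : SF U) : diff (f - g) = diff f - diff g := map_sub (diffₗ U) f g

theorem diff_sum {J : Type*} (s : Finset J) (f : J → SF U) :
    diff (∑ j ∈ s, f j) = ∑ j ∈ s, diff (f j) := map_sum (diffₗ U) f s

theorem diff_one : diff (1 : SF U) = 0 := by
  simp [diff_eq, pd_one]

theorem twist_pull (φ : Mor U V) (ε : ZMod 2) (f : SF V) :
    twist U ε (φ.pull f) = φ.pull (twist V ε f) := by
  rcases zmod_two_cases ε with rfl | rfl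
  · simp
  · simp [Mor.invol_pull]

/-- The differential of a coordinate has the parity of that coordinate, so moving it past a factor
undoes the twist of the partial derivative: `diff` is an even derivation and no sign appears. -/
theorem diff_mul (f g : SF U) :
    diff (f * g) = diff f * (pr U p).pull g + (pr U p).pull f * diff g := by
  simp only [diff_eq, pd_mul, map_add, mul_add, Finset.sum_add_distrib, Finset.sum_mul,
    Finset.mul_sum, Mor.pull_mul, mul_assoc]
  congr 1
  refine Finset.sum_congr rfl fun A _ => ?_
  rw [← mul_assoc, ← mul_assoc, (hasParity_coord (U := tan U) (Sum.inr A)).mul_twist, twist_pull,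
    Sum.elim_inr, twist_twist, CharTwo.add_self_eq_zero, twist_zero]

theorem diff_coord (A : ι) : diff (coord U A) = coord (tan U) (Sum.inr A) := by
  rw [diff_eq, Finset.sum_eq_single A]
  · rw [pd_coord, if_pos rfl, Mor.pull_one, mul_one]
  · intro B _ hB
    rw [pd_coord, if_neg hB, map_zero, mul_zero]
  · simp

theorem Mor.tangent_pull_pr (φ : Mor U V) (f : SF V) :
    φ.tangent.pull ((pr V p').pull f) = (pr U p).pull (φ.pull f) :=
  Mor.pull_square (fun C => by
    rw [pr_comp, Mor.pull_coord]
    rfl) f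

/-- Naturality of the differential. -/
theorem diff_pull (φ : Mor U V) (f : SF V) : diff (φ.pull f) = φ.tangent.pull (diff f) := by
  simp only [diff_eq, map_sum, Mor.pull_mul, Mor.tangent_pull_pr, Mor.pull_coord, Mor.pd_pull,
    Finset.mul_sum]
  rw [Finset.sum_comm]
  refine Finset.sum_congr rfl fun B _ => ?_
  simp only [← mul_assoc]
  rw [← Finset.sum_mul]
  rfl

theorem diff_res (h : W ≤ U) (f : SF U) : diff (res h f) = res (cyl_mono h p) (diff f) := by
  rw [← incl_pull, diff_pull]
  refine Mor.pull_eq_res _ _ (fun A => ?_) _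
  cases A with
  | inl A => exact pr_pull_coord A
  | inr A => exact diff_coord A

theorem pd_inr_diff (A : ι) (f : SF U) :
    pd (tan U) (Sum.inr A) (diff f) = (pr U p).pull (pd U A f) := by
  rw [diff_eq, map_sum, Finset.sum_eq_single A]
  · rw [pd_mul, pd_coord, if_pos rfl, one_mul, pd_inr_pr_pull, mul_zero, add_zero]
  · intro B _ hB
    rw [pd_mul, pd_coord, if_neg (fun e => hB (Sum.inr.inj e).symm), zero_mul, pd_inr_pr_pull,
      mul_zero, add_zero]
  · simp

/-- The sign of passing a derivative over the differential of a coordinate cancels the sign of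
exchanging the two partial derivatives. -/
theorem pd_inl_diff (A : ι) (f : SF U) :
    pd (tan U) (Sum.inl A) (diff f) = diff (pd U A f) := by
  rw [diff_eq, map_sum, diff_eq]
  refine Finset.sum_congr rfl fun B _ => ?_
  rw [pd_mul_of_hasParity _ (hasParity_coord (U := tan U) (Sum.inr B)), pd_coord,
    if_neg (by simp), zero_mul, zero_add, pd_inl_pr_pull, pd_pd A B, map_smul, mul_smul_comm,
    smul_smul]
  simp

namespace VF

theorem prolong_inl (X : VF U) (A : ι) : X.prolong (Sum.inl A) = (pr U p).pull (X A) := rfl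

theorem prolong_inr (X : VF U) (A : ι) : X.prolong (Sum.inr A) = diff (X A) := rfl

theorem vlift_inl (X : VF U) (A : ι) : X.vlift (Sum.inl A) = 0 := rfl

theorem vlift_inr (X : VF U) (A : ι) : X.vlift (Sum.inr A) = (pr U p).pull (X A) := rfl

/-- This and the three formulas after it give the action of both lifts on pullbacks and
differentials, which include all coordinates of the tangent bundle. The brackets of lifts follow
from them. -/
theorem prolong_apply_pull (X : VF U) (f : SF U) :
    X.prolong.apply ((pr U p).pull f) = (pr U p).pull (X.apply f) := by
  rw [apply, Fintype.sum_sum_type]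
  simp only [pd_inl_pr_pull, pd_inr_pr_pull, mul_zero, Finset.sum_const_zero, add_zero,
    prolong_inl, apply, map_sum, Mor.pull_mul]

theorem prolong_apply_diff (X : VF U) (f : SF U) :
    X.prolong.apply (diff f) = diff (X.apply f) := by
  rw [apply, Fintype.sum_sum_type]
  simp only [pd_inl_diff, pd_inr_diff, prolong_inl, prolong_inr, apply, diff_sum, diff_mul,
    Finset.sum_add_distrib]
  rw [add_comm]

theorem vlift_apply_pull (X : VF U) (f : SF U) : X.vlift.apply ((pr U p).pull f) = 0 := by
  rw [apply, Fintype.sum_sum_type]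
  simp only [pd_inr_pr_pull, mul_zero, Finset.sum_const_zero, add_zero, vlift_inl, zero_mul]

theorem vlift_apply_diff (X : VF U) (f : SF U) :
    X.vlift.apply (diff f) = (pr U p).pull (X.apply f) := by
  rw [apply, Fintype.sum_sum_type]
  simp only [pd_inr_diff, vlift_inl, vlift_inr, zero_mul, Finset.sum_const_zero, zero_add, apply,
    map_sum, Mor.pull_mul]

theorem HasParity.prolong {ε : ZMod 2} {X : VF U} (hX : X.HasParity ε) :
    X.prolong.HasParity ε := fun A => by
  cases A with
  | inl A => exact (pr U p).hasParity_pull (hX A)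
  | inr A => exact hasParity_diff (hX A)

theorem HasParity.vlift {ε : ZMod 2} {X : VF U} (hX : X.HasParity ε) :
    X.vlift.HasParity ε := fun A => by
  cases A with
  | inl A => exact hasParity_zero _
  | inr A => exact (pr U p).hasParity_pull (hX A)

/-- The components of a prolongation are themselves pullbacks and differentials, so the commutator
is computed componentwise from the action formulas. -/
theorem prolong_bracket (ε δ : ZMod 2) (X Y : VF U) :
    X.prolong.bracket ε δ Y.prolong = (X.bracket ε δ Y).prolong := by
  funext A
  cases A with
  | inl A =>
    simp only [bracket_eq_apply, prolong_inl, prolong_apply_pull, map_sub, map_smul]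
  | inr A =>
    simp only [bracket_eq_apply, prolong_inr, prolong_apply_diff, diff_sub, diff_smul]

theorem prolong_bracket_vlift (ε δ : ZMod 2) (X Y : VF U) :
    X.prolong.bracket ε δ Y.vlift = (X.bracket ε δ Y).vlift := by
  funext A
  cases A with
  | inl A =>
    simp only [bracket_eq_apply, vlift_inl, prolong_inl, vlift_apply_pull, apply_zero, smul_zero,
      sub_zero]
  | inr A =>
    simp only [bracket_eq_apply, vlift_inr, prolong_inr, prolong_apply_pull, vlift_apply_diff,
      map_sub, map_smul]

theorem vlift_bracket_vlift (ε δ : ZMod 2) (X Y : VF U) :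
    X.vlift.bracket ε δ Y.vlift = 0 := by
  funext A
  cases A with
  | inl A =>
    simp only [bracket_eq_apply, vlift_inl, apply_zero, smul_zero, sub_zero, Pi.zero_apply]
  | inr A =>
    simp only [bracket_eq_apply, vlift_inr, vlift_apply_pull, smul_zero, sub_zero, Pi.zero_apply]

theorem prolong_restr (h : W ≤ U) (X : VF U) :
    X.prolong.restr (cyl_mono h p) = (X.restr h).prolong := by
  funext A
  cases A with
  | inl A => exact (pr_pull_res h (X A)).symm
  | inr A => exact (diff_res h (X A)).symm

theorem prolong_add (X Y : VF U) : (X + Y).prolong = X.prolong + Y.prolong := by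
  funext A
  cases A with
  | inl A => exact map_add (pr U p).pull _ _
  | inr A => exact diff_add _ _

theorem vlift_add (X Y : VF U) : (X + Y).vlift = X.vlift + Y.vlift := by
  funext A
  cases A with
  | inl A => exact (add_zero _).symm
  | inr A => exact map_add (pr U p).pull _ _

theorem prolong_smul (c : ℝ) (X : VF U) : (c • X).prolong = c • X.prolong := by
  funext A
  cases A with
  | inl A => exact map_smul (pr U p).pull _ _
  | inr A => exact diff_smul _ _

theorem vlift_smul (c : ℝ) (X : VF U) : (c • X).vlift = c • X.vlift := by
  funext A
  cases A with
  | inl A => exact (smul_zero c).symm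
  | inr A => exact map_smul (pr U p).pull _ _

theorem Related.prolong {φ : Mor U V} {X : VF U} {Y : VF V} (h : Related φ X Y) :
    Related φ.tangent X.prolong Y.prolong := fun B => by
  cases B with
  | inl B =>
    rw [prolong_inl, Mor.tangent_pull_pr]
    exact (prolong_apply_pull _ _).trans (congrArg _ (h B))
  | inr B =>
    rw [prolong_inr, ← diff_pull]
    exact (prolong_apply_diff _ _).trans (congrArg _ (h B))

end VF

end Tangent

/-! ## Gluing -/

section Preimage

variable {ι ι' κ κ' : Type*} {p : ι → ZMod 2} {p' : ι' → ZMod 2} [Fintype ι] [Fintype ι']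
  [Fintype κ] [Fintype κ'] [DecidableEq ι] [DecidableEq ι'] [DecidableEq κ] [DecidableEq κ']
  {U W : Opens (Ev p → ℝ)} {V V' : Opens (Ev p' → ℝ)} {r : κ → ZMod 2} {r' : κ' → ZMod 2}

/-- The preimage of an open set under the underlying map of a morphism. -/
def Mor.preimage (φ : Mor U V) (V' : Opens (Ev p' → ℝ)) : Opens (Ev p → ℝ) where
  carrier := {x | ∃ h : x ∈ U, φ.point ⟨x, h⟩ ∈ V'}
  is_open' := by
    have hc : ContinuousOn (fun x (b : Ev p') => extendZero (body U (φ.comp b)).1 x)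
        (U : Set (Ev p → ℝ)) :=
      continuousOn_pi.2 fun b => (body U (φ.comp b)).2.continuousOn
    convert hc.isOpen_inter_preimage U.isOpen (t := (V' : Set (Ev p' → ℝ))) V'.isOpen using 1
    ext x
    have : ∀ h : x ∈ U, (fun b : Ev p' => extendZero (body U (φ.comp b)).1 x) =
      φ.point ⟨x, h⟩ := fun h => funext fun b => extendZero_apply _ (⟨x, h⟩ : U)
    constructor
    · rintro ⟨h, h'⟩
      exact ⟨h, by rw [Set.mem_preimage, this h]; exact h'⟩
    · rintro ⟨h, h'⟩
      exact ⟨h, by rw [Set.mem_preimage, this h] at h'; exact h'⟩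

theorem Mor.preimage_le (φ : Mor U V) : φ.preimage V' ≤ U := fun _ hx => hx.1

theorem Mor.preimage_maps (φ : Mor U V) (x : φ.preimage V') :
    φ.point ⟨x, φ.preimage_le x.2⟩ ∈ V' := x.2.2

/-- A morphism of cylinders which covers a morphism of the bases. -/
def Mor.Covers (Φ : Mor (cyl U r) (cyl V r')) (φ : Mor U V) : Prop :=
  ∀ B, Φ.comp (Sum.inl B) = (pr U r).pull (φ.comp B)

theorem Mor.Covers.pull_pr {Φ : Mor (cyl U r) (cyl V r')} {φ : Mor U V} (h : Φ.Covers φ)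
    (f : SF V) : Φ.pull ((pr V r').pull f) = (pr U r).pull (φ.pull f) :=
  Mor.pull_square (fun C => by rw [pr_comp, Mor.pull_coord, h C]) f

theorem Mor.Covers.point {Φ : Mor (cyl U r) (cyl V r')} {φ : Mor U V} (h : Φ.Covers φ)
    (y : cyl U r) : (fun b : Ev p' => Φ.point y ⟨Sum.inl b.1, b.2⟩) =
      φ.point ⟨fun a => y.1 ⟨Sum.inl a.1, a.2⟩, y.2⟩ := by
  funext b
  change (body (cyl U r) (Φ.comp (Sum.inl b.1))).1 y = _
  rw [h, body_pr_pull]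
  rfl

theorem Mor.Covers.point_mem {Φ : Mor (cyl U r) (cyl V r')} {φ : Mor U V} (h : Φ.Covers φ)
    (y : cyl U r) : Φ.point y ∈ cyl V' r' ↔
      φ.point ⟨fun a => y.1 ⟨Sum.inl a.1, a.2⟩, y.2⟩ ∈ V' := by
  rw [← h.point]
  rfl

theorem Mor.Covers.restr {Φ : Mor (cyl U r) (cyl V r')} {φ : Mor U V} (h : Φ.Covers φ)
    (hW : W ≤ U) (hV : ∀ x : W, φ.point ⟨x, hW x.2⟩ ∈ V')
    (hV' : ∀ x : cyl W r, Φ.point ⟨x, cyl_mono hW r x.2⟩ ∈ cyl V' r') :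
    (Φ.restr (cyl_mono hW r) hV').Covers (φ.restr hW hV) := fun B => by
  rw [Mor.restr_comp, h, Mor.restr_comp, pr_pull_res]

theorem Mor.Covers.maps {Φ : Mor (cyl U r) (cyl V r')} {φ : Mor U V} (h : Φ.Covers φ)
    (hW : W ≤ U) (hV : ∀ x : W, φ.point ⟨x, hW x.2⟩ ∈ V') (x : cyl W r) :
    Φ.point ⟨x, cyl_mono hW r x.2⟩ ∈ cyl V' r' :=
  (h.point_mem _).2 (hV ⟨_, x.2⟩)

theorem Mor.tangent_covers (φ : Mor U V) : φ.tangent.Covers φ := fun _ => rfl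

theorem Mor.linear_covers (φ : Mor U V) (T : κ → κ → SF U)
    (hT : ∀ i j, HasParity (r i + r j) (T i j)) : (φ.linear r T hT).Covers φ := fun _ => rfl

theorem Mor.tangent_restr (φ : Mor U V) (hW : W ≤ U)
    (hV : ∀ x : W, φ.point ⟨x, hW x.2⟩ ∈ V')
    (hV' : ∀ x : tan W, φ.tangent.point ⟨x, cyl_mono hW p x.2⟩ ∈ tan V') :
    φ.tangent.restr (cyl_mono hW p) hV' = (φ.restr hW hV).tangent := by
  refine Mor.ext fun B => ?_
  cases B with
  | inl B => exact (pr_pull_res hW _).symm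
  | inr B => exact (diff_res hW _).symm

end Preimage

/-! ### Cocycle conditions for tangent maps, linear morphisms and tangent matrices. -/

section Cocycle

variable {ι κ : Type*} {p : ι → ZMod 2} {r : κ → ZMod 2} [Fintype ι] [Fintype κ]
  [DecidableEq ι] [DecidableEq κ] {U U' V V' V₁ V₂ W : Opens (Ev p → ℝ)}

/-- Cocycle conditions are required over every admissible open set. With this lemma they are checked
once, over the preimage of the full triple overlap of the base, and then restricted. -/
theorem Mor.restr_pull_eq_of_le {φ : Mor U V} {f : SF V₁} {g : SF U'} {W₂ : Opens (Ev p → ℝ)}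
    (h₂ : W₂ ≤ W) (h : W ≤ U) (h' : W ≤ U') (hW : ∀ x : W, φ.point ⟨x, h x.2⟩ ∈ V₁)
    (H : (φ.restr h hW).pull f = res h' g) (k : W₂ ≤ U) (k' : W₂ ≤ U')
    (kW : ∀ x : W₂, φ.point ⟨x, k x.2⟩ ∈ V₁) : (φ.restr k kW).pull f = res k' g := by
  rw [← Mor.restr_restr_pull φ h h₂ hW, H, res_res]

/-- Tangent maps satisfy the cocycle condition. -/
theorem Mor.tangent_cocycle {φ : Mor U V} {ψ : Mor V₁ V₂} {χ : Mor U' V'} (h : W ≤ U) (h' : W ≤ U')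
    (hW : ∀ x : W, φ.point ⟨x, h x.2⟩ ∈ V₁)
    (H : ∀ C, (φ.restr h hW).pull (ψ.comp C) = res h' (χ.comp C))
    {W₂ : Opens (Ev (Sum.elim p p) → ℝ)} (h₂ : W₂ ≤ tan W) (k : W₂ ≤ tan U) (k' : W₂ ≤ tan U')
    (kW : ∀ x : W₂, φ.tangent.point ⟨x, k x.2⟩ ∈ tan V₁) (C : ι ⊕ ι) :
    (φ.tangent.restr k kW).pull (ψ.tangent.comp C) = res k' (χ.tangent.comp C) := by
  refine Mor.restr_pull_eq_of_le h₂ (cyl_mono h p) (cyl_mono h' p)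
    (φ.tangent_covers.maps h hW) ?_ k k' kW
  rw [Mor.tangent_restr _ _ hW]
  cases C with
  | inl C => exact (Mor.tangent_pull_pr _ _).trans ((congrArg _ (H C)).trans (pr_pull_res _ _))
  | inr C => exact (diff_pull _ _).symm.trans ((congrArg _ (H C)).trans (diff_res _ _))

theorem Mor.linear_inr (φ : Mor U V) (T : κ → κ → SF U)
    (hT : ∀ i j, HasParity (r i + r j) (T i j)) (k : κ) : (φ.linear r T hT).comp (Sum.inr k) =
      ∑ i, coord (cyl U r) (Sum.inr i) * (pr U r).pull (T i k) := rfl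

/-- The morphisms of total spaces given by matrices with the cocycle condition satisfy the cocycle
condition. -/
theorem Mor.linear_cocycle {φ : Mor U V} {ψ : Mor V₁ V₂} {χ : Mor U' V'} (h : W ≤ U) (h' : W ≤ U')
    (hW : ∀ x : W, φ.point ⟨x, h x.2⟩ ∈ V₁)
    (H : ∀ C, (φ.restr h hW).pull (ψ.comp C) = res h' (χ.comp C))
    {R : κ → κ → SF U} {S : κ → κ → SF V₁} {T : κ → κ → SF U'}
    (hR : ∀ i j, HasParity (r i + r j) (R i j)) (hS : ∀ i j, HasParity (r i + r j) (S i j))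
    (hT : ∀ i j, HasParity (r i + r j) (T i j))
    (HT : ∀ i k, ∑ j, res h (R i j) * (φ.restr h hW).pull (S j k) = res h' (T i k))
    {W₂ : Opens (Ev (Sum.elim p r) → ℝ)} (h₂ : W₂ ≤ cyl W r) (k : W₂ ≤ cyl U r)
    (k' : W₂ ≤ cyl U' r) (kW : ∀ x : W₂, (φ.linear r R hR).point ⟨x, k x.2⟩ ∈ cyl V₁ r)
    (C : ι ⊕ κ) : ((φ.linear r R hR).restr k kW).pull ((ψ.linear r S hS).comp C) =
      res k' ((χ.linear r T hT).comp C) := by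
  have hc := φ.linear_covers R hR
  have hc' := hc.restr h hW (hc.maps h hW)
  refine Mor.restr_pull_eq_of_le h₂ (cyl_mono h r) (cyl_mono h' r) (hc.maps h hW) ?_ k k' kW
  cases C with
  | inl C => exact (hc'.pull_pr _).trans ((congrArg _ (H C)).trans (pr_pull_res _ _))
  | inr k =>
    rw [Mor.linear_inr, Mor.linear_inr, map_sum, map_sum]
    have h1 : ∀ j, ((φ.linear r R hR).restr (cyl_mono h r) (hc.maps h hW)).pull
        (coord (cyl V₁ r) (Sum.inr j) * (pr _ r).pull (S j k)) =
        ∑ i, coord (cyl W r) (Sum.inr i) * (pr _ r).pull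
          (res h (R i j) * (φ.restr h hW).pull (S j k)) := by
      intro j
      rw [Mor.pull_mul, hc'.pull_pr, Mor.pull_coord, Mor.restr_comp, Mor.linear_inr, map_sum,
        Finset.sum_mul]
      refine Finset.sum_congr rfl fun i _ => ?_
      rw [map_mul, res_coord, ← pr_pull_res, Mor.pull_mul, mul_assoc]
    rw [Finset.sum_congr rfl fun j _ => h1 j, Finset.sum_comm]
    refine Finset.sum_congr rfl fun i _ => ?_
    rw [← Finset.mul_sum, ← map_sum, HT, map_mul, res_coord, ← pr_pull_res]

/-- The matrix of the tangent prolongation of a morphism of vector bundles. -/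
def tangentMatrix (T : κ → κ → SF U) : κ ⊕ κ → κ ⊕ κ → SF (tan U) :=
  Sum.elim
    (fun i => Sum.elim (fun j => (pr U p).pull (T i j)) (fun j => diff (T i j)))
    (fun i => Sum.elim (fun _ => 0) (fun j => (pr U p).pull (T i j)))

theorem tangentMatrix_inl_inl (T : κ → κ → SF U) (i j : κ) :
    tangentMatrix T (Sum.inl i) (Sum.inl j) = (pr _ p).pull (T i j) := rfl

theorem tangentMatrix_inl_inr (T : κ → κ → SF U) (i j : κ) :
    tangentMatrix T (Sum.inl i) (Sum.inr j) = diff (T i j) := rfl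

theorem tangentMatrix_inr_inl (T : κ → κ → SF U) (i j : κ) :
    tangentMatrix T (Sum.inr i) (Sum.inl j) = 0 := rfl

theorem tangentMatrix_inr_inr (T : κ → κ → SF U) (i j : κ) :
    tangentMatrix T (Sum.inr i) (Sum.inr j) = (pr _ p).pull (T i j) := rfl

theorem tangentMatrix_one {T : κ → κ → SF U} (hT : ∀ i j, T i j = if i = j then 1 else 0)
    (i j : κ ⊕ κ) : tangentMatrix T i j = if i = j then 1 else 0 := by
  rcases i with i | i <;> rcases j with j | j
  · rw [tangentMatrix_inl_inl, hT]
    by_cases h : i = j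
    · rw [if_pos h, if_pos (congrArg _ h), Mor.pull_one]
    · rw [if_neg h, if_neg (fun e => h (Sum.inl.inj e)), map_zero]
  · rw [tangentMatrix_inl_inr, hT, if_neg (show Sum.inl i ≠ Sum.inr j by simp)]
    split_ifs
    · exact diff_one
    · exact diff_zero
  · rw [tangentMatrix_inr_inl, if_neg (by simp)]
  · rw [tangentMatrix_inr_inr, hT]
    by_cases h : i = j
    · rw [if_pos h, if_pos (congrArg _ h), Mor.pull_one]
    · rw [if_neg h, if_neg (fun e => h (Sum.inr.inj e)), map_zero]

/-- The tangent prolongations of matrices satisfy the cocycle condition. -/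
theorem tangentMatrix_cocycle {φ : Mor U V} (h : W ≤ U) (h' : W ≤ U')
    (hW : ∀ x : W, φ.point ⟨x, h x.2⟩ ∈ V₁)
    {R : κ → κ → SF U} {S : κ → κ → SF V₁} {T : κ → κ → SF U'}
    (HT : ∀ i k, ∑ j, res h (R i j) * (φ.restr h hW).pull (S j k) = res h' (T i k))
    {W₂ : Opens (Ev (Sum.elim p p) → ℝ)} (h₂ : W₂ ≤ tan W) (k : W₂ ≤ tan U)
    (k' : W₂ ≤ tan U') (kW : ∀ x : W₂, φ.tangent.point ⟨x, k x.2⟩ ∈ tan V₁) (i l : κ ⊕ κ) :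
    ∑ j, res k (tangentMatrix R i j) * (φ.tangent.restr k kW).pull (tangentMatrix S j l) =
      res k' (tangentMatrix T i l) := by
  have hpull : ∀ f : SF (tan V₁), (φ.tangent.restr k kW).pull f =
      res h₂ ((φ.restr h hW).tangent.pull f) := by
    intro f
    rw [← Mor.tangent_restr _ _ _ (φ.tangent_covers.maps h hW),
      Mor.restr_restr_pull φ.tangent _ h₂ _ kW]
  have hres : ∀ f : SF (tan U), res k f = res h₂ (res (cyl_mono h p) f) := fun f =>
    (res_res _ _ _).symm
  have hres' : ∀ f : SF (tan U'), res k' f = res h₂ (res (cyl_mono h' p) f) := fun f =>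
    (res_res _ _ _).symm
  have H : ∑ j, res (cyl_mono h p) (tangentMatrix R i j) *
      (φ.restr h hW).tangent.pull (tangentMatrix S j l) =
      res (cyl_mono h' p) (tangentMatrix T i l) := by
    rw [Fintype.sum_sum_type]
    rcases i with i | i <;> rcases l with l | l
    · simp only [tangentMatrix_inl_inl, tangentMatrix_inr_inl, map_zero, mul_zero,
        Finset.sum_const_zero, add_zero, ← pr_pull_res h, ← pr_pull_res h', Mor.tangent_pull_pr, ← Mor.pull_mul,
        ← map_sum]
      exact congrArg _ (HT i l)
    -- The block with new content: the differential of the cocycle identity on the base, expanded by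
    -- the Leibniz rule. The diagonal blocks are pullbacks of that identity.
    · simp only [tangentMatrix_inl_inl, tangentMatrix_inl_inr, tangentMatrix_inr_inr,
        ← pr_pull_res h, ← diff_res h, ← diff_res h', Mor.tangent_pull_pr, ← diff_pull]
      rw [← HT i l, diff_sum, ← Finset.sum_add_distrib]
      refine Finset.sum_congr rfl fun j _ => ?_
      rw [diff_mul, add_comm]
    · simp only [tangentMatrix_inr_inl, map_zero, mul_zero, zero_mul, Finset.sum_const_zero,
        add_zero]
    · simp only [tangentMatrix_inr_inl, tangentMatrix_inr_inr, map_zero, zero_mul,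
        Finset.sum_const_zero, zero_add, ← pr_pull_res h, ← pr_pull_res h', Mor.tangent_pull_pr, ← Mor.pull_mul,
        ← map_sum]
      exact congrArg _ (HT i l)
  rw [hres', ← H, map_sum]
  refine Finset.sum_congr rfl fun j _ => ?_
  rw [map_mul, hpull, hres]

end Cocycle

/-! ### Tangent bundles, total spaces and tangent prolongations satisfy the gluing axioms. -/

section Atlas

variable {ι κ : Type*} {p : ι → ZMod 2} {q : κ → ZMod 2} [Fintype ι] [Fintype κ]
  [DecidableEq ι] [DecidableEq κ]

namespace Atlas

/-- The part of the chart `α` which is mapped to the intersection of the charts `β` and `γ`. -/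
def triple (N : Atlas.{u} p) (α β γ : N.Chart) : Opens (Ev p → ℝ) :=
  (N.tr α β).preimage (N.ov β γ)

theorem triple_le (N : Atlas.{u} p) (α β γ : N.Chart) : N.triple α β γ ≤ N.ov α β :=
  Mor.preimage_le _

theorem triple_maps (N : Atlas.{u} p) (α β γ : N.Chart) (x : N.triple α β γ) :
    (N.tr α β).point ⟨x, N.triple_le α β γ x.2⟩ ∈ N.ov β γ :=
  Mor.preimage_maps _ x

theorem IsSupermanifold.triple_le' {N : Atlas.{u} p} (hN : N.IsSupermanifold) (α β γ : N.Chart) :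
    N.triple α β γ ≤ N.ov α γ :=
  fun x hx => hN.ov_trans α β γ ⟨x, hx.1⟩ hx.2

theorem IsSupermanifold.tr_triple {N : Atlas.{u} p} (hN : N.IsSupermanifold) (α β γ : N.Chart)
    (C : ι) : ((N.tr α β).restr (N.triple_le α β γ) (N.triple_maps α β γ)).pull
      ((N.tr β γ).comp C) = res (hN.triple_le' α β γ) ((N.tr α γ).comp C) :=
  hN.tr_trans α β γ _ _ _ _ C

/-- The tangent bundle of a supermanifold is a supermanifold. -/
theorem IsSupermanifold.tangent {N : Atlas.{u} p} (hN : N.IsSupermanifold) :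
    N.tangent.IsSupermanifold where
  ov_self α := congrArg tan (hN.ov_self α)
  tr_self α A := by
    cases A with
    | inl A => exact (congrArg _ (hN.tr_self α A)).trans (pr_pull_coord A)
    | inr A => exact (congrArg _ (hN.tr_self α A)).trans (diff_coord A)
  ov_trans α β γ x hx :=
    hN.ov_trans α β γ ⟨_, x.2⟩ ((Mor.tangent_covers (N.tr α β)).point_mem x |>.1 hx)
  tr_trans := fun (α β γ : N.Chart) _ h h' hW C =>
    Mor.tangent_cocycle (N.triple_le α β γ) (hN.triple_le' α β γ) (N.triple_maps α β γ)
      (hN.tr_triple α β γ) (fun x hx =>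
        ⟨h hx, ((Mor.tangent_covers (N.tr α β)).point_mem ⟨x, h hx⟩).1 (hW ⟨x, hx⟩)⟩) h h' hW C

end Atlas

namespace Bundle

theorem total_covers (E : Bundle.{u} p q) (α β : E.base.Chart) :
    (E.total.tr α β).Covers (E.base.tr α β) := fun _ => rfl

theorem IsVectorBundle.trans_triple {E : Bundle.{u} p q} (hE : E.IsVectorBundle)
    (α β γ : E.base.Chart) (i k : κ) :
    ∑ j, res (E.base.triple_le α β γ) (E.trans α β i j) *
      ((E.base.tr α β).restr (E.base.triple_le α β γ) (E.base.triple_maps α β γ)).pull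
        (E.trans β γ j k) =
      res (hE.base_isSupermanifold.triple_le' α β γ) (E.trans α γ i k) :=
  hE.trans_trans α β γ _ _ _ _ i k

/-- The total space of a vector bundle is a supermanifold. -/
theorem IsVectorBundle.total {E : Bundle.{u} p q} (hE : E.IsVectorBundle) :
    E.total.IsSupermanifold where
  ov_self α := congrArg (cyl · q) (hE.base_isSupermanifold.ov_self α)
  tr_self := fun (α : E.base.Chart) A => by
    cases A with
    | inl A =>
      exact (congrArg _ (hE.base_isSupermanifold.tr_self α A)).trans (pr_pull_coord A)
    | inr k =>
      change ((E.base.tr α α).linear q _ (E.trans_parity α α)).comp (Sum.inr k) =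
        coord (cyl (E.base.ov α α) q) (Sum.inr k)
      rw [Mor.linear_inr, Finset.sum_eq_single k]
      · rw [hE.trans_self, if_pos rfl, Mor.pull_one, mul_one]
      · intro i _ hi
        rw [hE.trans_self, if_neg hi, map_zero, mul_zero]
      · simp
  ov_trans α β γ x hx :=
    hE.base_isSupermanifold.ov_trans α β γ ⟨_, x.2⟩ (((E.total_covers α β).point_mem x).1 hx)
  tr_trans := fun (α β γ : E.base.Chart) _ h h' hW C =>
    Mor.linear_cocycle (E.base.triple_le α β γ) (hE.base_isSupermanifold.triple_le' α β γ)
      (E.base.triple_maps α β γ) (hE.base_isSupermanifold.tr_triple α β γ)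
      (E.trans_parity α β) (E.trans_parity β γ) (E.trans_parity α γ)
      (hE.trans_triple α β γ) (fun x hx =>
        ⟨h hx, ((E.total_covers α β).point_mem ⟨x, h hx⟩).1 (hW ⟨x, hx⟩)⟩) h h' hW C

theorem IsVectorBundle.parityRev {E : Bundle.{u} p q} (hE : E.IsVectorBundle) :
    E.parityRev.IsVectorBundle where
  base_isSupermanifold := hE.base_isSupermanifold
  trans_self := hE.trans_self
  trans_trans := hE.trans_trans

/-- The tangent prolongation of a vector bundle is a vector bundle. -/
theorem IsVectorBundle.tangent {E : Bundle.{u} p q} (hE : E.IsVectorBundle) :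
    E.tangent.IsVectorBundle where
  base_isSupermanifold := hE.base_isSupermanifold.tangent
  trans_self := fun (α : E.base.Chart) i j => tangentMatrix_one (hE.trans_self α) i j
  trans_trans := fun (α β γ : E.base.Chart) _ h h' hW i k =>
    tangentMatrix_cocycle (E.base.triple_le α β γ) (hE.base_isSupermanifold.triple_le' α β γ)
      (E.base.triple_maps α β γ) (hE.trans_triple α β γ) (fun x hx => ⟨h hx,
        ((Mor.tangent_covers (E.base.tr α β)).point_mem ⟨x, h hx⟩).1 (hW ⟨x, hx⟩)⟩) h h' hW i k

end Bundle

/-! ### Regrouping of coordinates -/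

section Regroup

variable {U W : Opens (Ev p → ℝ)} {r : κ → ZMod 2} {s : κ ⊕ κ → ZMod 2}
  (hs : ∀ k, s k = Sum.elim r r k)

theorem regroup_comp (B : (ι ⊕ ι) ⊕ (κ ⊕ κ)) : (regroup U r s hs).comp B =
    coord (tan (cyl U r)) (Equiv.sumSumSumComm ι ι κ κ B) := rfl

theorem regroupInv_comp (B : (ι ⊕ κ) ⊕ (ι ⊕ κ)) : (regroupInv U r s hs).comp B =
    coord (cyl (tan U) s) (Equiv.sumSumSumComm ι κ ι κ B) := rfl

theorem regroup_pull_regroupInv_comp (B : (ι ⊕ κ) ⊕ (ι ⊕ κ)) :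
    (regroup U r s hs).pull ((regroupInv U r s hs).comp B) = coord (tan (cyl U r)) B := by
  rw [regroupInv_comp, Mor.pull_coord, regroup_comp]
  rcases B with (a | k) | (a | k) <;> rfl

theorem regroupInv_pull_regroup_comp (B : (ι ⊕ ι) ⊕ (κ ⊕ κ)) :
    (regroupInv U r s hs).pull ((regroup U r s hs).comp B) = coord (cyl (tan U) s) B := by
  rw [regroup_comp, Mor.pull_coord, regroupInv_comp]
  rcases B with (a | k) | (a | k) <;> rfl

theorem regroup_pull_regroupInv_pull (f : SF (tan (cyl U r))) :
    (regroup U r s hs).pull ((regroupInv U r s hs).pull f) = f := by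
  rw [← Mor.pull_trans, Mor.pull_eq_res _ le_rfl (regroup_pull_regroupInv_comp hs), res_rfl]

theorem regroupInv_pull_regroup_pull (f : SF (cyl (tan U) s)) :
    (regroupInv U r s hs).pull ((regroup U r s hs).pull f) = f := by
  rw [← Mor.pull_trans, Mor.pull_eq_res _ le_rfl (regroupInv_pull_regroup_comp hs), res_rfl]

theorem regroup_pull_injective : Function.Injective (regroup U r s hs).pull :=
  Function.LeftInverse.injective (regroupInv_pull_regroup_pull hs)

theorem regroup_pull_pr_pr (f : SF U) :
    (regroup U r s hs).pull ((pr (tan U) s).pull ((pr U p).pull f)) =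
      (pr (cyl U r) (Sum.elim p r)).pull ((pr U r).pull f) := by
  rw [← Mor.pull_trans (regroup U r s hs), Mor.pull_square (φ' := pr (cyl U r) (Sum.elim p r))
    (ψ' := pr U r)]
  intro C
  rw [Mor.pull_trans, pr_comp, pr_pull_coord, Mor.pull_coord, pr_comp, pr_pull_coord]
  rfl

theorem regroup_pull_pr_diff (f : SF U) :
    (regroup U r s hs).pull ((pr (tan U) s).pull (diff f)) = diff ((pr U r).pull f) := by
  rw [diff_pull, ← Mor.pull_trans]
  congr 2
  refine Mor.ext fun C => ?_
  change (regroup U r s hs).pull ((pr (tan U) s).comp C) = _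
  rw [pr_comp, Mor.pull_coord]
  cases C with
  | inl A => exact (pr_pull_coord _).symm
  | inr A => exact (diff_coord _).symm

theorem regroup_point_mem (x : tan (cyl U r)) (V : Opens (Ev p → ℝ)) :
    (regroup U r s hs).point x ∈ cyl (tan V) s ↔ x.1 ∈ tan (cyl V r) := by
  have : (fun a : Ev p => (regroup U r s hs).point x ⟨Sum.inl (Sum.inl a.1), a.2⟩) =
      fun a : Ev p => x.1 ⟨Sum.inl (Sum.inl a.1), a.2⟩ := by
    funext a
    exact congrFun (congrArg Subtype.val (body_coord (tan (cyl U r))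
      (⟨Sum.inl (Sum.inl a.1), a.2⟩ : Ev (Sum.elim (Sum.elim p r) (Sum.elim p r))))) x
  change (fun a : Ev p => (regroup U r s hs).point x ⟨Sum.inl (Sum.inl a.1), a.2⟩) ∈ V ↔ _
  rw [this]
  rfl

theorem regroup_restr (h : W ≤ U)
    (hV : ∀ x : tan (cyl W r), (regroup U r s hs).point
      ⟨x, cyl_mono (cyl_mono h r) (Sum.elim p r) x.2⟩ ∈ cyl (tan W) s) :
    (regroup U r s hs).restr (cyl_mono (cyl_mono h r) (Sum.elim p r)) hV = regroup W r s hs :=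
  Mor.ext fun _ => res_coord _ _

/-- The tangent map of `u^j = u^i T_i^j` is computed by the Leibniz rule, and the result is the
linear morphism with matrix `tangentMatrix T`. The parities `s` agree with the doubled ones only
pointwise, so that the same statement covers `E` and `ΠE`. -/
theorem regroup_pull_linear {V : Opens (Ev p → ℝ)} (φ : Mor U V) (T : κ → κ → SF U)
    (hT : ∀ i j, HasParity (r i + r j) (T i j))
    (hT' : ∀ i j, HasParity (s i + s j) (tangentMatrix T i j)) (B : (ι ⊕ ι) ⊕ (κ ⊕ κ)) :
    (regroup U r s hs).pull ((φ.tangent.linear s (tangentMatrix T) hT').comp B) =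
      (φ.linear r T hT).tangent.comp (Equiv.sumSumSumComm ι ι κ κ B) := by
  rcases B with (A | A) | (k | k)
  · exact regroup_pull_pr_pr hs _
  · exact regroup_pull_pr_diff hs _
  · change _ = (pr _ _).pull ((φ.linear r T hT).comp (Sum.inr k))
    rw [Mor.linear_inr, Mor.linear_inr, map_sum, map_sum, Fintype.sum_sum_type]
    simp only [Mor.pull_mul, tangentMatrix_inl_inl, tangentMatrix_inr_inl, map_zero,
      mul_zero, Finset.sum_const_zero, add_zero, regroup_pull_pr_pr, Mor.pull_coord]
    rfl
  · change _ = diff ((φ.linear r T hT).comp (Sum.inr k))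
    rw [Mor.linear_inr, Mor.linear_inr, diff_sum, map_sum, Fintype.sum_sum_type,
      ← Finset.sum_add_distrib]
    simp only [Mor.pull_mul, tangentMatrix_inl_inr, tangentMatrix_inr_inr, diff_mul,
      regroup_pull_pr_pr, regroup_pull_pr_diff, diff_coord, Mor.pull_coord]
    exact Finset.sum_congr rfl fun i _ => add_comm _ _

/-- `T(E)` with regrouped coordinates is the total space of `TE → TM`. -/
theorem Bundle.isDiffeo_regroup (E : Bundle.{u} p r) (s : κ ⊕ κ → ZMod 2)
    (hs : ∀ k, s k = Sum.elim r r k)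
    (hpar : ∀ α β i j, HasParity (s i + s j) (E.tangent.trans α β i j)) :
    E.total.tangent.IsDiffeo (Bundle.mk E.base.tangent E.tangent.trans hpar).total (Equiv.refl _)
      (fun α => regroup (E.base.dom α) r s hs) (fun α => regroupInv (E.base.dom α) r s hs) where
  left_inv _ := regroup_pull_regroupInv_comp hs
  right_inv _ := regroupInv_pull_regroup_comp hs
  ov_iff _ _ x := regroup_point_mem hs x _
  comm := fun (α β : E.base.Chart) h _ B =>
    ((Mor.pull_coord _ _).trans (res_rfl _)).trans
      ((regroup_pull_linear hs (E.base.tr α β) (E.trans α β) (E.trans_parity α β)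
        (hpar α β) B).symm.trans (congrArg (fun φ : Mor (tan (cyl (E.base.ov α β) r))
          (cyl (tan (E.base.ov α β)) s) => φ.pull _)
          (regroup_restr hs (E.base.ov_le α β) h).symm))

end Regroup

end Atlas

/-! ## Tangent prolongation of homological fields -/

section Homological

variable {ι κ : Type*} {p : ι → ZMod 2} {q r : κ → ZMod 2} [Fintype ι] [Fintype κ]
  [DecidableEq ι] [DecidableEq κ]

/-- The tangent prolongation of a homological vector field is homological. -/
theorem Atlas.IsHomological.prolong {N : Atlas.{u} p} {Q : N.VField} (hQ : N.IsHomological Q) :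
    N.tangent.IsHomological Q.prolong where
  isVField := fun (α β : N.Chart) => by
    have h := (hQ.isVField α β).prolong
    rw [← VF.prolong_restr, ← VF.prolong_restr] at h
    exact h
  odd := fun (α : N.Chart) => (hQ.odd α).prolong
  sq := fun (α : N.Chart) => by
    have h := VF.prolong_bracket 1 1 (Q α) (Q α)
    rw [hQ.sq α] at h
    refine h.trans (funext fun A => ?_)
    cases A with
    | inl A => exact map_zero _
    | inr A => exact diff_zero

/-! ### Vector fields in regrouped coordinates. -/

section Regroup

variable {U V W : Opens (Ev p → ℝ)} {s : κ ⊕ κ → ZMod 2} (hs : ∀ k, s k = Sum.elim r r k)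

/-- A vector field on `T(U × fibre)` in regrouped coordinates. -/
def VF.regroup (X : VF (tan (cyl U r))) : VF (cyl (tan U) s) :=
  fun B => (regroupInv U r s hs).pull (X (Equiv.sumSumSumComm ι ι κ κ B))

theorem VF.related_regroup (X : VF (tan (cyl U r))) :
    VF.Related (SuperGeom.regroup U r s hs) X (X.regroup hs) := fun B => by
  rw [regroup_comp, VF.apply_coord, VF.regroup, regroup_pull_regroupInv_pull]

/-- Pullback by the regrouping is injective, so a related field is unique. Identities such as the
one for brackets are transferred by this uniqueness. -/
theorem VF.Related.eq_regroup {X : VF (tan (cyl U r))} {Y : VF (cyl (tan U) s)}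
    (h : VF.Related (SuperGeom.regroup U r s hs) X Y) : Y = X.regroup hs :=
  funext fun B => regroup_pull_injective hs ((h B).symm.trans (X.related_regroup hs B))

theorem VF.HasParity.regroup {ε : ZMod 2} {X : VF (tan (cyl U r))} (hX : X.HasParity ε) :
    (X.regroup hs).HasParity ε := fun B =>
  (Mor.hasParity_pull _ (hX _)).congr (congrArg (ε + ·) (sumComm_parity p r s hs B))

theorem VF.regroup_bracket {ε δ : ZMod 2} {X Y : VF (tan (cyl U r))} (hX : X.HasParity ε)
    (hY : Y.HasParity δ) :
    (X.regroup hs).bracket ε δ (Y.regroup hs) = (X.bracket ε δ Y).regroup hs :=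
  ((X.related_regroup hs).bracket hX hY (Y.related_regroup hs)).eq_regroup

theorem VF.regroup_smul (c : ℝ) (X : VF (tan (cyl U r))) :
    (c • X).regroup hs = c • X.regroup hs :=
  funext fun _ => map_smul (regroupInv U r s hs).pull _ _

theorem VF.regroup_restr (h : W ≤ U) (X : VF (tan (cyl U r))) :
    (X.regroup hs).restr (cyl_mono (cyl_mono h p) s) =
      VF.regroup hs (X.restr (cyl_mono (cyl_mono h r) (Sum.elim p r))) := by
  funext B
  change res _ ((regroupInv U r s hs).pull _) = (regroupInv W r s hs).pull (res _ _)
  rw [← incl_pull (cyl_mono (cyl_mono h p) s),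
    ← incl_pull (cyl_mono (cyl_mono h r) (Sum.elim p r))]
  have key : ∀ C, (incl (cyl_mono (cyl_mono h p) s)).pull ((regroupInv U r s hs).comp C) =
      (regroupInv W r s hs).pull
        ((incl (cyl_mono (cyl_mono h r) (Sum.elim p r))).comp C) := fun C => by
    rw [regroupInv_comp, incl_pull (cyl_mono (cyl_mono h p) s), res_coord]
    exact (Mor.pull_coord (regroupInv W r s hs) _).symm
  exact Mor.pull_square key _

theorem VF.Related.regroup {φ : Mor U V} {T : κ → κ → SF U}
    {hT : ∀ i j, SuperGeom.HasParity (r i + r j) (T i j)}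
    (hT' : ∀ i j, SuperGeom.HasParity (s i + s j) (tangentMatrix T i j))
    {X : VF (tan (cyl U r))} {Y : VF (tan (cyl V r))}
    (h : VF.Related (φ.linear r T hT).tangent X Y) :
    VF.Related (φ.tangent.linear s (tangentMatrix T) hT') (X.regroup hs) (Y.regroup hs) := by
  intro B
  apply regroup_pull_injective hs
  have hsq : ∀ f, (SuperGeom.regroup U r s hs).pull
      ((φ.tangent.linear s (tangentMatrix T) hT').pull f) =
      (φ.linear r T hT).tangent.pull ((SuperGeom.regroup V r s hs).pull f) := fun f =>
    Mor.pull_square (fun C => by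
      rw [regroup_pull_linear hs φ T hT hT' C, regroup_comp, Mor.pull_coord]) f
  rw [← (X.related_regroup hs).apply_pull, regroup_pull_linear hs φ T hT hT' B, h, hsq,
    ← (Y.related_regroup hs) B, regroup_comp, VF.apply_coord]

/-- The Euler field of a trivial bundle. -/
def eulerVF (U : Opens (Ev p → ℝ)) (r : κ → ZMod 2) : VF (cyl U r) :=
  Sum.elim (fun _ => 0) (fun k => coord _ (Sum.inr k))

theorem hasParity_eulerVF : (eulerVF U r).HasParity 0 := fun A => by
  cases A with
  | inl A => exact hasParity_zero _
  | inr k => exact (hasParity_coord (U := cyl U r) (Sum.inr k)).congr (zero_add _).symm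

/-- The coefficients `u^k` of the Euler field prolong to `u^k` and `du^k`, the linear coordinates of
the doubled fibre. This is why prolongation preserves weights. -/
theorem eulerVF_tangent : eulerVF (tan U) s = (eulerVF U r).prolong.regroup hs := by
  funext B
  apply regroup_pull_injective hs
  rw [← VF.related_regroup hs, regroup_comp, VF.apply_coord]
  rcases B with (A | A) | (k | k)
  · exact (map_zero _).trans (map_zero (pr (cyl U r) _).pull).symm
  · exact (map_zero _).trans diff_zero.symm
  · exact (Mor.pull_coord _ _).trans (pr_pull_coord _).symm
  · exact (Mor.pull_coord _ _).trans (diff_coord _).symm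

theorem VF.regroup_prolong_sq {X : VF (cyl U r)} (hX : X.HasParity 1) (h : X.bracket 1 1 X = 0) :
    (X.prolong.regroup hs).bracket 1 1 (X.prolong.regroup hs) = 0 := by
  rw [VF.regroup_bracket hs hX.prolong hX.prolong, VF.prolong_bracket, h]
  funext B
  have h0 : ∀ A, (0 : VF (cyl U r)).prolong A = 0 := fun A => by
    cases A with
    | inl A => exact map_zero _
    | inr A => exact diff_zero
  rw [VF.regroup, h0, map_zero]
  rfl

theorem VF.eulerVF_bracket_regroup_prolong {X : VF (cyl U r)} (hX : X.HasParity 1) {c : ℝ}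
    (h : (eulerVF U r).bracket 0 1 X = c • X) :
    (eulerVF (tan U) s).bracket 0 1 (X.prolong.regroup hs) = c • X.prolong.regroup hs := by
  rw [eulerVF_tangent hs, VF.regroup_bracket hs hasParity_eulerVF.prolong hX.prolong,
    VF.prolong_bracket, h, VF.prolong_smul, VF.regroup_smul]

end Regroup

theorem Bundle.regroupVF_homological {E : Bundle.{u} p q} {Q : E.parityRev.total.VField}
    (hQ : E.parityRev.total.IsHomological Q) :
    E.tangent.parityRev.total.IsHomological (E.regroupVF Q.prolong) where
  isVField := fun (α β : E.base.Chart) => by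
    have h := hQ.prolong.isVField α β
    have h2 := VF.Related.regroup (T := E.trans α β) (hT := E.parityRev.trans_parity α β)
      (parityRev_elim q) (E.tangent.parityRev.trans_parity α β) h
    have e1 := VF.regroup_restr (parityRev_elim q) (E.base.ov_le α β) (Q.prolong α)
    have e2 := VF.regroup_restr (parityRev_elim q) (E.base.ov_le β α) (Q.prolong β)
    exact (congrArg₂ (VF.Related _) e1 e2).mpr h2
  odd := fun (α : E.base.Chart) => (hQ.prolong.odd α).regroup (parityRev_elim q)
  sq := fun (α : E.base.Chart) => VF.regroup_prolong_sq (parityRev_elim q) (hQ.odd α) (hQ.sq α)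

theorem Bundle.regroupVF_hasWeight {E : Bundle.{u} p q} {Q : E.parityRev.total.VField}
    (hQ : E.parityRev.total.IsHomological Q) (hQ1 : E.parityRev.HasWeight 1 1 Q) :
    E.tangent.parityRev.HasWeight 1 1 (E.regroupVF Q.prolong) := fun (α : E.base.Chart) =>
  VF.eulerVF_bracket_regroup_prolong (parityRev_elim q) (hQ.odd α) (hQ1 α)

end Homological

/-! ## The Lie algebroid given by a homological field -/

section ZeroSection

variable {ι κ : Type*} {p : ι → ZMod 2} {r : κ → ZMod 2} [Fintype ι] [Fintype κ]
  [DecidableEq ι] [DecidableEq κ] {V : Opens (Ev p → ℝ)}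

/-- The zero section of a trivial bundle. -/
def zeroSec (V : Opens (Ev p → ℝ)) (r : κ → ZMod 2) : Mor V (cyl V r) where
  comp := Sum.elim (fun A => coord V A) (fun _ => 0)
  parity B := by
    cases B with
    | inl A => exact hasParity_coord A
    | inr k => exact hasParity_zero _
  maps x := by
    convert x.2 using 1
    change (fun a : Ev p => (body V (coord V a.1)).1 x) ∈ V ↔ _
    simp only [body_coord]
    rfl

theorem zeroSec_pull_pr (f : SF V) : (zeroSec V r).pull ((pr V r).pull f) = f := by
  rw [← Mor.pull_trans, Mor.pull_eq_res _ le_rfl (fun A => ?_), res_rfl]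
  exact (Mor.pull_coord _ _)

theorem pr_pull_injective : Function.Injective (pr V r).pull :=
  Function.LeftInverse.injective zeroSec_pull_pr

/-- The function on the total space of a bundle is the pullback of a function on the base. -/
def IsBasic (f : SF (cyl V r)) : Prop := f ∈ LinearMap.range (pr V r).pull

theorem IsBasic.pull_zeroSec {f : SF (cyl V r)} (hf : IsBasic f) :
    (pr V r).pull ((zeroSec V r).pull f) = f := by
  obtain ⟨g, rfl⟩ := hf
  rw [zeroSec_pull_pr]

theorem isBasic_pull (g : SF V) : IsBasic ((pr V r).pull g) := ⟨g, rfl⟩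

theorem isBasic_zero : IsBasic (0 : SF (cyl V r)) := Submodule.zero_mem _

theorem IsBasic.sub {f g : SF (cyl V r)} (hf : IsBasic f) (hg : IsBasic g) : IsBasic (f - g) :=
  Submodule.sub_mem _ hf hg

theorem IsBasic.smul {f : SF (cyl V r)} (hf : IsBasic f) (c : ℝ) : IsBasic (c • f) :=
  Submodule.smul_mem _ c hf

theorem isBasic_sum {J : Type*} {s : Finset J} {f : J → SF (cyl V r)}
    (h : ∀ j ∈ s, IsBasic (f j)) : IsBasic (∑ j ∈ s, f j) :=
  Submodule.sum_mem _ h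

theorem IsBasic.mul {f g : SF (cyl V r)} (hf : IsBasic f) (hg : IsBasic g) : IsBasic (f * g) := by
  obtain ⟨f, rfl⟩ := hf
  obtain ⟨g, rfl⟩ := hg
  exact ⟨f * g, Mor.pull_mul _ f g⟩

theorem IsBasic.twist {f : SF (cyl V r)} (hf : IsBasic f) (ε : ZMod 2) :
    IsBasic (twist _ ε f) := by
  obtain ⟨f, rfl⟩ := hf
  exact ⟨SuperGeom.twist _ ε f, (twist_pull _ _ _).symm⟩

theorem IsBasic.pd_inr {f : SF (cyl V r)} (hf : IsBasic f) (k : κ) :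
    pd (cyl V r) (Sum.inr k) f = 0 := by
  obtain ⟨f, rfl⟩ := hf
  exact pd_inr_pr_pull k f

theorem hasParity_of_pull {ε : ZMod 2} {f : SF V} (h : HasParity ε ((pr V r).pull f)) :
    HasParity ε f := by
  apply pr_pull_injective (r := r)
  unfold HasParity at h
  rw [← Mor.invol_pull, h, map_smul]

theorem VF.apply_pr_pull (X : VF (cyl V r)) (f : SF V) :
    X.apply ((pr V r).pull f) = ∑ A, X (Sum.inl A) * (pr V r).pull (pd V A f) := by
  rw [VF.apply, Fintype.sum_sum_type]
  simp only [pd_inl_pr_pull, pd_inr_pr_pull, mul_zero, Finset.sum_const_zero, add_zero]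

end ZeroSection

/-! ### Sections as vertical fields, and the derived bracket. -/

section Sections

variable {ι κ : Type*} {p : ι → ZMod 2} {q : κ → ZMod 2} [Fintype ι] [Fintype κ]
  [DecidableEq ι] [DecidableEq κ] {V : Opens (Ev p → ℝ)}

/-- The parity count for `[Q, i(s)]`: `Q` is odd and `i` shifts parity by one. -/
theorem one_add_add_one (a : ZMod 2) : 1 + (a + 1) = a := by
  revert a; decide

namespace Sec

/-- The component of parity `ε` of a section. -/
def part (q : κ → ZMod 2) (V : Opens (Ev p → ℝ)) (ε : ZMod 2) : Sec κ V →ₗ[ℝ] Sec κ V :=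
  LinearMap.pi fun k => SuperGeom.part (ε + q k) ∘ₗ LinearMap.proj k

theorem part_apply (ε : ZMod 2) (s : Sec κ V) (k : κ) :
    part q V ε s k = SuperGeom.part (ε + q k) (s k) := rfl

theorem hasParity_part (ε : ZMod 2) (s : Sec κ V) : Sec.HasParity q ε (part q V ε s) :=
  fun _ => SuperGeom.hasParity_part _ _

theorem part_add_part (s : Sec κ V) : part q V 0 s + part q V 1 s = s := by
  funext k
  rw [Pi.add_apply, part_apply, part_apply]
  rcases zmod_two_cases (q k) with h | h
  · rw [h]
    exact SuperGeom.part_add_part _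
  · rw [h, add_comm]
    exact SuperGeom.part_add_part _

theorem HasParity.part_eq {ε : ZMod 2} {s : Sec κ V} (hs : s.HasParity q ε) (δ : ZMod 2) :
    part q V δ s = if ε = δ then s else 0 := by
  funext k
  rw [part_apply, (hs k).part_eq]
  by_cases h : ε = δ
  · rw [if_pos h, if_pos (congrArg (· + q k) h)]
  · rw [if_neg h, if_neg fun e => h (add_right_cancel e)]
    rfl

/-- A property of sections which is additive holds if it holds for homogeneous sections. -/
theorem homogeneous_induction (q : κ → ZMod 2) {C : Sec κ V → Prop}
    (add : ∀ s t, C s → C t → C (s + t)) (hom : ∀ ε s, Sec.HasParity q ε s → C s)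
    (s : Sec κ V) : C s := by
  rw [← part_add_part (q := q) s]
  exact add _ _ (hom _ _ (hasParity_part 0 s)) (hom _ _ (hasParity_part 1 s))

theorem HasParity.mul {ε δ : ZMod 2} {f : SF V} {s : Sec κ V} (hf : SuperGeom.HasParity ε f)
    (hs : s.HasParity q δ) : (f • s).HasParity q (ε + δ) := fun k =>
  (hf.mul (hs k)).congr (add_assoc _ _ _).symm

theorem toVF_inl (ε : ZMod 2) (s : Sec κ V) (A : ι) : s.toVF q ε (Sum.inl A) = 0 := rfl

theorem toVF_inr (ε : ZMod 2) (s : Sec κ V) (k : κ) :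
    s.toVF q ε (Sum.inr k) = sgn ε • (pr V (fun k => q k + 1)).pull (s k) := rfl

theorem toVF_add (ε : ZMod 2) (s t : Sec κ V) :
    (s + t).toVF q ε = s.toVF q ε + t.toVF q ε := by
  funext B
  cases B with
  | inl A => exact (add_zero _).symm
  | inr k => rw [Pi.add_apply, toVF_inr, toVF_inr, toVF_inr, Pi.add_apply, map_add, smul_add]

theorem toVF_smul (ε : ZMod 2) (c : ℝ) (s : Sec κ V) :
    (c • s).toVF q ε = c • s.toVF q ε := by
  funext B
  cases B with
  | inl A => exact (smul_zero c).symm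
  | inr k => rw [Pi.smul_apply, toVF_inr, toVF_inr, Pi.smul_apply, map_smul, smul_comm]

theorem toVF_mul (ε δ : ZMod 2) (f : SF V) (s : Sec κ V) :
    (f • s).toVF q (δ + ε) = (sgn δ • (pr V (fun k => q k + 1)).pull f) • s.toVF q ε := by
  funext B
  cases B with
  | inl A => exact (mul_zero _).symm
  | inr k =>
    rw [Pi.smul_apply, toVF_inr, toVF_inr, Pi.smul_apply, smul_eq_mul, smul_eq_mul, Mor.pull_mul,
      sgn_add, smul_mul_smul_comm]

theorem toVF_injective (ε : ZMod 2) : Function.Injective (Sec.toVF (V := V) q ε) := by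
  intro s t h
  funext k
  have h2 := congrArg (sgn ε • ·) (congrFun h (Sum.inr k))
  simp only [toVF_inr, smul_smul, sgn_mul_self, one_smul] at h2
  exact pr_pull_injective h2

theorem HasParity.toVF {ε : ZMod 2} {s : Sec κ V} (hs : s.HasParity q ε) :
    (s.toVF q ε).HasParity (ε + 1) := fun B => by
  cases B with
  | inl A => exact hasParity_zero _
  | inr k =>
    refine HasParity.smul ((Mor.hasParity_pull _ (hs k)).congr ?_) _
    change ε + q k = ε + 1 + (q k + 1)
    rw [add_assoc, add_comm (q k), ← add_assoc 1, CharTwo.add_self_eq_zero, zero_add]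

theorem hasParity_of_toVF {ε : ZMod 2} {s : Sec κ V} (hs : (s.toVF q ε).HasParity (ε + 1)) :
    s.HasParity q ε := fun k => by
  have h := HasParity.smul (hs (Sum.inr k)) (sgn ε)
  rw [toVF_inr, smul_smul, sgn_mul_self, one_smul] at h
  refine (hasParity_of_pull h).congr ?_
  change ε + 1 + (q k + 1) = ε + q k
  rw [add_assoc, add_comm (q k), ← add_assoc 1, CharTwo.add_self_eq_zero, zero_add]

theorem toVF_apply (ε : ZMod 2) (s : Sec κ V) (f : SF (cyl V (fun k => q k + 1))) :
    (s.toVF q ε).apply f =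
      ∑ k, sgn ε • ((pr V (fun k => q k + 1)).pull (s k) * pd _ (Sum.inr k) f) := by
  rw [VF.apply, Fintype.sum_sum_type]
  simp only [toVF_inl, toVF_inr, zero_mul, Finset.sum_const_zero, zero_add, smul_mul_assoc]

theorem toVF_apply_basic (ε : ZMod 2) (s : Sec κ V) {f : SF (cyl V (fun k => q k + 1))}
    (hf : IsBasic f) : (s.toVF q ε).apply f = 0 := by
  rw [toVF_apply]
  exact Finset.sum_eq_zero fun k _ => by rw [hf.pd_inr, mul_zero, smul_zero]

theorem toVF_apply_isBasic (ε : ZMod 2) (s : Sec κ V) {f : SF (cyl V (fun k => q k + 1))}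
    (hf : ∀ k, IsBasic (pd _ (Sum.inr k) f)) : IsBasic ((s.toVF q ε).apply f) := by
  rw [toVF_apply]
  exact isBasic_sum fun k _ => ((isBasic_pull _).mul (hf k)).smul _

/-- A vector field with vanishing base components and basic fibre components corresponds to a
section. -/
theorem exists_toVF (ε : ZMod 2) (X : VF (cyl V (fun k => q k + 1)))
    (h0 : ∀ A, X (Sum.inl A) = 0) (h1 : ∀ k, IsBasic (X (Sum.inr k))) :
    Sec.toVF q ε (fun k => sgn ε • (zeroSec V _).pull (X (Sum.inr k))) = X := by
  funext B
  cases B with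
  | inl A => exact (h0 A).symm
  | inr k =>
    rw [toVF_inr, map_smul, (h1 k).pull_zeroSec, smul_smul, sgn_mul_self, one_smul]

/-- Both fields are vertical with coefficients constant along the fibres. Skew-symmetry of the
derived bracket rests on this. -/
theorem toVF_bracket_toVF (ε δ ε' δ' : ZMod 2) (s t : Sec κ V) :
    (s.toVF q ε).bracket ε' δ' (t.toVF q δ) = 0 := by
  funext B
  rw [VF.bracket_eq_apply]
  cases B with
  | inl A => simp [toVF_inl]
  | inr k =>
    rw [toVF_inr, toVF_inr, toVF_apply_basic _ _ ((isBasic_pull _).smul _),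
      toVF_apply_basic _ _ ((isBasic_pull _).smul _), smul_zero, sub_zero]
    rfl

end Sec

theorem VF.bracket_mul_right {ι : Type*} {p : ι → ZMod 2} [Fintype ι] [DecidableEq ι]
    {U : Opens (Ev p → ℝ)} {ε φ δ : ZMod 2} {X Y : VF U} (hX : X.HasParity ε)
    {f : SF U} (hf : SuperGeom.HasParity φ f) :
    X.bracket ε (φ + δ) (f • Y) =
      X.apply f • Y + sgn (ε * φ) • f • X.bracket ε δ Y := by
  funext A
  simp only [VF.bracket_eq_apply, Pi.add_apply, Pi.smul_apply, smul_eq_mul, VF.mul_apply,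
    VF.apply_mul_of_hasParity hX hf, mul_sub, smul_sub, mul_smul_comm, smul_smul, mul_add, sgn_add]
  abel

/-- Components of the field are linear and quadratic in the fibre coordinates up to basic
functions: its fibre derivatives of first, respectively second order are basic. -/
structure VF.IsQuadratic (Q : VF (cyl V (fun k => q k + 1))) : Prop where
  basic_inl : ∀ k A, IsBasic (pd _ (Sum.inr k) (Q (Sum.inl A)))
  basic_inr : ∀ j k l, IsBasic (pd _ (Sum.inr j) (pd _ (Sum.inr k) (Q (Sum.inr l))))

/-- An odd field with square zero and quadratic components on a trivial bundle. -/
structure VF.IsDerived (Q : VF (cyl V (fun k => q k + 1))) : Prop extends Q.IsQuadratic where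
  odd : Q.HasParity 1
  sq : Q.bracket 1 1 Q = 0

/-- The field `[Q, i(s)]`. -/
def Sec.derived (q : κ → ZMod 2) (Q : VF (cyl V (fun k => q k + 1))) (ε : ZMod 2) (s : Sec κ V) :
    VF (cyl V (fun k => q k + 1)) :=
  Q.bracket 1 (ε + 1) (s.toVF q ε)

/-- The anchor given by a field `Q`. -/
def anchorOf (Q : VF (cyl V (fun k => q k + 1))) : Sec κ V →ₗ[SF V] VF V where
  toFun s A := ∑ k, s k * (zeroSec V _).pull (pd _ (Sum.inr k) (Q (Sum.inl A)))
  map_add' s t := by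
    funext A
    simp only [Pi.add_apply, add_mul, Finset.sum_add_distrib]
  map_smul' f s := by
    funext A
    simp only [Pi.smul_apply, smul_eq_mul, mul_assoc, Finset.mul_sum, RingHom.id_apply]

theorem anchorOf_apply (Q : VF (cyl V (fun k => q k + 1))) (s : Sec κ V) (A : ι) :
    anchorOf Q s A = ∑ k, s k * (zeroSec V _).pull (pd _ (Sum.inr k) (Q (Sum.inl A))) := rfl

/-- The derived bracket on sections of given parities. -/
def derivedBracket (Q : VF (cyl V (fun k => q k + 1))) (ε δ : ZMod 2) :
    Sec κ V →ₗ[ℝ] Sec κ V →ₗ[ℝ] Sec κ V :=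
  LinearMap.mk₂ ℝ (fun s t k => sgn (ε + δ) • (zeroSec V _).pull
      ((sgn ε • (s.derived q Q ε).bracket ε (δ + 1) (t.toVF q δ)) (Sum.inr k)))
    (fun s s' t => by
      funext k
      simp only [Sec.derived, Sec.toVF_add, VF.bracket_add_right, VF.bracket_add_left, smul_add,
        Pi.add_apply, map_add])
    (fun c s t => by
      funext k
      simp only [Sec.derived, Sec.toVF_smul, VF.bracket_smul_right, VF.bracket_smul_left,
        Pi.smul_apply, map_smul, smul_comm c])
    (fun s t t' => by
      funext k
      simp only [Sec.derived, Sec.toVF_add, VF.bracket_add_right, smul_add,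
        Pi.add_apply, map_add])
    (fun c s t => by
      funext k
      simp only [Sec.derived, Sec.toVF_smul, VF.bracket_smul_right,
        Pi.smul_apply, map_smul, smul_comm c])

/-- The bracket of sections given by a field `Q`. -/
def bracketOf (Q : VF (cyl V (fun k => q k + 1))) : Sec κ V →ₗ[ℝ] Sec κ V →ₗ[ℝ] Sec κ V :=
  -- The signs of the derived bracket depend on parities, so the formula is applied to homogeneous
  -- components and the results are added.
  ∑ ε : ZMod 2, ∑ δ : ZMod 2,
    (derivedBracket Q ε δ).compl₁₂ (Sec.part q V ε) (Sec.part q V δ)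

theorem bracketOf_eq (Q : VF (cyl V (fun k => q k + 1))) {ε δ : ZMod 2} {s t : Sec κ V}
    (hs : s.HasParity q ε) (ht : t.HasParity q δ) :
    bracketOf Q s t = derivedBracket Q ε δ s t := by
  simp only [bracketOf, LinearMap.sum_apply, LinearMap.compl₁₂_apply, hs.part_eq, ht.part_eq]
  rw [Finset.sum_eq_single ε, Finset.sum_eq_single δ]
  · rw [if_pos rfl, if_pos rfl]
  · intro δ' _ h
    rw [if_neg h.symm, map_zero]
  · simp
  · intro ε' _ h
    refine Finset.sum_eq_zero fun δ' _ => ?_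
    rw [if_neg h.symm, map_zero, LinearMap.zero_apply]
  · simp

section Derived

variable {Q : VF (cyl V (fun k => q k + 1))} {ε δ γ : ZMod 2} {s t w : Sec κ V}

theorem Sec.HasParity.derived (hQ : Q.HasParity 1) (hs : s.HasParity q ε) :
    (s.derived q Q ε).HasParity ε :=
  (hQ.bracket hs.toVF).congr (one_add_add_one ε)

/-- As `i(s)` is vertical, only the term in which it differentiates the base component of `Q`
survives. The sign of the commutator cancels the sign built into `i`. -/
theorem derived_inl (hQ : Q.IsDerived) (ε : ZMod 2) (s : Sec κ V) (A : ι) :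
    s.derived q Q ε (Sum.inl A) = (pr V _).pull (anchorOf Q s A) := by
  rw [Sec.derived, VF.bracket_eq_apply, Sec.toVF_inl, VF.apply_zero, zero_sub, Sec.toVF_apply,
    ← Finset.smul_sum, smul_smul, ← neg_smul, one_mul, sgn_add, sgn_one]
  rw [show -(sgn ε * -1 * sgn ε) = 1 by rw [mul_neg_one, neg_mul, neg_neg, sgn_mul_self], one_smul,
    anchorOf_apply, map_sum]
  refine Finset.sum_congr rfl fun k _ => ?_
  rw [Mor.pull_mul, (hQ.basic_inl k A).pull_zeroSec]

theorem derived_apply_pull (hQ : Q.IsDerived) (ε : ZMod 2) (s : Sec κ V) (f : SF V) :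
    (s.derived q Q ε).apply ((pr V _).pull f) = (pr V _).pull ((anchorOf Q s).apply f) := by
  rw [VF.apply_pr_pull, VF.apply, map_sum]
  refine Finset.sum_congr rfl fun A _ => ?_
  rw [derived_inl hQ, Mor.pull_mul]

theorem hasParity_anchorOf (hQ : Q.IsDerived) (hs : s.HasParity q ε) :
    (anchorOf Q s).HasParity ε := fun A => by
  have h := hs.derived hQ.odd (Sum.inl A)
  rw [derived_inl hQ] at h
  exact hasParity_of_pull h

/-- Only first fibre derivatives of base components and second fibre derivatives of fibre components
of `Q` occur, with basic coefficients. -/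
theorem isBasic_toVF_apply_derived (hQ : Q.IsDerived) (ε δ : ZMod 2) (s t : Sec κ V) (k : κ) :
    IsBasic ((t.toVF q δ).apply (s.derived q Q ε (Sum.inr k))) := by
  rw [Sec.derived, VF.bracket_eq_apply, VF.apply_sub, VF.apply_smul, Sec.toVF_inr, VF.apply_smul,
    VF.apply_smul]
  refine IsBasic.sub (IsBasic.smul (Sec.toVF_apply_isBasic _ _ fun j => ?_) _)
    (IsBasic.smul (Sec.toVF_apply_isBasic _ _ fun j => ?_) _)
  · rw [VF.apply_pr_pull, map_sum]
    refine isBasic_sum fun A _ => ?_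
    rw [pd_mul, pd_inr_pr_pull, mul_zero, add_zero]
    exact (hQ.basic_inl j A).mul (isBasic_pull _)
  · rw [Sec.toVF_apply, map_sum]
    refine isBasic_sum fun i _ => ?_
    rw [map_smul, pd_mul, pd_inr_pr_pull, zero_mul, zero_add]
    exact (((isBasic_pull _).twist _).mul (hQ.basic_inr j i k)).smul _

/-- The derived bracket formula. -/
theorem toVF_bracketOf (hQ : Q.IsDerived) (hs : s.HasParity q ε) (ht : t.HasParity q δ) :
    (bracketOf Q s t).toVF q (ε + δ) =
      sgn ε • (s.derived q Q ε).bracket ε (δ + 1) (t.toVF q δ) := by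
  rw [bracketOf_eq Q hs ht]
  refine Sec.exists_toVF (ε + δ) _ (fun A => ?_) (fun k => ?_)
  · rw [Pi.smul_apply, VF.bracket_eq_apply, Sec.toVF_inl, VF.apply_zero, derived_inl hQ,
      Sec.toVF_apply_basic _ _ (isBasic_pull _), smul_zero, sub_zero, smul_zero]
  · rw [Pi.smul_apply, VF.bracket_eq_apply, Sec.toVF_inr, VF.apply_smul, derived_apply_pull hQ]
    exact (((isBasic_pull _).smul _).sub
      ((isBasic_toVF_apply_derived hQ ε δ s t k).smul _)).smul _

theorem hasParity_bracketOf (hQ : Q.IsDerived) (hs : s.HasParity q ε) (ht : t.HasParity q δ) :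
    (bracketOf Q s t).HasParity q (ε + δ) := by
  apply Sec.hasParity_of_toVF
  rw [toVF_bracketOf hQ hs ht]
  exact (((hs.derived hQ.odd).bracket ht.toVF).smul _).congr (add_assoc _ _ _).symm

/-- Since `[i(s), i(t)] = 0`, the Jacobi identity for `Q`, `i(s)`, `i(t)` moves `Q` from one section
to the other; skew-symmetry of the commutator then exchanges the entries. -/
theorem bracketOf_skew (hQ : Q.IsDerived) (hs : s.HasParity q ε) (ht : t.HasParity q δ) :
    bracketOf Q s t = -(sgn (ε * δ) • bracketOf Q t s) := by
  apply Sec.toVF_injective (q := q) (ε + δ)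
  have hneg : ∀ u : Sec κ V, (-u).toVF q (ε + δ) = -u.toVF q (ε + δ) := fun u => by
    have := Sec.toVF_smul (q := q) (ε + δ) (-1) u
    rwa [neg_one_smul, neg_one_smul] at this
  have hts := toVF_bracketOf hQ ht hs
  rw [add_comm δ ε] at hts
  rw [hneg, Sec.toVF_smul, hts, toVF_bracketOf hQ hs ht]
  have hJ := VF.bracket_jacobi hQ.odd hs.toVF ht.toVF
  have h0 : Q.bracket 1 (ε + 1 + (δ + 1)) (0 : VF (cyl V fun k => q k + 1)) = 0 := by
    funext A
    simp [VF.bracket_eq_apply]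
  rw [Sec.toVF_bracket_toVF, h0, one_add_add_one, one_add_add_one] at hJ
  have h1 := eq_neg_of_add_eq_zero_left hJ.symm
  have h2 := VF.bracket_skew (ε + 1) δ (s.toVF q ε) (Q.bracket 1 (δ + 1) (t.toVF q δ))
  rw [h2] at h1
  change (s.derived q Q ε).bracket ε (δ + 1) (t.toVF q δ) = _ at h1
  rw [h1]
  change sgn ε • -(sgn (1 * (ε + 1)) • -(sgn ((ε + 1) * δ) •
    (t.derived q Q δ).bracket δ (ε + 1) (s.toVF q ε))) = _
  simp only [smul_smul, ← neg_smul, one_mul, add_mul, sgn_add, sgn_one]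
  congr 1
  linear_combination (-sgn (ε * δ) * sgn δ) * sgn_mul_self ε

/-- With `[Q, Q] = 0`, the Jacobi identity for `Q`, `Q`, `i(s)` makes the left side equal to its own
negative. -/
theorem bracket_derived_eq_zero (hQ : Q.IsDerived) (hs : s.HasParity q ε) :
    Q.bracket 1 ε (s.derived q Q ε) = 0 := by
  have hJ := VF.bracket_jacobi hQ.odd hQ.odd hs.toVF
  have h0 : (0 : VF (cyl V fun k => q k + 1)).bracket (1 + 1) (ε + 1) (s.toVF q ε) = 0 := by
    funext A
    simp [VF.bracket_eq_apply]
  rw [hQ.sq, h0, zero_add, one_add_add_one, mul_one, sgn_one, neg_one_smul] at hJ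
  change Q.bracket 1 ε (s.derived q Q ε) = -Q.bracket 1 ε (s.derived q Q ε) at hJ
  have h2 : (2 : ℝ) • Q.bracket 1 ε (s.derived q Q ε) = 0 := by
    rw [two_smul]
    nth_rewrite 1 [hJ]
    exact neg_add_cancel _
  exact (smul_eq_zero.1 h2).resolve_left two_ne_zero

/-- As `[Q, [Q, i(s)]] = 0`, bracketing `[[Q, i(s)], i(t)]` with `Q` acts on `i(t)` alone. So `s ↦
[Q, i(s)]` is a homomorphism, and both the Jacobi identity and the compatibility of the anchor
follow from those of vector fields. -/
theorem derived_bracketOf (hQ : Q.IsDerived) (hs : s.HasParity q ε) (ht : t.HasParity q δ) :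
    (bracketOf Q s t).derived q Q (ε + δ) =
      (s.derived q Q ε).bracket ε δ (t.derived q Q δ) := by
  have hJ := VF.bracket_jacobi hQ.odd (hs.derived hQ.odd) ht.toVF
  have h0 : (0 : VF (cyl V fun k => q k + 1)).bracket (1 + ε) (δ + 1) (t.toVF q δ) = 0 := by
    funext A
    simp [VF.bracket_eq_apply]
  rw [bracket_derived_eq_zero hQ hs, h0, zero_add, one_add_add_one, ← add_assoc] at hJ
  rw [Sec.derived, toVF_bracketOf hQ hs ht, VF.bracket_smul_right, hJ, one_mul, smul_smul,
    sgn_mul_self, one_smul]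
  rfl

theorem anchorOf_bracketOf (hQ : Q.IsDerived) (hs : s.HasParity q ε) (ht : t.HasParity q δ) :
    anchorOf Q (bracketOf Q s t) = (anchorOf Q s).bracket ε δ (anchorOf Q t) := by
  refine VF.ext_apply fun f => pr_pull_injective (r := fun k => q k + 1) ?_
  rw [← derived_apply_pull hQ (ε + δ), derived_bracketOf hQ hs ht,
    VF.bracket_apply (hs.derived hQ.odd) (ht.derived hQ.odd),
    VF.bracket_apply (hasParity_anchorOf hQ hs) (hasParity_anchorOf hQ ht)]
  simp only [derived_apply_pull hQ, map_sub, map_smul]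

theorem bracketOf_leibniz (hQ : Q.IsDerived) {φ : ZMod 2} (hs : s.HasParity q ε) {f : SF V}
    (hf : HasParity φ f) (t : Sec κ V) : bracketOf Q s (f • t) =
      (anchorOf Q s).apply f • t + sgn (ε * φ) • f • bracketOf Q s t := by
  refine Sec.homogeneous_induction q (C := fun t => bracketOf Q s (f • t) =
    (anchorOf Q s).apply f • t + sgn (ε * φ) • f • bracketOf Q s t) (fun t t' ht ht' => ?_)
    (fun δ t ht => ?_) t
  · rw [smul_add, map_add, ht, ht', map_add, smul_add, smul_add, smul_add]
    abel
  · apply Sec.toVF_injective (q := q) (ε + (φ + δ))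
    rw [toVF_bracketOf hQ hs (Sec.HasParity.mul hf ht), Sec.toVF_mul, Sec.toVF_add, Sec.toVF_smul]
    have h1 := Sec.toVF_mul (q := q) δ (ε + φ) ((anchorOf Q s).apply f) t
    rw [add_assoc] at h1
    have h2 := Sec.toVF_mul (q := q) (ε + δ) φ f (bracketOf Q s t)
    rw [add_left_comm] at h2
    rw [h1, h2, toVF_bracketOf hQ hs ht, add_assoc φ, smul_assoc, VF.bracket_smul_right,
      VF.bracket_mul_right (hs.derived hQ.odd) (Mor.hasParity_pull _ hf), derived_apply_pull hQ,
      sgn_add ε φ]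
    simp only [smul_add, smul_assoc, smul_smul]
    congr 1
    rw [smul_comm ((pr V fun k => q k + 1).pull f) (sgn ε), smul_smul]
    congr 1
    ring

theorem bracketOf_jacobi (hQ : Q.IsDerived) (hs : s.HasParity q ε) (ht : t.HasParity q δ)
    (w : Sec κ V) : bracketOf Q s (bracketOf Q t w) = bracketOf Q (bracketOf Q s t) w +
      sgn (ε * δ) • bracketOf Q t (bracketOf Q s w) := by
  refine Sec.homogeneous_induction q (C := fun w => bracketOf Q s (bracketOf Q t w) =
    bracketOf Q (bracketOf Q s t) w + sgn (ε * δ) • bracketOf Q t (bracketOf Q s w))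
    (fun w w' hw hw' => ?_) (fun γ w hw => ?_) w
  · simp only [map_add, hw, hw', smul_add]
    abel
  · apply Sec.toVF_injective (q := q) (ε + (δ + γ))
    have h1 := toVF_bracketOf hQ (hasParity_bracketOf hQ hs ht) hw
    rw [add_assoc] at h1
    have h2 := toVF_bracketOf hQ ht (hasParity_bracketOf hQ hs hw)
    rw [add_left_comm] at h2
    rw [toVF_bracketOf hQ hs (hasParity_bracketOf hQ ht hw), Sec.toVF_add, Sec.toVF_smul, h1, h2,
      derived_bracketOf hQ hs ht, toVF_bracketOf hQ ht hw, toVF_bracketOf hQ hs hw,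
      VF.bracket_smul_right, VF.bracket_smul_right, add_assoc δ, add_assoc ε γ,
      VF.bracket_jacobi (hs.derived hQ.odd) (ht.derived hQ.odd) hw.toVF, sgn_add]
    simp only [smul_add, smul_smul]
    congr 2
    ring

end Derived

end Sections

/-! ## Compatibility with changes of charts -/

section Restriction

variable {ι ι' κ : Type*} {p : ι → ZMod 2} {p' : ι' → ZMod 2} [Fintype ι] [Fintype ι'] [Fintype κ]
  [DecidableEq ι] [DecidableEq ι'] [DecidableEq κ]

/-- The target sets `V` and `V'` need not be comparable; the two pullbacks are compared through the
common larger set `D`, where they agree on coordinates. -/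
theorem Mor.res_pull_res {U W : Opens (Ev p → ℝ)} {V V' D : Opens (Ev p' → ℝ)} (φ : Mor U V)
    (hV : V ≤ D) (hV' : V' ≤ D) (h : W ≤ U) (hm : ∀ x : W, φ.point ⟨x, h x.2⟩ ∈ V') (g : SF D) :
    res h (φ.pull (res hV g)) = (φ.restr h hm).pull (res hV' g) := by
  have hm₀ : ∀ x : W, φ.point ⟨x, h x.2⟩ ∈ V := fun x => φ.maps ⟨x, h x.2⟩
  have h1 := Mor.restr_pull_res φ h hm₀ le_rfl (res hV g)
  rw [res_rfl] at h1
  have h2 : ∀ C, (φ.restr h hm₀).pull ((incl hV).comp C) =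
      (φ.restr h hm).pull ((incl hV').comp C) := fun C => by
    change (φ.restr h hm₀).pull (coord V C) =
      (φ.restr h hm).pull (coord V' C)
    rw [Mor.pull_coord, Mor.pull_coord, Mor.restr_comp, Mor.restr_comp]
  rw [← h1, ← incl_pull hV, ← incl_pull hV']
  exact Mor.pull_square h2 g

theorem VF.Related.restr {U U' W : Opens (Ev p → ℝ)} {V V' D : Opens (Ev p' → ℝ)} {φ : Mor U V}
    {X : VF U'} {Y : VF D} {hU : U ≤ U'} {hV : V ≤ D} (H : VF.Related φ (X.restr hU) (Y.restr hV))
    (h : W ≤ U) (hV' : V' ≤ D) (hm : ∀ x : W, φ.point ⟨x, h x.2⟩ ∈ V') :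
    VF.Related (φ.restr h hm) (X.restr (h.trans hU)) (Y.restr hV') := fun B => by
  have e : X.restr (h.trans hU) = (X.restr hU).restr h := funext fun A => (res_res _ _ _).symm
  rw [e, Mor.restr_comp, VF.restr_apply, H B]
  exact Mor.res_pull_res φ hV hV' h hm (Y B)

theorem VF.Related.add {U : Opens (Ev p → ℝ)} {V : Opens (Ev p' → ℝ)} {φ : Mor U V} {X X' : VF U}
    {Y Y' : VF V} (h : VF.Related φ X Y) (h' : VF.Related φ X' Y') :
    VF.Related φ (X + X') (Y + Y') := fun B => by
  rw [VF.add_apply, h B, h' B, Pi.add_apply, map_add]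

end Restriction

/-! ### Sections, anchors and brackets under changes of frames. -/

section Agreement

variable {ι κ : Type*} {p : ι → ZMod 2} {q : κ → ZMod 2} [Fintype ι] [Fintype κ]
  [DecidableEq ι] [DecidableEq κ] {V V' : Opens (Ev p → ℝ)}

/-- Sections of trivial bundles which agree under a change of frames. -/
def Sec.Agree (φ : Mor V V') (T : κ → κ → SF V) (s : Sec κ V) (s' : Sec κ V') : Prop :=
  ∀ j, φ.pull (s' j) = ∑ i, s i * T i j

/-- The morphism of total spaces given by a change of frames. -/
structure Mor.IsLinear {r : κ → ZMod 2} (Φ : Mor (cyl V r) (cyl V' r)) (φ : Mor V V')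
    (T : κ → κ → SF V) : Prop where
  covers : Φ.Covers φ
  comp_inr : ∀ j, Φ.comp (Sum.inr j) =
    ∑ i, coord (cyl V r) (Sum.inr i) * (pr V r).pull (T i j)

theorem part_mul {γ δ : ZMod 2} (f : SF V) {g : SF V} (hg : HasParity δ g) :
    part (γ + δ) (f * g) = part γ f * g := by
  unfold HasParity at hg
  rw [part_apply, part_apply, map_mul, hg, sgn_add, smul_mul_assoc, add_mul, mul_smul_comm,
    smul_smul, smul_mul_assoc, mul_assoc, sgn_mul_self, mul_one]

theorem part_pull (φ : Mor V V') (ε : ZMod 2) (f : SF V') :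
    part ε (φ.pull f) = φ.pull (part ε f) := by
  rw [part_apply, part_apply, map_smul, map_add, map_smul, Mor.invol_pull]

variable {φ : Mor V V'} {T : κ → κ → SF V} {s t : Sec κ V} {s' t' : Sec κ V'}

namespace Sec.Agree

theorem add (h : Sec.Agree φ T s s') (h' : Sec.Agree φ T t t') :
    Sec.Agree φ T (s + t) (s' + t') := fun j => by
  simp only [Pi.add_apply, map_add, h j, h' j, add_mul, Finset.sum_add_distrib]

/-- The parities of the matrix entries make the change of frame preserve parity of sections. This
permits reduction to homogeneous sections, for which the derived formulas are available. -/
theorem part (hT : ∀ i j, SuperGeom.HasParity (q i + q j) (T i j)) (h : Sec.Agree φ T s s')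
    (ε : ZMod 2) : Sec.Agree φ T (Sec.part q V ε s) (Sec.part q V' ε s') := fun j => by
  rw [Sec.part_apply, ← part_pull, h j, map_sum]
  refine Finset.sum_congr rfl fun i _ => ?_
  have e : ε + q j = ε + q i + (q i + q j) := by
    rw [add_assoc, ← add_assoc (q i), CharTwo.add_self_eq_zero, zero_add]
  rw [e, part_mul _ (hT i j), Sec.part_apply]

theorem homogeneous_induction (hT : ∀ i j, SuperGeom.HasParity (q i + q j) (T i j))
    {C : Sec κ V → Sec κ V' → Prop} (add : ∀ s s' t t', C s s' → C t t' → C (s + t) (s' + t'))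
    (hom : ∀ ε s s', s.HasParity q ε → s'.HasParity q ε → Sec.Agree φ T s s' → C s s')
    (h : Sec.Agree φ T s s') : C s s' := by
  rw [← Sec.part_add_part (q := q) s, ← Sec.part_add_part (q := q) s']
  exact add _ _ _ _
    (hom _ _ _ (Sec.hasParity_part 0 s) (Sec.hasParity_part 0 s') (h.part hT 0))
    (hom _ _ _ (Sec.hasParity_part 1 s) (Sec.hasParity_part 1 s') (h.part hT 1))

end Sec.Agree

variable {Φ : Mor (cyl V fun k => q k + 1) (cyl V' fun k => q k + 1)}

/-- Sections agree if and only if the corresponding vector fields on the parity reversion are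
related. -/
theorem Sec.agree_iff_related (hΦ : Φ.IsLinear φ T) (ε : ZMod 2) (s : Sec κ V) (s' : Sec κ V') :
    Sec.Agree φ T s s' ↔ VF.Related Φ (s.toVF q ε) (s'.toVF q ε) := by
  have key : ∀ j, (s.toVF q ε).apply (Φ.comp (Sum.inr j)) =
      sgn ε • (pr V _).pull (∑ i, s i * T i j) := fun j => by
    rw [hΦ.comp_inr, Sec.toVF_apply, map_sum, Finset.smul_sum]
    refine Finset.sum_congr rfl fun k _ => ?_
    rw [map_sum, Finset.sum_eq_single k, pd_mul, pd_inr_pr_pull, mul_zero, add_zero, pd_coord,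
      if_pos rfl, one_mul, Mor.pull_mul]
    · intro i _ hi
      rw [pd_mul, pd_inr_pr_pull, mul_zero, add_zero, pd_coord,
        if_neg fun e => hi (Sum.inr_injective e).symm, zero_mul]
    · simp
  have key' : ∀ j, Φ.pull (s'.toVF q ε (Sum.inr j)) = sgn ε • (pr V _).pull (φ.pull (s' j)) :=
    fun j => by rw [Sec.toVF_inr, map_smul, hΦ.covers.pull_pr]
  constructor
  · intro h B
    cases B with
    | inl A =>
      rw [hΦ.covers A, Sec.toVF_apply_basic _ _ (isBasic_pull _), Sec.toVF_inl, map_zero]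
    | inr j => rw [key, key', h j]
  · intro h j
    have h2 := congrArg (sgn ε • ·) (h (Sum.inr j))
    simp only [key, key', smul_smul, sgn_mul_self, one_smul] at h2
    exact (pr_pull_injective h2).symm

variable {Q : VF (cyl V fun k => q k + 1)} {Q' : VF (cyl V' fun k => q k + 1)}

theorem Sec.Agree.derived (hΦ : Φ.IsLinear φ T) (hQ : Q.IsDerived) (hQQ : VF.Related Φ Q Q')
    {ε : ZMod 2} (hs : s.HasParity q ε) (h : Sec.Agree φ T s s') :
    VF.Related Φ (s.derived q Q ε) (s'.derived q Q' ε) :=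
  hQQ.bracket hQ.odd hs.toVF ((Sec.agree_iff_related hΦ ε s s').1 h)

theorem related_anchorOf (hT : ∀ i j, HasParity (q i + q j) (T i j)) (hΦ : Φ.IsLinear φ T)
    (hQ : Q.IsDerived) (hQ' : Q'.IsDerived) (hQQ : VF.Related Φ Q Q') (h : Sec.Agree φ T s s') :
    VF.Related φ (anchorOf Q s) (anchorOf Q' s') := by
  refine Sec.Agree.homogeneous_induction hT
    (C := fun s s' => VF.Related φ (anchorOf Q s) (anchorOf Q' s'))
    (fun s s' t t' h h' => ?_) (fun ε s s' hs _ h => ?_) h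
  · rw [map_add, map_add]
    exact h.add h'
  · intro B
    apply pr_pull_injective (r := fun k => q k + 1)
    rw [← derived_apply_pull hQ ε, ← hΦ.covers B, h.derived hΦ hQ hQQ hs, derived_inl hQ',
      hΦ.covers.pull_pr]

/-- For homogeneous sections, agreement means relatedness of the fields `i(s)`, and relatedness
survives the two commutators of the derived bracket. -/
theorem agree_bracketOf (hT : ∀ i j, HasParity (q i + q j) (T i j)) (hΦ : Φ.IsLinear φ T)
    (hQ : Q.IsDerived) (hQ' : Q'.IsDerived) (hQQ : VF.Related Φ Q Q') (h : Sec.Agree φ T s s')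
    (h' : Sec.Agree φ T t t') : Sec.Agree φ T (bracketOf Q s t) (bracketOf Q' s' t') := by
  refine Sec.Agree.homogeneous_induction hT
    (C := fun s s' => Sec.Agree φ T (bracketOf Q s t) (bracketOf Q' s' t'))
    (fun s s' u u' h h' => ?_) (fun ε s s' hs hs' h => ?_) h
  · rw [map_add, map_add, LinearMap.add_apply, LinearMap.add_apply]
    exact h.add h'
  refine Sec.Agree.homogeneous_induction hT
    (C := fun t t' => Sec.Agree φ T (bracketOf Q s t) (bracketOf Q' s' t'))
    (fun t t' u u' h h' => ?_) (fun δ t t' ht ht' h' => ?_) h'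
  · rw [map_add, map_add]
    exact h.add h'
  rw [Sec.agree_iff_related hΦ (ε + δ), toVF_bracketOf hQ hs ht, toVF_bracketOf hQ' hs' ht']
  exact ((h.derived hΦ hQ hQQ hs).bracket (hs.derived hQ.odd) ht.toVF
    ((Sec.agree_iff_related hΦ δ t t').1 h')).smul _

theorem IsBasic.res {r : κ → ZMod 2} {f : SF (cyl V r)} (hf : IsBasic f) {W : Opens (Ev p → ℝ)}
    (h : W ≤ V) : IsBasic (res (cyl_mono h r) f) := by
  obtain ⟨g, rfl⟩ := hf
  exact ⟨SuperGeom.res h g, pr_pull_res h g⟩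

theorem VF.IsDerived.restr {W : Opens (Ev p → ℝ)} (hQ : Q.IsDerived) (h : W ≤ V) :
    (Q.restr (cyl_mono h (fun k => q k + 1))).IsDerived where
  basic_inl k A := by
    rw [VF.restr, pd_res]
    exact (hQ.basic_inl k A).res h
  basic_inr j k l := by
    rw [VF.restr, pd_res, pd_res]
    exact (hQ.basic_inr j k l).res h
  odd := hQ.odd.restr _
  sq := by
    rw [← VF.bracket_restr, hQ.sq]
    exact funext fun A => map_zero _

theorem Mor.linear_isLinear_restr {U U' : Opens (Ev p → ℝ)} {r : κ → ZMod 2} (ψ : Mor U U')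
    (S : κ → κ → SF U) (hS : ∀ i j, HasParity (r i + r j) (S i j)) (h : V ≤ U)
    (hm : ∀ x : V, ψ.point ⟨x, h x.2⟩ ∈ V') :
    ((ψ.linear r S hS).restr (cyl_mono h r)
      (Mor.Covers.maps (ψ.linear_covers S hS) h hm)).IsLinear (ψ.restr h hm)
      (fun i j => res h (S i j)) where
  covers := (ψ.linear_covers S hS).restr h hm _
  comp_inr j := by
    rw [Mor.restr_comp, Mor.linear_inr, map_sum]
    refine Finset.sum_congr rfl fun i _ => ?_
    rw [map_mul, res_coord, pr_pull_res]

end Agreement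

/-! ### The Lie algebroid of a derived field. -/

section Existence

variable {ι κ : Type*} {p : ι → ZMod 2} {q : κ → ZMod 2} [Fintype ι] [Fintype κ]
  [DecidableEq ι] [DecidableEq κ]

/-- The Lie algebroid structure given by a homological field with quadratic components. -/
def LieAlgebroid.ofVF (F : Bundle.{u} p q) (Q : F.parityRev.total.VField)
    (hQ : F.parityRev.total.IsHomological Q)
    (hQ2 : ∀ α : F.base.Chart, VF.IsDerived (V := F.base.dom α) (q := q) (Q α)) :
    LieAlgebroid F where
  anchor α _ hV := anchorOf (VF.restr (cyl_mono hV _) (Q α))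
  bracket α _ hV := bracketOf (VF.restr (cyl_mono hV _) (Q α))
  anchor_agree α β _ _ hV hV' hm _ _ h :=
    related_anchorOf (fun i j => (F.trans_parity α β i j).res hV)
      (Mor.linear_isLinear_restr (F.base.tr α β) (F.trans α β) (F.parityRev.trans_parity α β) hV hm)
      ((hQ2 α).restr (hV.trans (F.base.ov_le α β))) ((hQ2 β).restr hV') ((hQ.isVField α β).restr _ _ _) h
  bracket_agree α β _ _ hV hV' hm _ _ _ _ h h' :=
    agree_bracketOf (fun i j => (F.trans_parity α β i j).res hV)
      (Mor.linear_isLinear_restr (F.base.tr α β) (F.trans α β) (F.parityRev.trans_parity α β) hV hm)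
      ((hQ2 α).restr (hV.trans (F.base.ov_le α β))) ((hQ2 β).restr hV') ((hQ.isVField α β).restr _ _ _) h h'
  anchor_parity α _ hV _ _ hs := hasParity_anchorOf ((hQ2 α).restr hV) hs
  bracket_parity α _ hV _ _ _ _ hs ht := hasParity_bracketOf ((hQ2 α).restr hV) hs ht
  bracket_skew α _ hV _ _ _ _ hs ht := bracketOf_skew ((hQ2 α).restr hV) hs ht
  jacobi α _ hV _ _ _ _ w hs ht := bracketOf_jacobi ((hQ2 α).restr hV) hs ht w
  leibniz α _ hV _ _ _ t _ hs hf := bracketOf_leibniz ((hQ2 α).restr hV) hs hf t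
  anchor_bracket α _ hV _ _ _ _ hs ht := anchorOf_bracketOf ((hQ2 α).restr hV) hs ht

theorem LieAlgebroid.ofVF_anchor (F : Bundle.{u} p q) (Q : F.parityRev.total.VField)
    (hQ : F.parityRev.total.IsHomological Q)
    (hQ2 : ∀ α : F.base.Chart, VF.IsDerived (V := F.base.dom α) (q := q) (Q α))
    (α : F.base.Chart) (V : Opens (Ev p → ℝ)) (hV : V ≤ F.base.dom α) :
    (LieAlgebroid.ofVF F Q hQ hQ2).anchor α V hV = anchorOf (VF.restr (cyl_mono hV _) (Q α)) := rfl

theorem LieAlgebroid.ofVF_bracket (F : Bundle.{u} p q) (Q : F.parityRev.total.VField)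
    (hQ : F.parityRev.total.IsHomological Q)
    (hQ2 : ∀ α : F.base.Chart, VF.IsDerived (V := F.base.dom α) (q := q) (Q α))
    (α : F.base.Chart) (V : Opens (Ev p → ℝ)) (hV : V ≤ F.base.dom α) :
    (LieAlgebroid.ofVF F Q hQ hQ2).bracket α V hV = bracketOf (VF.restr (cyl_mono hV _) (Q α)) :=
  rfl

theorem LieAlgebroid.ofVF_isGivenBy (F : Bundle.{u} p q) (Q : F.parityRev.total.VField)
    (hQ : F.parityRev.total.IsHomological Q)
    (hQ2 : ∀ α : F.base.Chart, VF.IsDerived (V := F.base.dom α) (q := q) (Q α)) :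
    (LieAlgebroid.ofVF F Q hQ hQ2).IsGivenBy Q where
  anchor_eq α V hV ε s _ f := by
    rw [LieAlgebroid.ofVF_anchor]
    exact (derived_apply_pull ((hQ2 α).restr hV) ε s f).symm
  bracket_eq α V hV ε δ s t hs ht := by
    rw [LieAlgebroid.ofVF_bracket]
    exact toVF_bracketOf ((hQ2 α).restr hV) hs ht

end Existence

/-! ## Fields giving Lie algebroids are quadratic -/

section Quadratic

variable {ι κ : Type*} {p : ι → ZMod 2} {q : κ → ZMod 2} [Fintype ι] [Fintype κ]
  [DecidableEq ι] [DecidableEq κ] {V : Opens (Ev p → ℝ)}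

/-- The sections of the standard frame. -/
def Sec.basis (V : Opens (Ev p → ℝ)) (k : κ) : Sec κ V := Pi.single k 1

theorem Sec.basis_apply (k l : κ) : Sec.basis V k l = if l = k then 1 else 0 :=
  Pi.single_apply _ _ _

theorem Sec.hasParity_basis (k : κ) : (Sec.basis V k).HasParity q (q k) := fun l => by
  rw [Sec.basis_apply]
  split_ifs with h
  · rw [h, CharTwo.add_self_eq_zero]
    exact hasParity_one
  · exact hasParity_zero _

theorem Sec.eq_sum_basis (s : Sec κ V) : s = ∑ k, s k • Sec.basis V k := by
  funext l
  rw [Finset.sum_apply, Finset.sum_eq_single l]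
  · rw [Pi.smul_apply, Sec.basis_apply, if_pos rfl, smul_eq_mul, mul_one]
  · intro k _ h
    rw [Pi.smul_apply, Sec.basis_apply, if_neg h.symm, smul_zero]
  · simp

theorem Sec.toVF_basis_apply (ε : ZMod 2) (k : κ) (f : SF (cyl V (fun k => q k + 1))) :
    ((Sec.basis V k).toVF q ε).apply f = sgn ε • pd _ (Sum.inr k) f := by
  rw [Sec.toVF_apply, Finset.sum_eq_single k]
  · rw [Sec.basis_apply, if_pos rfl, Mor.pull_one, one_mul]
  · intro l _ h
    rw [Sec.basis_apply, if_neg h, map_zero, zero_mul, smul_zero]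
  · simp

theorem VF.apply_toVF_basis (X : VF (cyl V (fun k => q k + 1))) (ε : ZMod 2) (k : κ)
    (B : ι ⊕ κ) : X.apply ((Sec.basis V k).toVF q ε B) = 0 := by
  cases B with
  | inl A => rw [Sec.toVF_inl, VF.apply_zero]
  | inr l =>
    rw [Sec.toVF_inr, Sec.basis_apply]
    split_ifs
    · rw [Mor.pull_one, VF.apply_smul, VF.apply]
      simp [pd_one]
    · rw [map_zero, smul_zero, VF.apply_zero]

/-- The field of a frame section has constant coefficients, so only the derivative of `Q` along the
fibre coordinate remains. -/
theorem Sec.derived_basis (Q : VF (cyl V (fun k => q k + 1))) (ε : ZMod 2) (k : κ) (B : ι ⊕ κ) :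
    (Sec.basis V k).derived q Q ε B =
      (-(sgn (1 * (ε + 1)) * sgn ε)) • pd _ (Sum.inr k) (Q B) := by
  rw [Sec.derived, VF.bracket_eq_apply, VF.apply_toVF_basis, Sec.toVF_basis_apply, zero_sub,
    smul_smul, neg_smul]

theorem sgn_ne_zero (ε : ZMod 2) : sgn ε ≠ 0 := fun h => by
  have := sgn_mul_self ε
  rw [h, zero_mul] at this
  exact zero_ne_one this

theorem IsBasic.of_smul {r : κ → ZMod 2} {f : SF (cyl V r)} {c : ℝ} (hc : c ≠ 0)
    (h : IsBasic (c • f)) : IsBasic f := by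
  have := h.smul c⁻¹
  rwa [smul_smul, inv_mul_cancel₀ hc, one_smul] at this

/-- If the derived anchor and bracket are defined on the standard frame then the field has quadratic
components. -/
theorem VF.isQuadratic_of_derived {Q : VF (cyl V (fun k => q k + 1))}
    (h1 : ∀ k A, IsBasic ((Sec.basis V k).derived q Q (q k) (Sum.inl A)))
    (h2 : ∀ k j l, IsBasic (((Sec.basis V k).derived q Q (q k)).bracket (q k) (q j + 1)
      ((Sec.basis V j).toVF q (q j)) (Sum.inr l))) : Q.IsQuadratic where
  basic_inl k A := by
    have h := h1 k A
    rw [Sec.derived_basis] at h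
    exact h.of_smul (neg_ne_zero.2 (mul_ne_zero (sgn_ne_zero _) (sgn_ne_zero _)))
  basic_inr j k l := by
    have h := h2 k j l
    rw [VF.bracket_eq_apply, VF.apply_toVF_basis, zero_sub, Sec.toVF_basis_apply,
      Sec.derived_basis, map_smul, ← neg_smul] at h
    exact ((h.of_smul (neg_ne_zero.2 (sgn_ne_zero _))).of_smul (sgn_ne_zero _)).of_smul
      (neg_ne_zero.2 (mul_ne_zero (sgn_ne_zero _) (sgn_ne_zero _)))

/-- The left sides of the two identities are built from pullbacks from the base. Evaluated on
coordinates and on components, they show that the fibre derivatives of `Q` are basic. -/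
theorem VF.isQuadratic_of_eq {Q : VF (cyl V (fun k => q k + 1))} {a : Sec κ V → VF V}
    {b : Sec κ V → Sec κ V → Sec κ V}
    (h1 : ∀ k A, (pr V _).pull ((a (Sec.basis V k)).apply (coord V A)) =
      ((Sec.basis V k).derived q (Q.restr (cyl_mono le_rfl _)) (q k)).apply
        ((pr V _).pull (coord V A)))
    (h2 : ∀ k j, (b (Sec.basis V k) (Sec.basis V j)).toVF q (q k + q j) =
      sgn (q k) • ((Sec.basis V k).derived q (Q.restr (cyl_mono le_rfl _)) (q k)).bracket (q k)
        (q j + 1) ((Sec.basis V j).toVF q (q j))) : Q.IsQuadratic := by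
  have e : Q.restr (cyl_mono le_rfl _) = Q := funext fun A => res_rfl _
  rw [e] at h1 h2
  refine VF.isQuadratic_of_derived (fun k A => ?_) (fun k j l => ?_)
  · have h := h1 k A
    rw [pr_pull_coord, VF.apply_coord] at h
    exact ⟨_, h.trans (VF.apply_coord _ _)⟩
  · have h := congrFun (h2 k j) (Sum.inr l)
    rw [Sec.toVF_inr, Pi.smul_apply] at h
    refine IsBasic.of_smul (sgn_ne_zero (q k)) ?_
    rw [← h]
    exact (isBasic_pull _).smul _

theorem LieAlgebroid.IsGivenBy.isDerived {F : Bundle.{u} p q} {L : LieAlgebroid F}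
    {Q : F.parityRev.total.VField} (h : L.IsGivenBy Q) (hQ : F.parityRev.total.IsHomological Q)
    (α : F.base.Chart) : VF.IsDerived (V := F.base.dom α) (q := q) (Q α) where
  toIsQuadratic := VF.isQuadratic_of_eq (a := L.anchor α (F.base.dom α) le_rfl)
    (b := fun s t => L.bracket α (F.base.dom α) le_rfl s t)
    (fun k A => h.anchor_eq α (F.base.dom α) le_rfl (q k) _ (Sec.hasParity_basis k) (coord _ A))
    (fun k j => h.bracket_eq α (F.base.dom α) le_rfl (q k) (q j) _ _ (Sec.hasParity_basis k)
      (Sec.hasParity_basis j))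
  odd := hQ.odd α
  sq := hQ.sq α

end Quadratic

/-! ### Quadraticity passes to the prolonged field. -/

section RegroupQuadratic

variable {ι κ : Type*} {p : ι → ZMod 2} {q r : κ → ZMod 2} [Fintype ι] [Fintype κ]
  [DecidableEq ι] [DecidableEq κ] {U V : Opens (Ev p → ℝ)}

theorem pd_regroupInv_pull {s : κ ⊕ κ → ZMod 2} (hs : ∀ k, s k = Sum.elim r r k)
    (B : (ι ⊕ ι) ⊕ (κ ⊕ κ)) (f : SF (tan (cyl U r))) :
    pd _ B ((regroupInv U r s hs).pull f) =
      (regroupInv U r s hs).pull (pd _ (Equiv.sumSumSumComm ι ι κ κ B) f) := by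
  have e : ∀ C, Equiv.sumSumSumComm ι κ ι κ C = B ↔ C = Equiv.sumSumSumComm ι ι κ κ B := by
    intro C
    exact (Equiv.eq_symm_apply (Equiv.sumSumSumComm ι κ ι κ)).symm
  rw [Mor.pd_pull, Finset.sum_eq_single (Equiv.sumSumSumComm ι ι κ κ B)]
  · rw [regroupInv_comp, pd_coord, if_pos ((e _).2 rfl).symm, one_mul]
  · intro C _ hC
    rw [regroupInv_comp, pd_coord, if_neg fun h => hC ((e _).1 h.symm), zero_mul]
  · simp

theorem IsBasic.regroupInv_pr {s : κ ⊕ κ → ZMod 2} (hs : ∀ k, s k = Sum.elim r r k)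
    {f : SF (cyl U r)} (hf : IsBasic f) :
    IsBasic ((regroupInv U r s hs).pull ((pr (cyl U r) (Sum.elim p r)).pull f)) := by
  obtain ⟨g, rfl⟩ := hf
  rw [← regroup_pull_pr_pr hs, regroupInv_pull_regroup_pull]
  exact isBasic_pull _

theorem IsBasic.regroupInv_diff {s : κ ⊕ κ → ZMod 2} (hs : ∀ k, s k = Sum.elim r r k)
    {f : SF (cyl U r)} (hf : IsBasic f) :
    IsBasic ((regroupInv U r s hs).pull (diff f)) := by
  obtain ⟨g, rfl⟩ := hf
  rw [← regroup_pull_pr_diff hs, regroupInv_pull_regroup_pull]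
  exact isBasic_pull _

/-- A fibre derivative of a component of the prolongation is zero, or the pullback or differential
of a fibre derivative of a component of `Q`. Pullbacks and differentials of functions basic over `M`
are basic over `TM`. -/
theorem VF.IsQuadratic.regroup_prolong {Q : VF (cyl U fun k => q k + 1)} (hQ : Q.IsQuadratic) :
    VF.IsQuadratic (q := Sum.elim q q) (Q.prolong.regroup (parityRev_elim q)) where
  basic_inl k A := by
    rw [VF.regroup, pd_regroupInv_pull]
    rcases k with k | k <;> rcases A with A | A
    · change IsBasic ((regroupInv U _ _ _).pull (pd _ (Sum.inl (Sum.inr k)) ((pr _ _).pull _)))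
      rw [pd_inl_pr_pull]
      exact (hQ.basic_inl k A).regroupInv_pr _
    · change IsBasic ((regroupInv U _ _ _).pull (pd _ (Sum.inl (Sum.inr k)) (diff _)))
      rw [pd_inl_diff]
      exact (hQ.basic_inl k A).regroupInv_diff _
    · change IsBasic ((regroupInv U _ _ _).pull (pd _ (Sum.inr (Sum.inr k)) ((pr _ _).pull _)))
      rw [pd_inr_pr_pull, map_zero]
      exact isBasic_zero
    · change IsBasic ((regroupInv U _ _ _).pull (pd _ (Sum.inr (Sum.inr k)) (diff _)))
      rw [pd_inr_diff]
      exact (hQ.basic_inl k A).regroupInv_pr _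
  basic_inr j k l := by
    rw [VF.regroup, pd_regroupInv_pull, pd_regroupInv_pull]
    rcases k with k | k <;> rcases l with l | l
    · change IsBasic ((regroupInv U _ _ _).pull (pd _ _
        (pd _ (Sum.inl (Sum.inr k)) ((pr _ _).pull _))))
      rw [pd_inl_pr_pull]
      rcases j with j | j
      · change IsBasic ((regroupInv U _ _ _).pull (pd _ (Sum.inl (Sum.inr j)) ((pr _ _).pull _)))
        rw [pd_inl_pr_pull]
        exact (hQ.basic_inr j k l).regroupInv_pr _
      · change IsBasic ((regroupInv U _ _ _).pull (pd _ (Sum.inr (Sum.inr j)) ((pr _ _).pull _)))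
        rw [pd_inr_pr_pull, map_zero]
        exact isBasic_zero
    · change IsBasic ((regroupInv U _ _ _).pull (pd _ _ (pd _ (Sum.inl (Sum.inr k)) (diff _))))
      rw [pd_inl_diff]
      rcases j with j | j
      · change IsBasic ((regroupInv U _ _ _).pull (pd _ (Sum.inl (Sum.inr j)) (diff _)))
        rw [pd_inl_diff]
        exact (hQ.basic_inr j k l).regroupInv_diff _
      · change IsBasic ((regroupInv U _ _ _).pull (pd _ (Sum.inr (Sum.inr j)) (diff _)))
        rw [pd_inr_diff]
        exact (hQ.basic_inr j k l).regroupInv_pr _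
    · change IsBasic ((regroupInv U _ _ _).pull (pd _ _
        (pd _ (Sum.inr (Sum.inr k)) ((pr _ _).pull _))))
      rw [pd_inr_pr_pull, map_zero, map_zero]
      exact isBasic_zero
    · change IsBasic ((regroupInv U _ _ _).pull (pd _ _ (pd _ (Sum.inr (Sum.inr k)) (diff _))))
      rw [pd_inr_diff]
      rcases j with j | j
      · change IsBasic ((regroupInv U _ _ _).pull (pd _ (Sum.inl (Sum.inr j)) ((pr _ _).pull _)))
        rw [pd_inl_pr_pull]
        exact (hQ.basic_inr j k l).regroupInv_pr _
      · change IsBasic ((regroupInv U _ _ _).pull (pd _ (Sum.inr (Sum.inr j)) ((pr _ _).pull _)))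
        rw [pd_inr_pr_pull, map_zero]
        exact isBasic_zero

theorem VF.IsDerived.regroup_prolong {Q : VF (cyl U fun k => q k + 1)} (hQ : Q.IsDerived) :
    VF.IsDerived (q := Sum.elim q q) (Q.prolong.regroup (parityRev_elim q)) where
  toIsQuadratic := hQ.toIsQuadratic.regroup_prolong
  odd := hQ.odd.prolong.regroup _
  sq := VF.regroup_prolong_sq _ hQ.odd hQ.sq

end RegroupQuadratic

/-! ## The Lie algebroid given by the tangent prolongation -/

section TangentSections

variable {ι κ : Type*} {p : ι → ZMod 2} {q : κ → ZMod 2} [Fintype ι] [Fintype κ]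
  [DecidableEq ι] [DecidableEq κ] {V : Opens (Ev p → ℝ)}

namespace Sec

theorem tangent_inl (s : Sec κ V) (k : κ) : s.tangent (Sum.inl k) = (pr V p).pull (s k) := rfl

theorem tangent_inr (s : Sec κ V) (k : κ) : s.tangent (Sum.inr k) = diff (s k) := rfl

theorem core_inl (s : Sec κ V) (k : κ) : s.core (Sum.inl k) = 0 := rfl

theorem core_inr (s : Sec κ V) (k : κ) : s.core (Sum.inr k) = (pr V p).pull (s k) := rfl

theorem tangent_add (s t : Sec κ V) : (s + t).tangent = s.tangent + t.tangent := by
  funext k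
  cases k with
  | inl k => exact map_add _ _ _
  | inr k => exact diff_add _ _

theorem core_add (s t : Sec κ V) : (s + t).core = s.core + t.core := by
  funext k
  cases k with
  | inl k => exact (add_zero _).symm
  | inr k => exact map_add _ _ _

theorem HasParity.tangent {ε : ZMod 2} {s : Sec κ V} (hs : s.HasParity q ε) :
    s.tangent.HasParity (Sum.elim q q) ε := fun k => by
  cases k with
  | inl k => exact (pr V p).hasParity_pull (hs k)
  | inr k => exact hasParity_diff (hs k)

theorem HasParity.core {ε : ZMod 2} {s : Sec κ V} (hs : s.HasParity q ε) :
    s.core.HasParity (Sum.elim q q) ε := fun k => by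
  cases k with
  | inl k => exact hasParity_zero _
  | inr k => exact (pr V p).hasParity_pull (hs k)

/-- Together with `core_basis`: the tangent and core sections of a frame of `E` are the standard
frame of `TE`. Uniqueness of the prolongation rests on this. -/
theorem tangent_basis (k : κ) : (basis V k).tangent = basis (tan V) (Sum.inl k) := by
  funext l
  rw [basis_apply]
  cases l with
  | inl l =>
    rw [tangent_inl, basis_apply]
    by_cases h : l = k
    · rw [if_pos h, if_pos (congrArg _ h), Mor.pull_one]
    · rw [if_neg h, if_neg fun e => h (Sum.inl_injective e), map_zero]
  | inr l =>
    rw [tangent_inr, basis_apply, if_neg Sum.inr_ne_inl]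
    split_ifs
    · exact diff_one
    · exact diff_zero

theorem core_basis (k : κ) : (basis V k).core = basis (tan V) (Sum.inr k) := by
  funext l
  rw [basis_apply]
  cases l with
  | inl l => rw [core_inl, if_neg Sum.inl_ne_inr]
  | inr l =>
    rw [core_inr, basis_apply]
    by_cases h : l = k
    · rw [if_pos h, if_pos (congrArg _ h), Mor.pull_one]
    · rw [if_neg h, if_neg fun e => h (Sum.inr_injective e), map_zero]

/-- With `toVF_core`, the dictionary between lifts of sections and lifts of vector fields. The
brackets formed with the prolonged field thereby become lifts of brackets formed with `Q`. -/
theorem toVF_tangent (ε : ZMod 2) (s : Sec κ V) :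
    s.tangent.toVF (Sum.elim q q) ε = (s.toVF q ε).prolong.regroup (parityRev_elim q) := by
  funext B
  apply regroup_pull_injective (parityRev_elim q)
  rw [VF.regroup, regroup_pull_regroupInv_pull]
  rcases B with (A | A) | (k | k)
  · exact (map_zero _).trans (map_zero (pr (cyl V fun k => q k + 1) _).pull).symm
  · exact (map_zero _).trans diff_zero.symm
  · change (regroup V _ _ (parityRev_elim q)).pull (sgn ε • (pr (tan V) _).pull
      ((pr V p).pull (s k))) = (pr _ _).pull (sgn ε • (pr V _).pull (s k))
    rw [map_smul, map_smul, regroup_pull_pr_pr]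
  · change (regroup V _ _ (parityRev_elim q)).pull (sgn ε • (pr (tan V) _).pull
      (diff (s k))) = diff (sgn ε • (pr V _).pull (s k))
    rw [map_smul, diff_smul, regroup_pull_pr_diff]

theorem toVF_core (ε : ZMod 2) (s : Sec κ V) :
    s.core.toVF (Sum.elim q q) ε = (s.toVF q ε).vlift.regroup (parityRev_elim q) := by
  funext B
  apply regroup_pull_injective (parityRev_elim q)
  rw [VF.regroup, regroup_pull_regroupInv_pull]
  rcases B with (A | A) | (k | k)
  · exact map_zero _
  · exact (map_zero _).trans (map_zero (pr (cyl V fun k => q k + 1) _).pull).symm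
  · change (regroup V _ _ (parityRev_elim q)).pull (sgn ε • (pr (tan V) _).pull 0) = 0
    rw [map_zero, smul_zero, map_zero]
  · change (regroup V _ _ (parityRev_elim q)).pull (sgn ε • (pr (tan V) _).pull
      ((pr V p).pull (s k))) = (pr _ _).pull (sgn ε • (pr V _).pull (s k))
    rw [map_smul, map_smul, regroup_pull_pr_pr]

variable {Q : VF (cyl V fun k => q k + 1)} {ε δ : ZMod 2} {s t : Sec κ V}

theorem derived_tangent (hQ : Q.HasParity 1) (hs : s.HasParity q ε) :
    s.tangent.derived (Sum.elim q q) (Q.prolong.regroup (parityRev_elim q)) ε =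
      (s.derived q Q ε).prolong.regroup (parityRev_elim q) := by
  rw [derived, toVF_tangent, VF.regroup_bracket _ hQ.prolong hs.toVF.prolong, VF.prolong_bracket,
    derived]

theorem derived_core (hQ : Q.HasParity 1) (hs : s.HasParity q ε) :
    s.core.derived (Sum.elim q q) (Q.prolong.regroup (parityRev_elim q)) ε =
      (s.derived q Q ε).vlift.regroup (parityRev_elim q) := by
  rw [derived, toVF_core, VF.regroup_bracket _ hQ.prolong hs.toVF.vlift, VF.prolong_bracket_vlift,
    derived]

end Sec

theorem VF.ext_lift {X Y : VF (tan V)}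
    (h : ∀ f, X.apply ((pr V p).pull f) = Y.apply ((pr V p).pull f))
    (h' : ∀ f, X.apply (diff f) = Y.apply (diff f)) : X = Y := by
  funext B
  cases B with
  | inl A => simpa only [pr_pull_coord, VF.apply_coord] using h (coord V A)
  | inr A => simpa only [diff_coord, VF.apply_coord] using h' (coord V A)

theorem VF.regroup_apply {r : κ → ZMod 2} {s : κ ⊕ κ → ZMod 2} (hs : ∀ k, s k = Sum.elim r r k)
    (X : VF (tan (cyl V r))) (f : SF (cyl (tan V) s)) :
    (X.regroup hs).apply f = (regroupInv V r s hs).pull (X.apply ((SuperGeom.regroup V r s hs).pull f)) := by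
  apply regroup_pull_injective hs
  rw [regroup_pull_regroupInv_pull, (X.related_regroup hs).apply_pull]

section Lift

variable {D : VF (cyl V fun k => q k + 1)} {a : VF V} {b : VF (tan V)}

/-- In use, `D` is `[Q, i(s)]`, and `a` and `b` are the anchors of `s` and of its tangent section.
The fields are compared on pullbacks and differentials, after lifting to the total space, where
pullback is injective. -/
theorem VF.eq_prolong (ha : ∀ f, (pr V _).pull (a.apply f) = D.apply ((pr V _).pull f))
    (hb : ∀ f, (pr (tan V) _).pull (b.apply f) =
      (D.prolong.regroup (parityRev_elim q)).apply ((pr (tan V) _).pull f)) : b = a.prolong := by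
  refine VF.ext_lift (fun f => ?_) (fun f => ?_) <;>
    refine pr_pull_injective (r := fun k => Sum.elim q q k + 1)
      (regroup_pull_injective (parityRev_elim q) ?_) <;>
    rw [hb, VF.regroup_apply, regroup_pull_regroupInv_pull]
  · rw [regroup_pull_pr_pr, VF.prolong_apply_pull, ← ha, VF.prolong_apply_pull, regroup_pull_pr_pr]
  · rw [regroup_pull_pr_diff, VF.prolong_apply_diff, ← ha, VF.prolong_apply_diff,
      regroup_pull_pr_diff]

theorem VF.eq_vlift (ha : ∀ f, (pr V _).pull (a.apply f) = D.apply ((pr V _).pull f))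
    (hb : ∀ f, (pr (tan V) _).pull (b.apply f) =
      (D.vlift.regroup (parityRev_elim q)).apply ((pr (tan V) _).pull f)) : b = a.vlift := by
  refine VF.ext_lift (fun f => ?_) (fun f => ?_) <;>
    refine pr_pull_injective (r := fun k => Sum.elim q q k + 1)
      (regroup_pull_injective (parityRev_elim q) ?_) <;>
    rw [hb, VF.regroup_apply, regroup_pull_regroupInv_pull]
  · rw [regroup_pull_pr_pr, VF.vlift_apply_pull, VF.vlift_apply_pull, map_zero, map_zero]
  · rw [regroup_pull_pr_diff, VF.vlift_apply_diff, ← ha, VF.vlift_apply_diff, regroup_pull_pr_pr]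

end Lift

section Bracket

variable {Q : VF (cyl V fun k => q k + 1)} {ε δ : ZMod 2} {s t w : Sec κ V} {b : Sec (κ ⊕ κ) (tan V)}

/-- Here `w` stands for the bracket in `E` and `b` for the bracket in `TE`. Since `i` is injective,
the claim becomes the bracket formula for two prolongations; the next two lemmas use the other two
bracket formulas. -/
theorem Sec.eq_tangent_of_derived (hQ : Q.HasParity 1) (hs : s.HasParity q ε)
    (ht : t.HasParity q δ)
    (hw : w.toVF q (ε + δ) = sgn ε • (s.derived q Q ε).bracket ε (δ + 1) (t.toVF q δ))
    (hb : b.toVF (Sum.elim q q) (ε + δ) =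
      sgn ε • (s.tangent.derived (Sum.elim q q) (Q.prolong.regroup (parityRev_elim q)) ε).bracket ε
        (δ + 1) (t.tangent.toVF (Sum.elim q q) δ)) : b = w.tangent := by
  apply Sec.toVF_injective (q := Sum.elim q q) (ε + δ)
  rw [hb, Sec.derived_tangent hQ hs, Sec.toVF_tangent, Sec.toVF_tangent, hw,
    VF.regroup_bracket _ (hs.derived hQ).prolong ht.toVF.prolong, VF.prolong_bracket,
    VF.prolong_smul, VF.regroup_smul]

theorem Sec.eq_core_of_derived (hQ : Q.HasParity 1) (hs : s.HasParity q ε)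
    (ht : t.HasParity q δ)
    (hw : w.toVF q (ε + δ) = sgn ε • (s.derived q Q ε).bracket ε (δ + 1) (t.toVF q δ))
    (hb : b.toVF (Sum.elim q q) (ε + δ) =
      sgn ε • (s.tangent.derived (Sum.elim q q) (Q.prolong.regroup (parityRev_elim q)) ε).bracket ε
        (δ + 1) (t.core.toVF (Sum.elim q q) δ)) : b = w.core := by
  apply Sec.toVF_injective (q := Sum.elim q q) (ε + δ)
  rw [hb, Sec.derived_tangent hQ hs, Sec.toVF_core, Sec.toVF_core, hw,
    VF.regroup_bracket _ (hs.derived hQ).prolong ht.toVF.vlift, VF.prolong_bracket_vlift,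
    VF.vlift_smul, VF.regroup_smul]

theorem Sec.eq_zero_of_derived (hQ : Q.HasParity 1) (hs : s.HasParity q ε)
    (ht : t.HasParity q δ)
    (hb : b.toVF (Sum.elim q q) (ε + δ) =
      sgn ε • (s.core.derived (Sum.elim q q) (Q.prolong.regroup (parityRev_elim q)) ε).bracket ε
        (δ + 1) (t.core.toVF (Sum.elim q q) δ)) : b = 0 := by
  apply Sec.toVF_injective (q := Sum.elim q q) (ε + δ)
  rw [hb, Sec.derived_core hQ hs, Sec.toVF_core,
    VF.regroup_bracket _ (hs.derived hQ).vlift ht.toVF.vlift, VF.vlift_bracket_vlift]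
  have h0 := Sec.toVF_smul (q := Sum.elim q q) (ε + δ) 0 (0 : Sec (κ ⊕ κ) (tan V))
  rw [zero_smul, zero_smul] at h0
  rw [h0, ← VF.regroup_smul, smul_zero]
  exact funext fun B => map_zero _

end Bracket

end TangentSections

/-! ### The algebroid given by the prolonged field is a tangent prolongation. -/

section Prolongation

variable {ι κ : Type*} {p : ι → ZMod 2} {q : κ → ZMod 2} [Fintype ι] [Fintype κ]
  [DecidableEq ι] [DecidableEq κ] {E : Bundle.{u} p q}

theorem Bundle.regroupVF_restr (Q : E.parityRev.total.VField) {α : E.base.Chart}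
    {V : Opens (Ev p → ℝ)} (hV : V ≤ E.base.dom α) :
    VF.restr (cyl_mono (cyl_mono hV p) (fun k => Sum.elim q q k + 1)) (E.regroupVF Q.prolong α) =
      (VF.restr (cyl_mono hV (fun k => q k + 1)) (Q α)).prolong.regroup (parityRev_elim q) :=
  (VF.regroup_restr (parityRev_elim q) hV (Q.prolong α)).trans
    (congrArg (VF.regroup (parityRev_elim q))
      (VF.prolong_restr (cyl_mono hV (fun k => q k + 1)) (Q α)))

/-- The Lie algebroid given by the tangent prolongation of `Q` is a tangent prolongation. -/
theorem LieAlgebroid.IsGivenBy.isTangentProlongation {A : LieAlgebroid E}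
    {Q : E.parityRev.total.VField} (hA : A.IsGivenBy Q)
    (hQ : E.parityRev.total.IsHomological Q) {L : LieAlgebroid E.tangent}
    (hL : L.IsGivenBy (E.regroupVF Q.prolong)) : A.IsTangentProlongation L := by
  have hodd : ∀ (α : E.base.Chart) (V : Opens (Ev p → ℝ)) (hV : V ≤ E.base.dom α),
      (VF.restr (cyl_mono hV (fun k => q k + 1)) (Q α)).HasParity 1 := fun α V hV =>
    VF.HasParity.restr (hQ.odd α) (cyl_mono hV _)
  -- The hypothesis on `L` involves the restriction of the regrouped prolongation. By
  -- `Bundle.regroupVF_restr` it is restated with the prolongation of the restricted field, to which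
  -- the lifting lemmas apply.
  have hanchor : ∀ (α : E.base.Chart) (V : Opens (Ev p → ℝ)) (hV : V ≤ E.base.dom α) (ε : ZMod 2)
      (s : Sec (κ ⊕ κ) (tan V)), s.HasParity (Sum.elim q q) ε → ∀ f : SF (tan V),
      (pr (tan V) (fun k => Sum.elim q q k + 1)).pull
        (VF.apply (L.anchor α (tan V) (cyl_mono hV p) s) f) =
      (s.derived (Sum.elim q q) ((VF.restr (cyl_mono hV (fun k => q k + 1)) (Q α)).prolong.regroup
        (parityRev_elim q)) ε).apply ((pr (tan V) (fun k => Sum.elim q q k + 1)).pull f) :=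
    fun α V hV ε s hs f => (hL.anchor_eq α (tan V) (cyl_mono hV p) ε s hs f).trans
      (congrArg (fun X => VF.apply (s.derived (Sum.elim q q) X ε) _)
        (Bundle.regroupVF_restr Q hV))
  have hbracket : ∀ (α : E.base.Chart) (V : Opens (Ev p → ℝ)) (hV : V ≤ E.base.dom α)
      (ε δ : ZMod 2) (s t : Sec (κ ⊕ κ) (tan V)), s.HasParity (Sum.elim q q) ε →
      t.HasParity (Sum.elim q q) δ →
      Sec.toVF (Sum.elim q q) (ε + δ) (L.bracket α (tan V) (cyl_mono hV p) s t) =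
      sgn ε • (s.derived (Sum.elim q q) ((VF.restr (cyl_mono hV (fun k => q k + 1))
        (Q α)).prolong.regroup (parityRev_elim q)) ε).bracket ε (δ + 1)
          (t.toVF (Sum.elim q q) δ) :=
    fun α V hV ε δ s t hs ht => (hL.bracket_eq α (tan V) (cyl_mono hV p) ε δ s t hs ht).trans
      (congrArg (fun X => sgn ε • VF.bracket ε (δ + 1) (s.derived (Sum.elim q q) X ε) _)
        (Bundle.regroupVF_restr Q hV))
  refine ⟨fun α V hV s => ?_, fun α V hV s => ?_, fun α V hV s t => ?_, fun α V hV s t => ?_,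
    fun α V hV s t => ?_⟩
  -- The derived formulas speak of homogeneous sections, while a tangent prolongation is defined by
  -- all sections; both sides being additive, the homogeneous case suffices. The other four clauses
  -- are treated alike.
  · refine Sec.homogeneous_induction q (C := fun s =>
      L.anchor α (tan V) (cyl_mono hV p) s.tangent = (A.anchor α V hV s).prolong)
      (fun s t hs ht => ?_) (fun ε s hs => ?_) s
    · rw [Sec.tangent_add, map_add, map_add, VF.prolong_add, ← hs, ← ht]
    · refine VF.eq_prolong (hA.anchor_eq α V hV ε s hs) fun f => ?_
      exact (hanchor α V hV ε _ hs.tangent f).trans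
        (congrArg (fun X => VF.apply X _) (Sec.derived_tangent (hodd α V hV) hs))
  · refine Sec.homogeneous_induction q (C := fun s =>
      L.anchor α (tan V) (cyl_mono hV p) s.core = (A.anchor α V hV s).vlift)
      (fun s t hs ht => ?_) (fun ε s hs => ?_) s
    · rw [Sec.core_add, map_add, map_add, VF.vlift_add, ← hs, ← ht]
    · refine VF.eq_vlift (hA.anchor_eq α V hV ε s hs) fun f => ?_
      exact (hanchor α V hV ε _ hs.core f).trans
        (congrArg (fun X => VF.apply X _) (Sec.derived_core (hodd α V hV) hs))
  · refine Sec.homogeneous_induction q (C := fun s =>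
      L.bracket α (tan V) (cyl_mono hV p) s.tangent t.tangent = (A.bracket α V hV s t).tangent)
      (fun s s' hs hs' => ?_) (fun ε s hs => ?_) s
    · rw [Sec.tangent_add, map_add, map_add, LinearMap.add_apply, LinearMap.add_apply,
        Sec.tangent_add, ← hs, ← hs']
    refine Sec.homogeneous_induction q (C := fun t =>
      L.bracket α (tan V) (cyl_mono hV p) s.tangent t.tangent = (A.bracket α V hV s t).tangent)
      (fun t t' ht ht' => ?_) (fun δ t ht => ?_) t
    · rw [Sec.tangent_add, map_add, map_add, Sec.tangent_add, ← ht, ← ht']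
    · exact Sec.eq_tangent_of_derived (hodd α V hV) hs ht (hA.bracket_eq α V hV ε δ s t hs ht)
        (hbracket α V hV ε δ _ _ hs.tangent ht.tangent)
  · refine Sec.homogeneous_induction q (C := fun s =>
      L.bracket α (tan V) (cyl_mono hV p) s.tangent t.core = (A.bracket α V hV s t).core)
      (fun s s' hs hs' => ?_) (fun ε s hs => ?_) s
    · rw [Sec.tangent_add, map_add, map_add, LinearMap.add_apply, LinearMap.add_apply,
        Sec.core_add, ← hs, ← hs']
    refine Sec.homogeneous_induction q (C := fun t =>
      L.bracket α (tan V) (cyl_mono hV p) s.tangent t.core = (A.bracket α V hV s t).core)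
      (fun t t' ht ht' => ?_) (fun δ t ht => ?_) t
    · rw [Sec.core_add, map_add, map_add, Sec.core_add, ← ht, ← ht']
    · exact Sec.eq_core_of_derived (hodd α V hV) hs ht (hA.bracket_eq α V hV ε δ s t hs ht)
        (hbracket α V hV ε δ _ _ hs.tangent ht.core)
  · refine Sec.homogeneous_induction q (C := fun s =>
      L.bracket α (tan V) (cyl_mono hV p) s.core t.core = 0)
      (fun s s' hs hs' => ?_) (fun ε s hs => ?_) s
    · rw [Sec.core_add, map_add, LinearMap.add_apply, hs, hs', add_zero]
    refine Sec.homogeneous_induction q (C := fun t =>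
      L.bracket α (tan V) (cyl_mono hV p) s.core t.core = 0)
      (fun t t' ht ht' => ?_) (fun δ t ht => ?_) t
    · rw [Sec.core_add, map_add, ht, ht', add_zero]
    · exact Sec.eq_zero_of_derived (hodd α V hV) hs ht
        (hbracket α V hV ε δ _ _ hs.core ht.core)

end Prolongation

/-! ## Uniqueness of the tangent prolongation -/

section Uniqueness

variable {ι κ : Type*} {p : ι → ZMod 2} {q : κ → ZMod 2} [Fintype ι] [Fintype κ]
  [DecidableEq ι] [DecidableEq κ]

theorem LieAlgebroid.ext {F : Bundle.{u} p q} {L L' : LieAlgebroid F}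
    (h : ∀ α V hV, L.anchor α V hV = L'.anchor α V hV)
    (h' : ∀ α V hV, L.bracket α V hV = L'.bracket α V hV) : L = L' := by
  have h1 : L.anchor = L'.anchor := by
    funext α V hV
    exact h α V hV
  have h2 : L.bracket = L'.bracket := by
    funext α V hV
    exact h' α V hV
  cases L
  cases L'
  cases h1
  cases h2
  rfl

/-- The bracket is determined by the anchor and the brackets of the sections of a frame. -/
theorem LieAlgebroid.bracket_eq_of_basis {F : Bundle.{u} p q} {L L' : LieAlgebroid F}
    {α : F.base.Chart} {V : Opens (Ev p → ℝ)} {hV : V ≤ F.base.dom α}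
    (ha : L.anchor α V hV = L'.anchor α V hV)
    (hb : ∀ k l, L.bracket α V hV (Sec.basis V k) (Sec.basis V l) =
      L'.bracket α V hV (Sec.basis V k) (Sec.basis V l)) :
    L.bracket α V hV = L'.bracket α V hV := by
  -- The Leibniz rule expands the right argument only, for a homogeneous left argument. The left
  -- argument is reached afterwards by skew-symmetry and a second use of this step.
  have step : ∀ (ε : ZMod 2) (s : Sec κ V), s.HasParity q ε →
      (∀ l, L.bracket α V hV s (Sec.basis V l) = L'.bracket α V hV s (Sec.basis V l)) →
      L.bracket α V hV s = L'.bracket α V hV s := by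
    intro ε s hs h
    refine LinearMap.ext fun t => ?_
    rw [Sec.eq_sum_basis t, map_sum, map_sum]
    refine Finset.sum_congr rfl fun l _ => ?_
    generalize t l = f
    induction f using SF.homogeneous_induction with
    | add f g hf hg => rw [add_smul, map_add, map_add, hf, hg]
    | hom δ f hf => rw [L.leibniz α V hV ε δ s _ f hs hf, L'.leibniz α V hV ε δ s _ f hs hf, ha, h]
  refine LinearMap.ext fun s => Sec.homogeneous_induction q
    (C := fun s => L.bracket α V hV s = L'.bracket α V hV s) (fun s t hs ht => ?_)
    (fun ε s hs => step ε s hs fun l => ?_) s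
  · rw [map_add, map_add, hs, ht]
  · rw [L.bracket_skew α V hV ε (q l) s _ hs (Sec.hasParity_basis l),
      L'.bracket_skew α V hV ε (q l) s _ hs (Sec.hasParity_basis l),
      step (q l) _ (Sec.hasParity_basis l) fun k => hb l k]

theorem LieAlgebroid.anchor_eq_of_basis {F : Bundle.{u} p q} {L L' : LieAlgebroid F}
    {α : F.base.Chart} {V : Opens (Ev p → ℝ)} {hV : V ≤ F.base.dom α}
    (h : ∀ k, L.anchor α V hV (Sec.basis V k) = L'.anchor α V hV (Sec.basis V k)) :
    L.anchor α V hV = L'.anchor α V hV := by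
  refine LinearMap.ext fun s => ?_
  rw [Sec.eq_sum_basis s, map_sum, map_sum]
  exact Finset.sum_congr rfl fun k _ => by rw [map_smul, map_smul, h]

/-- Applied to the change from a chart to itself, over nested open sets: compatibility with changes
of charts then says that anchor and bracket commute with restriction. -/
theorem Sec.agree_iff_of_one {V V' : Opens (Ev p → ℝ)} {φ : Mor V V'} {T : κ → κ → SF V}
    (hT : ∀ i j, T i j = if i = j then 1 else 0) (hφ : ∀ A, φ.comp A = coord V A)
    (h : V ≤ V') (s : Sec κ V) (s' : Sec κ V') :
    Sec.Agree φ T s s' ↔ s = fun k => res h (s' k) := by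
  have e : ∀ j, ∑ i, s i * T i j = s j := fun j => by
    rw [Finset.sum_eq_single j]
    · rw [hT, if_pos rfl, mul_one]
    · intro i _ hi
      rw [hT, if_neg hi, mul_zero]
    · simp
  simp only [Sec.Agree, e, Mor.pull_eq_res φ h hφ]
  exact ⟨fun H => funext fun j => (H j).symm, fun H j => (congrFun H j).symm⟩

theorem VF.Related.eq_restr {V V' : Opens (Ev p → ℝ)} {φ : Mor V V'}
    (hφ : ∀ A, φ.comp A = coord V A) (h : V ≤ V') {X : VF V} {Y : VF V'}
    (H : VF.Related φ X Y) : X = Y.restr h := by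
  funext A
  rw [← VF.apply_coord X, ← hφ, H A, Mor.pull_eq_res φ h hφ]
  rfl

theorem Sec.basis_res {V V' : Opens (Ev p → ℝ)} (h : V ≤ V') (k : κ) :
    (fun l => res h (Sec.basis V' k l)) = Sec.basis V k := by
  funext l
  rw [Sec.basis_apply, Sec.basis_apply]
  split_ifs
  · exact map_one _
  · exact map_zero _

/-! ### Reduction to frames over whole charts. -/

section Localization

variable {F : Bundle.{u} p q} {α : F.base.Chart} {V V' : Opens (Ev p → ℝ)}

theorem Bundle.IsVectorBundle.le_ov (hF : F.IsVectorBundle) (hV : V ≤ F.base.dom α) :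
    V ≤ F.base.ov α α :=
  hV.trans (hF.base_isSupermanifold.ov_self α).ge

theorem Bundle.IsVectorBundle.tr_mem (hF : F.IsVectorBundle) (h : V ≤ V')
    (hV : V ≤ F.base.ov α α) (x : V) : (F.base.tr α α).point ⟨x, hV x.2⟩ ∈ V' := by
  rw [point_eq_self _ (hF.base_isSupermanifold.tr_self α)]
  exact h x.2

theorem Bundle.IsVectorBundle.tr_restr_comp (hF : F.IsVectorBundle) (hV : V ≤ F.base.ov α α)
    (hm : ∀ x : V, (F.base.tr α α).point ⟨x, hV x.2⟩ ∈ V') (A : ι) :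
    ((F.base.tr α α).restr hV hm).comp A = coord V A := by
  rw [Mor.restr_comp, hF.base_isSupermanifold.tr_self, res_coord]

theorem Bundle.IsVectorBundle.res_trans_self (hF : F.IsVectorBundle) (hV : V ≤ F.base.ov α α)
    (i j : κ) : res hV (F.trans α α i j) = if i = j then 1 else 0 := by
  rw [hF.trans_self]
  split_ifs
  · exact map_one _
  · exact map_zero _

theorem LieAlgebroid.anchor_basis_restr (hF : F.IsVectorBundle) (L : LieAlgebroid F)
    (hV' : V' ≤ F.base.dom α) (h : V ≤ V') (k : κ) :
    L.anchor α V (h.trans hV') (Sec.basis V k) =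
      (L.anchor α V' hV' (Sec.basis V' k)).restr h := by
  have hV := hF.le_ov (h.trans hV')
  have hm := hF.tr_mem h hV
  exact VF.Related.eq_restr (hF.tr_restr_comp hV hm) h
    (L.anchor_agree α α V V' hV hV' hm _ _ ((Sec.agree_iff_of_one (hF.res_trans_self hV)
      (hF.tr_restr_comp hV hm) h _ _).2 (Sec.basis_res h k).symm))

theorem LieAlgebroid.bracket_basis_restr (hF : F.IsVectorBundle) (L : LieAlgebroid F)
    (hV' : V' ≤ F.base.dom α) (h : V ≤ V') (k l : κ) :
    L.bracket α V (h.trans hV') (Sec.basis V k) (Sec.basis V l) =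
      fun j => res h (L.bracket α V' hV' (Sec.basis V' k) (Sec.basis V' l) j) := by
  have hV := hF.le_ov (h.trans hV')
  have hm := hF.tr_mem h hV
  have hiff := Sec.agree_iff_of_one (hF.res_trans_self hV) (hF.tr_restr_comp hV hm) h
  exact (hiff _ _).1 (L.bracket_agree α α V V' hV hV' hm _ _ _ _
    ((hiff _ _).2 (Sec.basis_res h k).symm) ((hiff _ _).2 (Sec.basis_res h l).symm))

/-- A Lie algebroid structure is determined by its values on the frames over the charts. -/
theorem LieAlgebroid.ext_basis (hF : F.IsVectorBundle) {L L' : LieAlgebroid F}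
    (ha : ∀ α k, L.anchor α (F.base.dom α) le_rfl (Sec.basis _ k) =
      L'.anchor α (F.base.dom α) le_rfl (Sec.basis _ k))
    (hb : ∀ α k l, L.bracket α (F.base.dom α) le_rfl (Sec.basis _ k) (Sec.basis _ l) =
      L'.bracket α (F.base.dom α) le_rfl (Sec.basis _ k) (Sec.basis _ l)) : L = L' := by
  have ha' : ∀ α V hV, L.anchor α V hV = L'.anchor α V hV := fun α V hV =>
    LieAlgebroid.anchor_eq_of_basis fun k => by
      rw [L.anchor_basis_restr hF le_rfl hV, L'.anchor_basis_restr hF le_rfl hV, ha]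
  exact LieAlgebroid.ext ha' fun α V hV =>
    LieAlgebroid.bracket_eq_of_basis (ha' α V hV) fun k l => by
      rw [L.bracket_basis_restr hF le_rfl hV, L'.bracket_basis_restr hF le_rfl hV, hb]

end Localization

/-- The tangent prolongation of a Lie algebroid is unique. -/
theorem LieAlgebroid.IsTangentProlongation.unique {E : Bundle.{u} p q} (hE : E.IsVectorBundle)
    {A : LieAlgebroid E} {L L' : LieAlgebroid E.tangent} (hL : A.IsTangentProlongation L)
    (hL' : A.IsTangentProlongation L') : L = L' := by
  -- The definition prescribes brackets of a tangent section with a core section in this order only;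
  -- the opposite order is recovered by skew-symmetry.
  have hskew : ∀ (M : LieAlgebroid E.tangent) (α : E.base.Chart) (k l : κ ⊕ κ),
      M.bracket α (tan (E.base.dom α)) le_rfl (Sec.basis _ k) (Sec.basis _ l) =
        -(sgn (Sum.elim q q k * Sum.elim q q l) •
          M.bracket α (tan (E.base.dom α)) le_rfl (Sec.basis _ l) (Sec.basis _ k)) :=
    fun M α k l => M.bracket_skew α _ le_rfl _ _ _ _ (Sec.hasParity_basis k) (Sec.hasParity_basis l)
  have htc : ∀ (α : E.base.Chart) (k l : κ),
      L.bracket α (tan (E.base.dom α)) le_rfl (Sec.basis _ (Sum.inl k)) (Sec.basis _ (Sum.inr l)) =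
      L'.bracket α (tan (E.base.dom α)) le_rfl (Sec.basis _ (Sum.inl k))
        (Sec.basis _ (Sum.inr l)) := fun α k l => by
    rw [← Sec.tangent_basis, ← Sec.core_basis]
    exact (hL.tangent_core α _ le_rfl _ _).trans (hL'.tangent_core α _ le_rfl _ _).symm
  refine LieAlgebroid.ext_basis hE.tangent (fun (α : E.base.Chart) k => ?_)
    (fun (α : E.base.Chart) k l => ?_)
  · change L.anchor α (tan (E.base.dom α)) le_rfl (Sec.basis _ k) =
      L'.anchor α (tan (E.base.dom α)) le_rfl (Sec.basis _ k)
    cases k with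
    | inl k =>
      rw [← Sec.tangent_basis]
      exact (hL.anchor_tangent α _ le_rfl _).trans (hL'.anchor_tangent α _ le_rfl _).symm
    | inr k =>
      rw [← Sec.core_basis]
      exact (hL.anchor_core α _ le_rfl _).trans (hL'.anchor_core α _ le_rfl _).symm
  · change L.bracket α (tan (E.base.dom α)) le_rfl (Sec.basis _ k) (Sec.basis _ l) =
      L'.bracket α (tan (E.base.dom α)) le_rfl (Sec.basis _ k) (Sec.basis _ l)
    rcases k with k | k <;> rcases l with l | l
    · rw [← Sec.tangent_basis, ← Sec.tangent_basis]
      exact (hL.tangent_tangent α _ le_rfl _ _).trans (hL'.tangent_tangent α _ le_rfl _ _).symm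
    · exact htc α k l
    · rw [hskew L, hskew L', htc]
    · rw [← Sec.core_basis, ← Sec.core_basis]
      exact (hL.core_core α _ le_rfl _ _).trans (hL'.core_core α _ le_rfl _ _).symm

end Uniqueness

end SuperGeom

end

theorem proposition4p2 {ι κ : Type*} [Fintype ι] [Fintype κ] [DecidableEq ι] [DecidableEq κ]
    {p : ι → ZMod 2} {q : κ → ZMod 2}
    -- a vector bundle `E → M` of supermanifolds
    (E : SuperGeom.Bundle.{u} p q) (hE : E.IsVectorBundle)
    -- a Lie algebroid structure on it, given by a homological field of weight 1 on `ΠE`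
    (A : SuperGeom.LieAlgebroid E) (Q : E.parityRev.total.VField)
    (hQ : E.parityRev.total.IsHomological Q) (hQ1 : E.parityRev.HasWeight 1 1 Q)
    (hA : A.IsGivenBy Q) :
    -- `TE → TM` is a vector bundle with total space the tangent bundle of `E`,
    E.tangent.IsVectorBundle ∧
    E.total.tangent.IsDiffeo E.tangent.total (Equiv.refl _)
      (fun α => SuperGeom.regroup (E.base.dom α) q (Sum.elim q q) (fun _ => rfl))
      (fun α => SuperGeom.regroupInv (E.base.dom α) q (Sum.elim q q) (fun _ => rfl)) ∧
    -- `T(ΠE)` and `Π_{TM} TE` are supermanifolds, and they are identified by regrouping coordinates,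
    E.parityRev.total.tangent.IsSupermanifold ∧
    E.tangent.parityRev.total.IsSupermanifold ∧
    E.parityRev.total.tangent.IsDiffeo E.tangent.parityRev.total (Equiv.refl _)
      (fun α => SuperGeom.regroup (E.base.dom α) (fun k => q k + 1)
        (fun k => Sum.elim q q k + 1) (SuperGeom.parityRev_elim q))
      (fun α => SuperGeom.regroupInv (E.base.dom α) (fun k => q k + 1)
        (fun k => Sum.elim q q k + 1) (SuperGeom.parityRev_elim q)) ∧
    -- the tangent prolongation of `Q` is homological on `T(ΠE)`,
    E.parityRev.total.tangent.IsHomological Q.prolong ∧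
    -- and, viewed as a field on `Π_{TM} TE`, it is homological of weight 1,
    E.tangent.parityRev.total.IsHomological (E.regroupVF Q.prolong) ∧
    E.tangent.parityRev.HasWeight 1 1 (E.regroupVF Q.prolong) ∧
    -- the tangent prolongation Lie algebroid exists and is unique, and it is the Lie algebroid
    -- given by the tangent prolongation of `Q`
    (∃! L : SuperGeom.LieAlgebroid E.tangent, A.IsTangentProlongation L) ∧
    ∀ L : SuperGeom.LieAlgebroid E.tangent,
      A.IsTangentProlongation L ↔ L.IsGivenBy (E.regroupVF Q.prolong) := by
  -- On each chart, `Q` has basic fibre derivatives of the required orders because it gives `A`; its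
  -- prolongation inherits this, so it gives a Lie algebroid on `TE`.
  have hdom := fun α : E.base.Chart => (hA.isDerived hQ α).regroup_prolong
  have hQ' := SuperGeom.Bundle.regroupVF_homological hQ
  have hgiven := SuperGeom.LieAlgebroid.ofVF_isGivenBy E.tangent (E.regroupVF Q.prolong) hQ' hdom
  have hprol := hA.isTangentProlongation hQ hgiven
  refine ⟨hE.tangent,
    SuperGeom.Bundle.isDiffeo_regroup E _ (fun _ => rfl) E.tangent.trans_parity,
    hE.parityRev.total.tangent, hE.tangent.parityRev.total,
    SuperGeom.Bundle.isDiffeo_regroup E.parityRev _ (SuperGeom.parityRev_elim q)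
      E.tangent.parityRev.trans_parity,
    hQ.prolong, hQ', SuperGeom.Bundle.regroupVF_hasWeight hQ hQ1,
    ⟨_, hprol, fun L hL => hL.unique hE hprol⟩, fun L => ⟨fun hL => ?_, hA.isTangentProlongation hQ⟩⟩
  -- By uniqueness, `L` is the algebroid constructed from the prolonged field.
  rw [hL.unique hE hprol]
  exact hgiven
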